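/- Let $F_{\mathrm{cl}}=\mathbb R^4$ with orthonormal basis $e_1,\dots,e_4$, and let $\tilde F=F_{\mathrm{cl}}\oplus\mathbb R\delta\oplus\mathbb Ra\oplus\mathbb R\Lambda_0$ carry the symmetric bilinear form $\tilde I$ that extends the Euclidean one, with $\tilde I(\delta,\Lambda_0)=1$ and all other products among $F_{\mathrm{cl}},\delta,a,\Lambda_0$ equal to $0$ (the hyperbolic extension of the marked elliptic root system of type $D_4^{(1,1)}$). Let $\alpha_1=e_1-e_2$, $\alpha_2=e_2-e_3$, $\alpha_3=e_3-e_4$, $\alpha_4=e_3+e_4$, $\alpha_0=\delta-e_1-e_2$. Let $W_{\mathrm{af}}\subset GL(\tilde F)$ be the affine Weyl group generated by the reflections $u\mapsto u-\tilde I(u,\alpha_i^\vee)\alpha_i$ $(0\le i\le 4)$, where $\alpha^\vee=2\alpha/\tilde I(\alpha,\alpha)$, and let $\varepsilon:W_{\mathrm{af}}\to\{\pm1\}$ be the parity of the number of reflections. Let $\Lambda_0$, $\Lambda_1=\Lambda_0+e_1$, $\Lambda_2=2\Lambda_0+e_1+e_2$, $\Lambda_3=\Lambda_0+\tfrac12(e_1+e_2+e_3-e_4)$,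 $\Lambda_4=\Lambda_0+\tfrac12(e_1+e_2+e_3+e_4)$ be the fundamental weights and $\rho=\sum_{i=0}^4\Lambda_i$. Let $\mathbb H=\{\tau\in\mathbb C:\operatorname{Im}\tau>0\}$ and $q=e^{2\pi\sqrt{-1}\tau}$ (with $q^s=e^{2\pi\sqrt{-1}s\tau}$). Let $Y$ be the set of $\mathbb R$-linear maps $x:\tilde F\to\mathbb C$ with $\langle a,x\rangle=-2\pi\sqrt{-1}$ and $\operatorname{Re}\langle\delta,x\rangle>0$, identified with $\mathbb H\times\mathbb C^4\times\mathbb C\ni(\tau,z,t)$ by $\langle\delta,x\rangle=-2\pi\sqrt{-1}\,\tau$, $\langle e_j,x\rangle=2\pi\sqrt{-1}\,z_j$, $\langle\Lambda_0,x\rangle=2\pi\sqrt{-1}\,t$, and write $e^v$ for the function $x\mapsto e^{\langle v,x\rangle}$ on $Y$. For $i=0,1$ let $ch_{\Lambda_i}$ be the holomorphic function on $Y$ with $$ch_{\Lambda_i}\cdot\sum_{w\in W_{\mathrm{af}}}\varepsilon(w)e^{w(\rho)}=\sum_{w\in W_{\mathrm{af}}}\varepsilon(w)e^{w(\rho+\Lambda_i)},$$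 and put $$\chi_{\Lambda_i}=e^{-m_{\Lambda_i}\delta}ch_{\Lambda_i},\qquad m_{\Lambda_i}=\frac{\tilde I(\Lambda_i+\rho,\Lambda_i+\rho)}{2\tilde I(\Lambda_i+\rho,\delta)}-\frac{\tilde I(\rho,\rho)}{2\tilde I(\rho,\delta)},\qquad \chi^0_{\Lambda_i}(\tau)=\chi_{\Lambda_i}(\tau,0,0).$$ On $\mathbb H$ let $f'=q\frac{d}{dq}f=\frac1{2\pi\sqrt{-1}}\frac{df}{d\tau}$, $\eta=q^{1/24}\prod_{n\ge1}(1-q^n)$, and $$\theta_2=\sum_{n\in\mathbb Z}q^{(n-1/2)^2/2},\quad \theta_3=\sum_{n\in\mathbb Z}q^{n^2/2},\quad \theta_4=\sum_{n\in\mathbb Z}(-1)^nq^{n^2/2},\qquad \xi_i=2(\log\theta_i)'=2\theta_i'/\theta_i\ (i=2,3,4).$$ Then these objects are well defined (for $i=0,1$ the holomorphic function $ch_{\Lambda_i}$ on $Y$ exists and is unique, and $\theta_2,\theta_3,\theta_4$ have no zeros on $\mathbb H$), and on $\mathbb H$ $$\eta^4\chi^0_{\Lambda_0}=4\xi_2-2\xi_3-2\xi_4,\qquad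 \eta^4\chi^0_{\Lambda_1}=2\xi_3-2\xi_4,\qquad \frac{\eta'}{\eta}=\frac16(\xi_2+\xi_3+\xi_4).$$ -/

import Mathlib

noncomputable section

namespace EllipticD4

open Complex
open UpperHalfPlane hiding I

/-! ### The hyperbolic extension of the marked elliptic root system of type `D₄^(1,1)` -/

/-- The real vector space `F̃ = F_cl ⊕ ℝδ ⊕ ℝa ⊕ ℝΛ₀` of dimension `4 + 3`; an element
`(v, m, n, k)` is `v + m δ + n a + k Λ₀`, where `v ∈ F_cl = ℝ⁴` is written in an orthonormal
basis `e₁, …, e₄`. -/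
abbrev HypSpace : Type := (Fin 4 → ℝ) × ℝ × ℝ × ℝ

/-- The symmetric bilinear form `Ĩ`: Euclidean on `F_cl`, `Ĩ(δ, Λ₀) = 1`, all the other products
of `F_cl`, `δ`, `a`, `Λ₀` being zero. Its radical is `ℝa`, and the radical of its restriction to
`F = F_cl ⊕ ℝδ ⊕ ℝa` is `ℝδ ⊕ ℝa`. -/
def form : HypSpace →ₗ[ℝ] HypSpace →ₗ[ℝ] ℝ :=
  LinearMap.mk₂ ℝ (fun u v => u.1 ⬝ᵥ v.1 + u.2.1 * v.2.2.2 + u.2.2.2 * v.2.1)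
    (fun u u' v => by simp [add_dotProduct]; ring)
    (fun c u v => by simp [smul_dotProduct]; ring)
    (fun u v v' => by simp [dotProduct_add]; ring)
    (fun c u v => by simp [dotProduct_smul]; ring)

/-- The null root `δ`. -/
def delta : HypSpace := (0, 1, 0, 0)

/-- The inclusion `F_cl → F̃`. -/
def ofCl (v : Fin 4 → ℝ) : HypSpace := (v, 0, 0, 0)

/-- The simple roots `α₀ = δ - θ`, `α₁ = e₁ - e₂`, `α₂ = e₂ - e₃`, `α₃ = e₃ - e₄`,
`α₄ = e₃ + e₄`, where `θ = e₁ + e₂` is the highest root of `D₄`. -/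
def simpleRoot : Fin 5 → HypSpace :=
  ![delta - ofCl ![1, 1, 0, 0], ofCl ![1, -1, 0, 0], ofCl ![0, 1, -1, 0], ofCl ![0, 0, 1, -1],
    ofCl ![0, 0, 1, 1]]

/-- The coroot `α^∨ = 2α / Ĩ(α, α)`. -/
def coroot (v : HypSpace) : HypSpace := (2 / form v v) • v

/-- The fundamental weights `Λ₀` and `Λᵢ = aᵢ^∨ Λ₀ + ωᵢ`, with the colabels
`(a₀^∨, …, a₄^∨) = (1, 1, 2, 1, 1)` and the fundamental weights `ω₁, …, ω₄` of `D₄`. -/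
def fundWeight : Fin 5 → HypSpace :=
  ![(0, 0, 0, 1), (![1, 0, 0, 0], 0, 0, 1), (![1, 1, 0, 0], 0, 0, 2),
    (![1 / 2, 1 / 2, 1 / 2, -1 / 2], 0, 0, 1), (![1 / 2, 1 / 2, 1 / 2, 1 / 2], 0, 0, 1)]

/-- `ρ = Λ₀ + ⋯ + Λ₄`. -/
def rho : HypSpace := ∑ i, fundWeight i

lemma form_simpleRoot_self (i : Fin 5) : form (simpleRoot i) (simpleRoot i) = 2 := by
  fin_cases i <;>
    simp [form, simpleRoot, ofCl, delta, dotProduct, Fin.sum_univ_four] <;> norm_num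

lemma form_coroot_self (i : Fin 5) : form (coroot (simpleRoot i)) (simpleRoot i) = 2 := by
  simp [coroot, form_simpleRoot_self]

/-- The fundamental weights are dual to the simple coroots. -/
lemma form_fundWeight_coroot (i j : Fin 5) :
    form (fundWeight i) (coroot (simpleRoot j)) = if i = j then 1 else 0 := by
  rw [coroot, form_simpleRoot_self]
  fin_cases i <;> fin_cases j <;>
    simp [form, simpleRoot, fundWeight, ofCl, delta, dotProduct, Fin.sum_univ_four] <;> norm_num

/-! ### The affine Weyl group -/

/-- The simple reflection `u ↦ u - Ĩ(αᵢ^∨, u) αᵢ` of `F̃`. -/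
def simpleReflection (i : Fin 5) : HypSpace ≃ₗ[ℝ] HypSpace :=
  Module.reflection (form_coroot_self i)

/-- The affine Weyl group `W_af`, generated by the simple reflections. -/
def affineWeyl : Subgroup (HypSpace ≃ₗ[ℝ] HypSpace) :=
  Subgroup.closure (Set.range simpleReflection)

/-- The sign character `ε : W_af → {±1}`, the parity of the number of reflections in a word for
`w`. It is the determinant on `F̃`: a group homomorphism that takes the value `-1` on each
reflection (`sign_simpleReflection`). -/
def sign (w : affineWeyl) : ℝ := LinearMap.det (w : HypSpace ≃ₗ[ℝ] HypSpace).toLinearMap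

lemma sign_one : sign 1 = 1 := by
  simp [sign]

lemma sign_mul (v w : affineWeyl) : sign (v * w) = sign v * sign w := by
  simp [sign]

lemma sign_simpleReflection (i : Fin 5) :
    sign ⟨simpleReflection i, Subgroup.subset_closure ⟨i, rfl⟩⟩ = -1 := by
  have h : (simpleReflection i).toLinearMap =
      LinearMap.transvection (-form (coroot (simpleRoot i))) (simpleRoot i) := by
    ext1 <;> ext <;>
      simp [simpleReflection, Module.reflection_apply, LinearMap.transvection.apply, sub_eq_add_neg]
  rw [sign, h, LinearMap.transvection.det]
  simp [form_coroot_self]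
  norm_num

/-! ### The domain `Y` and the characters -/

/-- The domain `Y` of all real linear `x : F̃ → ℂ` with `⟨a, x⟩ = -2πi` and `Re ⟨δ, x⟩ > 0`, in its
coordinates `(τ, z, t) ∈ ℍ × 𝔥_ℂ × ℂ`, as an open subset of `ℂ × ℂ⁴ × ℂ`. -/
def domainY : Set (ℂ × (Fin 4 → ℂ) × ℂ) := {p | 0 < p.1.im}

/-- The pairing `⟨v, x⟩` of `v ∈ F̃` with the point `x ∈ Y` of coordinates `(τ, z, t)`: here
`⟨a, x⟩ = -2πi`, `⟨δ, x⟩ = -2πiτ`, `⟨eⱼ, x⟩ = 2πi zⱼ` and `⟨Λ₀, x⟩ = 2πi t`. -/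
def pairing (v : HypSpace) (p : ℂ × (Fin 4 → ℂ) × ℂ) : ℂ :=
  2 * Real.pi * I * (∑ j, v.1 j * p.2.1 j - v.2.1 * p.1 - v.2.2.1 + v.2.2.2 * p.2.2)

/-- The alternating sum `∑_{w ∈ W_af} ε(w) e^{w(lam)}`. -/
def altSum (lam : HypSpace) (p : ℂ × (Fin 4 → ℂ) × ℂ) : ℂ :=
  ∑' w : affineWeyl, (sign w : ℂ) * exp (pairing (w.1 lam) p)

/-- `f` is the holomorphic function on `Y` that is the quotient of the alternating sums of
`ρ + Λᵢ` and `ρ`. -/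
def IsCharacter (i : Fin 5) (f : ℂ × (Fin 4 → ℂ) × ℂ → ℂ) : Prop :=
  DifferentiableOn ℂ f domainY ∧
    ∀ p ∈ domainY, f p * altSum rho p = altSum (rho + fundWeight i) p

open Classical in
/-- The character `ch_{Λᵢ} = (∑ ε(w) e^{w(ρ + Λᵢ)}) / (∑ ε(w) e^{w(ρ)})`, the holomorphic quotient
on `Y`. -/
def ch (i : Fin 5) : ℂ × (Fin 4 → ℂ) × ℂ → ℂ :=
  if h : ∃ f, IsCharacter i f then h.choose else 0

/-- `m_{Λᵢ} = |Λᵢ + ρ|² / (2 Ĩ(Λᵢ + ρ, δ)) - |ρ|² / (2 Ĩ(ρ, δ))`. -/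
def modularAnomaly (i : Fin 5) : ℝ :=
  form (fundWeight i + rho) (fundWeight i + rho) / (2 * form (fundWeight i + rho) delta)
    - form rho rho / (2 * form rho delta)

/-- The normalized character `χ_{Λᵢ} = e^{-m_{Λᵢ} δ} ch_{Λᵢ}`. -/
def chi (i : Fin 5) (p : ℂ × (Fin 4 → ℂ) × ℂ) : ℂ :=
  exp (-(modularAnomaly i : ℂ) * pairing delta p) * ch i p

/-- `χ⁰_{Λᵢ}(τ) = χ_{Λᵢ}(τ, 0, 0)`. -/
def chiZero (i : Fin 5) (τ : ℍ) : ℂ := chi i ((τ : ℂ), 0, 0)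

/-! ### Functions on the upper half plane -/

/-- `q^s = e^{2πi s τ}` for real `s`. -/
def qPow (s : ℝ) (τ : ℍ) : ℂ := exp (2 * Real.pi * I * s * τ)

/-- `∑_{n ∈ ℤ} q^{(n - 1/2)²/2}`. -/
def theta2 (τ : ℍ) : ℂ := ∑' n : ℤ, qPow (((n : ℝ) - 1 / 2) ^ 2 / 2) τ

/-- `∑_{n ∈ ℤ} q^{n²/2}`. -/
def theta3 (τ : ℍ) : ℂ := ∑' n : ℤ, qPow ((n : ℝ) ^ 2 / 2) τ

/-- `∑_{n ∈ ℤ} (-1)^n q^{n²/2}`. -/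
def theta4 (τ : ℍ) : ℂ := ∑' n : ℤ, (-1 : ℂ) ^ n * qPow ((n : ℝ) ^ 2 / 2) τ

/-- The Dedekind eta function `q^{1/24} ∏_{n ≥ 1} (1 - q^n)` on the upper half plane. -/
def eta (τ : ℍ) : ℂ := ModularForm.eta τ

/-- The logarithmic derivative `(log f)' = f' / f` for `' = q d/dq = (2πi)⁻¹ d/dτ`. -/
def qLogDeriv (f : ℍ → ℂ) (τ : ℍ) : ℂ := Derivative.normalizedDerivOfComplex f τ / f τ

/-- The Halphen functions `ξ_i = 2 (log θ_i)'`. -/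
def xi2 : ℍ → ℂ := fun τ => 2 * qLogDeriv theta2 τ

/-- See `xi2`. -/
def xi3 : ℍ → ℂ := fun τ => 2 * qLogDeriv theta3 τ

/-- See `xi2`. -/
def xi4 : ℍ → ℂ := fun τ => 2 * qLogDeriv theta4 τ

end EllipticD4

end

/-! The group `W_af` consists of the signed permutations of four coordinates with an even number of
sign changes, combined with translations by integer vectors of even sum, and `ε` is the sign of the
permutation (`equivAffineWeyl`). Averaging over the characters of the two parity conditions makes
the alternating sum factor over the coordinates, so it becomes a combination of 4×4 determinants of
one-variable theta functions (`altSum_eq_sum_det`). For `ρ` only the determinant `detTheta 6` of the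
even theta functions of level 6 survives. At level 7 the determinants `detTheta 7` at `z` and at `z
+ 1/2` survive.

The even theta functions of level 6, and likewise of level 7, form a space with four basis elements,
as many as there are variables. Hence multiplying by `∏ ϑ(z_j)`, of level 1, turns `detTheta 6` into
a multiple of `detTheta 7` whose factor depends only on `τ` (`prod_jacobiTheta₂_mul_detTheta_six`).
The factor is again a level 6 determinant, at `(0, τ, 2τ, 3τ)` and modulus `7τ`, and the product
formula `prod_thetaPair_eq_eta`, the denominator identity of type D₄, evaluates it to a power of `q`
times `η⁴`. The characters are therefore, up to an exponential, `(∏ ϑ(z_j) ± ∏ ϑ(z_j + 1/2)) /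
(2η⁴)`. The product formula also locates the zeros of the denominator and so gives uniqueness
(`IsCharacter.eqOn`).

At `z = 0` this reads `η⁴ χ⁰ = (θ₃⁴ ± θ₄⁴) / 2`. The theorem follows from `ξ₂ - ξ₃ = θ₄⁴/4` and `ξ₂
- ξ₄ = θ₃⁴/4`, and from the logarithmic derivative of `2η³ = θ₂θ₃θ₄`. The first difference is a
Wronskian of theta constants, which a change of summation indices identifies with the square of
Jacobi's series for `η(τ/2)³` (`thetaNull_wronskian`). The second is its translate by `τ ↦ τ + 1`.
-/

noncomputable section

namespace EllipticD4

open Complex Filter Topology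

/-! ### The exponential `e^{2πiw}` -/

/-- The exponential `e^{2πiw}`. -/
def ee (w : ℂ) : ℂ := exp (2 * Real.pi * I * w)

lemma ee_add (v w : ℂ) : ee (v + w) = ee v * ee w := by
  simp only [ee, ← exp_add]; ring_nf

@[simp] lemma ee_zero : ee 0 = 1 := by simp [ee]

lemma ee_ne_zero (w : ℂ) : ee w ≠ 0 := exp_ne_zero _

lemma ee_neg (w : ℂ) : ee (-w) = (ee w)⁻¹ := by
  simp only [ee, ← exp_neg]; ring_nf

lemma ee_mul_neg (w : ℂ) : ee w * ee (-w) = 1 := by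
  rw [← ee_add, add_neg_cancel, ee_zero]

lemma ee_nat_mul (n : ℕ) (w : ℂ) : ee (n * w) = ee w ^ n := by
  simp only [ee, ← exp_nat_mul]; ring_nf

lemma ee_int_mul (n : ℤ) (w : ℂ) : ee (n * w) = ee w ^ n := by
  simp only [ee, ← exp_int_mul]; ring_nf

@[simp] lemma ee_int (n : ℤ) : ee n = 1 := by
  rw [ee, show 2 * (Real.pi : ℂ) * I * n = n * (2 * Real.pi * I) by ring]
  exact exp_int_mul_two_pi_mul_I n

lemma ee_half : ee (1 / 2) = -1 := by
  rw [ee, show 2 * (Real.pi : ℂ) * I * (1 / 2) = Real.pi * I by ring, exp_pi_mul_I]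

lemma ee_int_div_two (n : ℤ) : ee (n / 2) = (-1) ^ n := by
  rw [← ee_half, ← ee_int_mul]; ring_nf

lemma ee_eq_one_iff (w : ℂ) : ee w = 1 ↔ ∃ n : ℤ, w = n := by
  rw [ee, exp_eq_one_iff]
  refine exists_congr fun n => ?_
  rw [mul_comm (n : ℂ)]
  exact mul_right_inj' two_pi_I_ne_zero

lemma norm_ee (w : ℂ) : ‖ee w‖ = Real.exp (-2 * Real.pi * w.im) := by
  rw [ee, norm_exp]; congr 1; simp

lemma norm_ee_lt_one {τ : ℂ} (hτ : 0 < τ.im) : ‖ee τ‖ < 1 := by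
  rw [norm_ee, Real.exp_lt_one_iff]
  have := mul_pos Real.pi_pos hτ
  linarith

lemma differentiable_ee : Differentiable ℂ ee := by unfold ee; fun_prop

lemma continuous_ee : Continuous ee := differentiable_ee.continuous

lemma jacobiTheta₂_term_eq_ee (n : ℤ) (z τ : ℂ) :
    jacobiTheta₂_term n z τ = ee (n * z + n ^ 2 * τ / 2) := by
  rw [jacobiTheta₂_term, ee]; ring_nf

/-! ### The infinite q-Pochhammer symbol -/

/-- The infinite q-Pochhammer symbol `(x; q)_∞ = ∏_{n ≥ 0} (1 - x qⁿ)`. -/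
def qPoch (x q : ℂ) : ℂ := ∏' n : ℕ, (1 - x * q ^ n)

variable {q : ℂ}

lemma summable_norm_mul_pow (hq : ‖q‖ < 1) (x : ℂ) : Summable fun n : ℕ => ‖-(x * q ^ n)‖ := by
  simp only [norm_neg, norm_mul, norm_pow]
  exact (summable_geometric_of_lt_one (norm_nonneg _) hq).mul_left _

lemma multipliable_qPoch (hq : ‖q‖ < 1) (x : ℂ) : Multipliable fun n : ℕ => 1 - x * q ^ n := by
  simpa only [sub_eq_add_neg] using multipliable_one_add_of_summable (summable_norm_mul_pow hq x)

lemma qPoch_eq_one_sub_mul (hq : ‖q‖ < 1) (x : ℂ) :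
    qPoch x q = (1 - x) * qPoch (x * q) q := by
  rw [qPoch, tprod_eq_zero_mul' (by
    simpa [pow_succ', mul_assoc] using multipliable_qPoch hq (x * q))]
  simp [qPoch, pow_succ', mul_assoc]

lemma qPoch_ne_zero (hq : ‖q‖ < 1) {x : ℂ} (hx : ∀ n : ℕ, x * q ^ n ≠ 1) : qPoch x q ≠ 0 := by
  have := tprod_one_add_ne_zero_of_summable (f := fun n : ℕ => -(x * q ^ n))
    (fun n => by rw [← sub_eq_add_neg, sub_ne_zero]; exact (hx n).symm)
    (summable_norm_mul_pow hq x)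
  simpa only [qPoch, sub_eq_add_neg] using this

lemma qPoch_ne_zero_of_norm_lt_one (hq : ‖q‖ < 1) {x : ℂ} (hx : ‖x‖ < 1) : qPoch x q ≠ 0 := by
  refine qPoch_ne_zero hq fun n h => ?_
  have h1 : ‖x * q ^ n‖ < 1 := by
    rw [norm_mul, norm_pow]
    exact mul_lt_one_of_nonneg_of_lt_one_left (norm_nonneg _) hx
      (pow_le_one₀ (norm_nonneg _) hq.le)
  rw [h] at h1
  simp at h1

lemma tendsto_qPoch (hq : ‖q‖ < 1) (x : ℂ) :
    Tendsto (fun N => ∏ n ∈ Finset.range N, (1 - x * q ^ n)) atTop (𝓝 (qPoch x q)) :=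
  (multipliable_qPoch hq x).hasProd.tendsto_prod_nat

/-- Splitting the factors of `(x; q)_∞` by the exponent modulo `k`. -/
lemma prod_qPoch_pow (hq : ‖q‖ < 1) (x : ℂ) {k : ℕ} (hk : k ≠ 0) :
    ∏ r ∈ Finset.range k, qPoch (x * q ^ r) (q ^ k) = qPoch x q := by
  have hqk : ‖q ^ k‖ < 1 := by rw [norm_pow]; exact pow_lt_one₀ (norm_nonneg _) hq hk
  have h1 := tendsto_finsetProd (Finset.range k) fun r _ => tendsto_qPoch hqk (x * q ^ r)
  have h2 := (tendsto_qPoch hq x).comp (tendsto_id.atTop_mul_const' (Nat.pos_of_ne_zero hk))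
  refine tendsto_nhds_unique h1 (h2.congr fun N => ?_)
  simp only [Function.comp, id]
  induction N with
  | zero => simp
  | succ N ih =>
    rw [add_mul, one_mul, Finset.prod_range_add, ih, ← Finset.prod_mul_distrib]
    refine Finset.prod_congr rfl fun r _ => ?_
    rw [Finset.prod_range_succ]
    ring

lemma qPoch_mul_qPoch_neg (hq : ‖q‖ < 1) (x : ℂ) :
    qPoch x q * qPoch (-x) q = qPoch (x ^ 2) (q ^ 2) := by
  rw [qPoch, qPoch, ← (multipliable_qPoch hq x).tprod_mul (multipliable_qPoch hq (-x))]
  exact tprod_congr fun n => by ring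

lemma qPoch_mul_cube_roots (hq : ‖q‖ < 1) {ω : ℂ} (hω : 1 + ω + ω ^ 2 = 0) (x : ℂ) :
    qPoch x q * qPoch (ω * x) q * qPoch (ω ^ 2 * x) q = qPoch (x ^ 3) (q ^ 3) := by
  have h3 : ω ^ 3 = 1 := by linear_combination (ω - 1) * hω
  simp only [qPoch]
  rw [← (multipliable_qPoch hq x).tprod_mul (multipliable_qPoch hq _),
    ← ((multipliable_qPoch hq x).mul (multipliable_qPoch hq _)).tprod_mul
      (multipliable_qPoch hq _)]
  refine tprod_congr fun n => ?_
  linear_combination (-(x * q ^ n) + (x * q ^ n) ^ 2 * ω) * hω - (x * q ^ n) ^ 3 * h3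

/-- Serves `deriv_thetaOdd`, where continuity of the cofactor of a simple zero suffices. -/
lemma continuous_qPoch (hq : ‖q‖ < 1) : Continuous fun x => qPoch x q := by
  rw [continuous_iff_continuousAt]
  intro x₀
  have hu : Summable fun n : ℕ => (‖x₀‖ + 1) * ‖q‖ ^ n :=
    (summable_geometric_of_lt_one (norm_nonneg _) hq).mul_left _
  have h := Summable.hasProdLocallyUniformlyOn_nat_one_add (f := fun (n : ℕ) (x : ℂ) => -(x * q ^ n))
    (Metric.isOpen_ball (x := x₀) (ε := 1)) hu
    (Eventually.of_forall fun n x hx => by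
      rw [norm_neg, norm_mul, norm_pow]
      gcongr
      have := norm_sub_norm_le x x₀
      have hx' := mem_ball_iff_norm.1 hx
      linarith) (fun n => by fun_prop)
  have hc : ContinuousOn (fun x => ∏' n : ℕ, (1 + -(x * q ^ n))) (Metric.ball x₀ 1) := by
    refine (hasProdLocallyUniformlyOn_iff_tendstoLocallyUniformlyOn.1 h).continuousOn
      (Frequently.of_forall fun s => ?_)
    fun_prop
  have := hc.continuousAt (Metric.ball_mem_nhds x₀ one_pos)
  simpa only [qPoch, sub_eq_add_neg] using this

/-! ### The Jacobi triple product -/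

/-- The finite q-Pochhammer symbol `(q; q)_m = ∏_{1 ≤ k ≤ m} (1 - q^k)`. -/
def finPoch (q : ℂ) (m : ℕ) : ℂ := ∏ k ∈ Finset.range m, (1 - q ^ (k + 1))

/-- The reciprocal of `(q; q)_m`, which is `0` for negative `m`. -/
def invPoch (q : ℂ) (m : ℤ) : ℂ := if m < 0 then 0 else (finPoch q m.toNat)⁻¹

lemma one_sub_pow_ne_zero (hq : ‖q‖ < 1) (k : ℕ) : 1 - q ^ (k + 1) ≠ 0 := by
  intro h
  have h1 : ‖q ^ (k + 1)‖ < 1 := by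
    rw [norm_pow]; exact pow_lt_one₀ (norm_nonneg _) hq (Nat.succ_ne_zero k)
  rw [← sub_eq_zero.1 h] at h1
  simp at h1

lemma finPoch_ne_zero (hq : ‖q‖ < 1) (m : ℕ) : finPoch q m ≠ 0 :=
  Finset.prod_ne_zero_iff.2 fun k _ => one_sub_pow_ne_zero hq k

/-- The value `0` at negative arguments makes the recursion valid for every integer: at `m = 0` the
factor `1 - q ^ 0` vanishes. Finite sums can then run over all of `ℤ` and be shifted freely. -/
lemma invPoch_sub_one (hq : ‖q‖ < 1) (m : ℤ) :
    invPoch q (m - 1) = (1 - q ^ m) * invPoch q m := by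
  rcases lt_trichotomy m 0 with hm | rfl | hm
  · simp [invPoch, hm, show m - 1 < 0 by lia]
  · simp [invPoch]
  · obtain ⟨k, rfl⟩ : ∃ k : ℕ, m = k + 1 := ⟨(m - 1).toNat, by lia⟩
    have h1 : ((k : ℤ) + 1).toNat = k + 1 := by lia
    have hk := one_sub_pow_ne_zero hq k
    have hf := finPoch_ne_zero hq k
    have h2 : finPoch q (k + 1) = finPoch q k * (1 - q ^ (k + 1)) := Finset.prod_range_succ _ _
    rw [invPoch, invPoch, if_neg (by lia), if_neg (by lia), h1, h2, add_sub_cancel_right,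
      Int.toNat_natCast]
    have : q ^ ((k : ℤ) + 1) = q ^ (k + 1) := by exact_mod_cast zpow_natCast q (k + 1)
    rw [this]
    field_simp

lemma invPoch_of_neg {m : ℤ} (hm : m < 0) : invPoch q m = 0 := if_pos hm

lemma summable_invPoch_mul (M : ℕ) (f : ℤ → ℂ) :
    Summable fun j : ℤ => f j * (invPoch q j * invPoch q (M - j)) := by
  refine summable_of_ne_finset_zero (s := Finset.Icc 0 (M : ℤ)) fun j hj => ?_
  rw [Finset.mem_Icc, not_and_or] at hj
  rcases hj with h | h
  · rw [invPoch_of_neg (by lia : j < 0)]; ring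
  · rw [invPoch_of_neg (by lia : (M : ℤ) - j < 0)]; ring

/-- The finite binomial theorem `∏_{k<M} (1 + x q^k) = ∑_j q^{j(j-1)/2} [M choose j]_q x^j`. -/
lemma prod_one_add_ee {τ : ℂ} (hτ : 0 < τ.im) (z : ℂ) (M : ℕ) :
    ∏ k ∈ Finset.range M, (1 + ee (z + k * τ)) = finPoch (ee τ) M *
      ∑' j : ℤ, ee (j * z + j * (j - 1) / 2 * τ) *
        (invPoch (ee τ) j * invPoch (ee τ) (M - j)) := by
  have hq := norm_ee_lt_one hτ
  induction M with
  | zero =>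
    rw [tsum_eq_single 0]
    · simp [finPoch, invPoch]
    · intro j hj
      rcases lt_or_gt_of_ne hj with h | h
      · rw [invPoch_of_neg h]; ring
      · rw [invPoch_of_neg (m := ((0 : ℕ) : ℤ) - j) (by push_cast; lia)]; ring
  | succ M ih =>
    rw [Finset.prod_range_succ, ih]
    set S := fun j : ℤ => ee (j * z + j * (j - 1) / 2 * τ) *
        (invPoch (ee τ) j * invPoch (ee τ) (M - j)) with hS
    have hSs : Summable S := summable_invPoch_mul M _
    -- The new factor `1 + x q^M` contributes the terms of index `j` and `j - 1` to the coefficient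
    -- of `x^j`; what remains is the `q`-Pascal rule.
    have hshift : ∑' j : ℤ, S j = ∑' j : ℤ, S (j - 1) :=
      ((Equiv.subRight (1 : ℤ)).tsum_eq S).symm
    have hSs' : Summable fun j : ℤ => S (j - 1) := (Equiv.subRight (1 : ℤ)).summable_iff.2 hSs
    have h2 : finPoch (ee τ) (M + 1) = finPoch (ee τ) M * (1 - ee τ ^ (M + 1)) :=
      Finset.prod_range_succ _ _
    rw [h2, mul_assoc, mul_assoc]
    congr 1
    rw [mul_add, mul_one, ← tsum_mul_left]
    nth_rewrite 2 [hshift]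
    rw [← tsum_mul_right, ← hSs.tsum_add (hSs'.mul_right _)]
    refine tsum_congr fun j => ?_
    simp only [hS]
    have e1 : ee (((j - 1 : ℤ) : ℂ) * z + ((j - 1 : ℤ) : ℂ) * (((j - 1 : ℤ) : ℂ) - 1) / 2 * τ) *
        ee (z + M * τ) = ee (j * z + j * (j - 1) / 2 * τ) * ee τ ^ ((M : ℤ) + 1 - j) := by
      rw [← ee_int_mul, ← ee_add, ← ee_add]
      push_cast
      ring_nf
    have e2 := invPoch_sub_one hq j
    have e3 := invPoch_sub_one hq ((M : ℤ) + 1 - j)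
    have e4 : (M : ℤ) + 1 - j - 1 = M - j := by ring
    have e5 : (M : ℤ) - (j - 1) = M + 1 - j := by ring
    have e6 : ee τ ^ ((M : ℤ) + 1 - j) * ee τ ^ j = ee τ ^ (M + 1) := by
      rw [← zpow_add₀ (ee_ne_zero τ), sub_add_cancel]
      exact_mod_cast zpow_natCast (ee τ) (M + 1)
    rw [e4] at e3
    rw [e5, e2, e3, mul_right_comm, e1]
    push_cast
    linear_combination (-ee (j * z + j * (j - 1) / 2 * τ) * invPoch (ee τ) j *
      invPoch (ee τ) ((M : ℤ) + 1 - j)) * e6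

/-- A finite triple product: the binomial theorem for `2N` factors starting at `x q^{1/2 - N}`.
Reversing the first `N` factors and extracting a monomial from each makes the product symmetric, and
the index is recentred by `N`. -/
lemma prod_one_add_ee_symm {τ : ℂ} (hτ : 0 < τ.im) (z : ℂ) (N : ℕ) :
    (∏ k ∈ Finset.range N, (1 + ee (z + τ / 2) * ee τ ^ k)) *
      (∏ k ∈ Finset.range N, (1 + ee (-z + τ / 2) * ee τ ^ k)) =
    ∑' n : ℤ, jacobiTheta₂_term n z τ *
      (finPoch (ee τ) (2 * N) * (invPoch (ee τ) (N + n) * invPoch (ee τ) (N - n))) := by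
  have h := prod_one_add_ee hτ (z - N * τ + τ / 2) (2 * N)
  rw [two_mul N, Finset.prod_range_add, ← Finset.prod_range_reflect] at h
  have h1 : ∀ k ∈ Finset.range N, 1 + ee (z - N * τ + τ / 2 + ((N - 1 - k : ℕ) : ℂ) * τ) =
      ee (z - (k + 1 / 2) * τ) * (1 + ee (-z + τ / 2) * ee τ ^ k) := by
    intro k hk
    have hk := Finset.mem_range.1 hk
    have : ((N - 1 - k : ℕ) : ℂ) = N - 1 - k := by
      rw [Nat.cast_sub (by lia), Nat.cast_sub (by lia)]; simp
    rw [this, mul_add, mul_one, ← ee_nat_mul, ← ee_add, ← ee_add]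
    rw [show z - (k + 1 / 2) * τ + (-z + τ / 2 + k * τ) = 0 by ring, ee_zero, add_comm]
    ring_nf
  have h2 : ∀ k ∈ Finset.range N, 1 + ee (z - N * τ + τ / 2 + ((N + k : ℕ) : ℂ) * τ) =
      1 + ee (z + τ / 2) * ee τ ^ k := by
    intro k _
    rw [← ee_nat_mul, ← ee_add]
    push_cast
    ring_nf
  have h3 : ∀ N : ℕ, ∏ k ∈ Finset.range N, ee (z - (k + 1 / 2) * τ) =
      ee (N * z - N ^ 2 / 2 * τ) := by
    intro N
    induction N with
    | zero => simp
    | succ N ih =>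
      rw [Finset.prod_range_succ, ih, ← ee_add]
      push_cast
      ring_nf
  rw [Finset.prod_congr rfl h1, Finset.prod_congr rfl h2, Finset.prod_mul_distrib, h3,
    ← (Equiv.addLeft (N : ℤ)).tsum_eq] at h
  refine mul_left_cancel₀ (ee_ne_zero (N * z - N ^ 2 / 2 * τ)) ?_
  rw [mul_comm (∏ k ∈ Finset.range N, (1 + ee (z + τ / 2) * ee τ ^ k)), ← mul_assoc, h,
    ← tsum_mul_left, ← tsum_mul_left, two_mul]
  refine tsum_congr fun n => ?_
  rw [jacobiTheta₂_term_eq_ee]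
  simp only [Equiv.coe_addLeft]
  have e1 : ((N + N : ℕ) : ℤ) - (N + n) = N - n := by push_cast; ring
  have e2 : ee (((N + n : ℤ) : ℂ) * (z - N * τ + τ / 2) +
      ((N + n : ℤ) : ℂ) * (((N + n : ℤ) : ℂ) - 1) / 2 * τ) =
      ee (N * z - N ^ 2 / 2 * τ) * ee (n * z + n ^ 2 * τ / 2) := by
    rw [← ee_add]; push_cast; ring_nf
  rw [e1, e2]
  ring

lemma tendsto_finPoch (hq : ‖q‖ < 1) : Tendsto (finPoch q) atTop (𝓝 (qPoch q q)) := by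
  refine (tendsto_qPoch hq q).congr fun N => Finset.prod_congr rfl fun k _ => by ring

lemma tendsto_invPoch (hq : ‖q‖ < 1) {f : ℕ → ℤ} (hf : Tendsto f atTop atTop) :
    Tendsto (fun N => invPoch q (f N)) atTop (𝓝 (qPoch q q)⁻¹) := by
  have h1 : Tendsto (fun N => (f N).toNat) atTop atTop :=
    tendsto_atTop.2 fun b => (hf.eventually_ge_atTop (b : ℤ)).mono fun N hN => by lia
  have h2 := ((tendsto_finPoch hq).comp h1).inv₀ (qPoch_ne_zero_of_norm_lt_one hq hq)
  refine h2.congr' ((hf.eventually_ge_atTop 0).mono fun N hN => ?_)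
  simp only [invPoch, if_neg (not_lt.2 hN), Function.comp]

/-- The Jacobi triple product. -/
theorem jacobiTheta₂_eq_qPoch {τ : ℂ} (hτ : 0 < τ.im) (z : ℂ) :
    jacobiTheta₂ z τ = qPoch (ee τ) (ee τ) * qPoch (-ee (z + τ / 2)) (ee τ) *
      qPoch (-ee (-z + τ / 2)) (ee τ) := by
  have hq := norm_ee_lt_one hτ
  have hφ := qPoch_ne_zero_of_norm_lt_one hq hq
  have hL := (tendsto_qPoch hq (-ee (z + τ / 2))).mul (tendsto_qPoch hq (-ee (-z + τ / 2)))
  simp only [neg_mul, sub_neg_eq_add] at hL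
  -- Convergent sequences are bounded, so the theta terms times `B * (C * C)` dominate the finite
  -- identities. The coefficients tend to `(q; q)_∞ · (q; q)_∞⁻²`.
  obtain ⟨B, hB⟩ := (tendsto_finPoch hq).norm.bddAbove_range
  obtain ⟨C, hC⟩ := (tendsto_invPoch hq tendsto_natCast_atTop_atTop).norm.bddAbove_range
  have hB' : ∀ m, ‖finPoch (ee τ) m‖ ≤ B := fun m => hB ⟨m, rfl⟩
  have hC0 : 0 ≤ C := (norm_nonneg _).trans (hC ⟨0, rfl⟩)
  have hB0 : 0 ≤ B := (norm_nonneg _).trans (hB' 0)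
  have hC' : ∀ m : ℤ, ‖invPoch (ee τ) m‖ ≤ C := fun m => by
    rcases lt_or_ge m 0 with h | h
    · simpa [invPoch_of_neg h] using hC0
    · lift m to ℕ using h
      exact hC ⟨m, rfl⟩
  have hR : Tendsto (fun N : ℕ => ∑' n : ℤ, jacobiTheta₂_term n z τ *
      (finPoch (ee τ) (2 * N) * (invPoch (ee τ) (N + n) * invPoch (ee τ) (N - n)))) atTop
      (𝓝 (∑' n : ℤ, jacobiTheta₂_term n z τ *
        (qPoch (ee τ) (ee τ) * ((qPoch (ee τ) (ee τ))⁻¹ * (qPoch (ee τ) (ee τ))⁻¹)))) := by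
    refine tendsto_tsum_of_dominated_convergence
      (bound := fun n => ‖jacobiTheta₂_term n z τ‖ * (B * (C * C))) ?_ (fun n => ?_)
      (Eventually.of_forall fun N n => ?_)
    · exact ((summable_jacobiTheta₂_term_iff z τ).2 hτ).norm.mul_right _
    · refine Tendsto.const_mul _ (((tendsto_finPoch hq).comp
        (tendsto_id.const_mul_atTop' two_pos)).mul ((tendsto_invPoch hq ?_).mul
          (tendsto_invPoch hq ?_)))
      · exact tendsto_atTop_add_const_right _ _ tendsto_natCast_atTop_atTop
      · simpa only [sub_eq_add_neg] using
          tendsto_atTop_add_const_right _ (-n) tendsto_natCast_atTop_atTop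
    · rw [norm_mul, norm_mul, norm_mul]
      gcongr
      · exact hB' _
      · exact hC' _
      · exact hC' _
  have key := tendsto_nhds_unique (hL.congr fun N => prod_one_add_ee_symm hτ z N) hR
  rw [tsum_mul_right] at key
  change _ = jacobiTheta₂ z τ * _ at key
  rw [mul_assoc, key]
  field_simp

end EllipticD4

namespace EllipticD4

open Complex Filter Topology

/-! ### Even theta functions of one variable -/

/-- The theta series `∑ γ(n) q^{n²/2k} x^n` of level `k`, where `q = ee τ` and `x = ee z`. -/
def thetaSeries (k : ℕ) (γ : ℤ → ℂ) (z τ : ℂ) : ℂ :=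
  ∑' n : ℤ, γ n * ee (n * z + n ^ 2 * τ / (2 * k))

/-- A function on the integers that is even and has period `k`. -/
structure EvenPeriodic (k : ℕ) (γ : ℤ → ℂ) : Prop where
  add_period : ∀ n, γ (n + k) = γ n
  neg : ∀ n, γ (-n) = γ n

lemma EvenPeriodic.apply_emod {k : ℕ} {γ : ℤ → ℂ} (h : EvenPeriodic k γ) (n : ℤ) :
    γ (n % k) = γ n := by
  have : Function.Periodic γ (k : ℤ) := h.add_period
  rw [Int.emod_def, mul_comm]
  exact this.sub_int_mul_eq (n / k)

lemma EvenPeriodic.exists_norm_le {k : ℕ} (hk : k ≠ 0) {γ : ℤ → ℂ} (h : EvenPeriodic k γ) :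
    ∃ C, ∀ n, ‖γ n‖ ≤ C := by
  obtain ⟨C, hC⟩ := ((Set.finite_Ico (0 : ℤ) k).image fun n => ‖γ n‖).bddAbove
  refine ⟨C, fun n => ?_⟩
  rw [← h.apply_emod n]
  exact hC ⟨n % k, ⟨Int.emod_nonneg _ (by exact_mod_cast hk),
    Int.emod_lt_of_pos _ (by exact_mod_cast Nat.pos_of_ne_zero hk)⟩, rfl⟩

lemma im_div_natCast_pos {τ : ℂ} (hτ : 0 < τ.im) {k : ℕ} (hk : k ≠ 0) : 0 < (τ / k).im := by
  rw [div_natCast_im]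
  have : (0 : ℝ) < k := by exact_mod_cast Nat.pos_of_ne_zero hk
  positivity

lemma ee_quadratic_eq_term (k : ℕ) (n : ℤ) (z τ : ℂ) :
    ee (n * z + n ^ 2 * τ / (2 * k)) = jacobiTheta₂_term n z (τ / k) := by
  rw [jacobiTheta₂_term_eq_ee]
  congr 1
  rw [mul_comm 2 (k : ℂ), ← div_div, mul_div_assoc]

lemma EvenPeriodic.summable_norm {k : ℕ} (hk : k ≠ 0) {γ : ℤ → ℂ} (h : EvenPeriodic k γ)
    (z : ℂ) {τ : ℂ} (hτ : 0 < τ.im) :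
    Summable fun n : ℤ => ‖γ n * ee (n * z + n ^ 2 * τ / (2 * k))‖ := by
  obtain ⟨C, hC⟩ := h.exists_norm_le hk
  have hs := ((summable_jacobiTheta₂_term_iff z (τ / k)).2 (im_div_natCast_pos hτ hk)).norm
  refine Summable.of_nonneg_of_le (fun _ => norm_nonneg _) (fun n => ?_) (hs.mul_left C)
  rw [norm_mul, ee_quadratic_eq_term]
  gcongr
  exact hC n

/-- The coefficients of the product of two theta series. -/
def thetaConv (k l : ℕ) (γ γ' : ℤ → ℂ) (τ : ℂ) (n : ℤ) : ℂ :=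
  ∑' m : ℤ, γ m * γ' (n - m) *
    ee ((m ^ 2 / (2 * k) + (n - m) ^ 2 / (2 * l) - n ^ 2 / (2 * (k + l))) * τ)

/-- The exponent equals `(l m - k (n - m))² / (2 k l (k + l))`, which is unchanged under `(m, n) ↦
(m + k, n + k + l)` and under negation of both indices. -/
lemma EvenPeriodic.thetaConv {k l : ℕ} (hk : k ≠ 0) (hl : l ≠ 0) {γ γ' : ℤ → ℂ}
    (h : EvenPeriodic k γ) (h' : EvenPeriodic l γ') (τ : ℂ) :
    EvenPeriodic (k + l) (thetaConv k l γ γ' τ) := by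
  have hk' : (k : ℂ) ≠ 0 := by exact_mod_cast hk
  have hl' : (l : ℂ) ≠ 0 := by exact_mod_cast hl
  have hkl : (k : ℂ) + l ≠ 0 := by
    have : k + l ≠ 0 := by lia
    exact_mod_cast this
  constructor
  · intro n
    simp only [EllipticD4.thetaConv]
    rw [← (Equiv.addRight (k : ℤ)).tsum_eq]
    refine tsum_congr fun m => ?_
    simp only [Equiv.coe_addRight]
    rw [h.add_period, show n + ((k + l : ℕ) : ℤ) - (m + k) = n - m + l by push_cast; ring,
      h'.add_period]
    congr 2
    push_cast
    field_simp
    ring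
  · intro n
    simp only [EllipticD4.thetaConv]
    rw [← (Equiv.neg ℤ).tsum_eq]
    refine tsum_congr fun m => ?_
    simp only [Equiv.neg_apply]
    rw [h.neg, show -n - -m = -(n - m) by ring, h'.neg]
    congr 2
    push_cast
    ring

lemma thetaSeries_mul {k l : ℕ} (hk : k ≠ 0) (hl : l ≠ 0) {γ γ' : ℤ → ℂ}
    (h : EvenPeriodic k γ) (h' : EvenPeriodic l γ') (z : ℂ) {τ : ℂ} (hτ : 0 < τ.im) :
    thetaSeries k γ z τ * thetaSeries l γ' z τ =
      thetaSeries (k + l) (thetaConv k l γ γ' τ) z τ := by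
  have hs := h.summable_norm hk z hτ
  have hs' := h'.summable_norm hl z hτ
  have hsum := summable_mul_of_summable_norm hs hs'
  rw [thetaSeries, thetaSeries, tsum_mul_tsum_of_summable_norm hs hs']
  let e : ℤ × ℤ ≃ ℤ × ℤ :=
    { toFun := fun p => (p.2, p.1 - p.2)
      invFun := fun p => (p.1 + p.2, p.1)
      left_inv := fun p => by simp
      right_inv := fun p => by simp }
  rw [← e.tsum_eq, thetaSeries]
  refine (Summable.tsum_prod (e.summable_iff.2 hsum)).trans (tsum_congr fun n => ?_)
  rw [thetaConv, ← tsum_mul_right]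
  refine tsum_congr fun m => ?_
  simp only [e, Equiv.coe_fn_mk, Function.comp]
  rw [mul_mul_mul_comm, mul_assoc (γ m * γ' (n - m)), ← ee_add, ← ee_add]
  congr 2
  push_cast
  ring

/-- The indicator function of the residue classes `a` and `-a` modulo `k`. -/
def orbitInd (k : ℕ) (a n : ℤ) : ℂ := if (k : ℤ) ∣ n - a ∨ (k : ℤ) ∣ n + a then 1 else 0

lemma evenPeriodic_orbitInd (k : ℕ) (a : ℤ) : EvenPeriodic k (orbitInd k a) := by
  constructor
  · intro n
    have h1 : n + k - a = n - a + k := by ring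
    have h2 : n + k + a = n + a + k := by ring
    simp only [orbitInd, h1, h2, dvd_add_self_right]
  · intro n
    have h1 : -n - a = -(n + a) := by ring
    have h2 : -n + a = -(n - a) := by ring
    simp only [orbitInd, h1, h2, dvd_neg, or_comm]

/-- The theta series of level `k` of the residue classes `a` and `-a`. -/
def thetaOrbit (k : ℕ) (a : ℤ) (z τ : ℂ) : ℂ := thetaSeries k (orbitInd k a) z τ

/-- Modulo 6 and modulo 7 alike, the residue classes up to sign are represented by `0, 1, 2, 3`.
This coincidence makes the determinants of both levels square of size 4. -/
lemma EvenPeriodic.eq_sum_orbitInd {k : ℕ} (hk : k = 6 ∨ k = 7) {γ : ℤ → ℂ}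
    (h : EvenPeriodic k γ) (n : ℤ) :
    γ n = ∑ a : Fin 4, γ (a : ℕ) * orbitInd k (a : ℕ) n := by
  rw [← h.apply_emod n]
  have : ∀ a : Fin 4, orbitInd k (a : ℕ) n = orbitInd k (a : ℕ) (n % k) := fun a =>
    ((evenPeriodic_orbitInd k _).apply_emod n).symm
  simp only [this]
  have h0 : 0 ≤ n % k := Int.emod_nonneg _ (by rcases hk with rfl | rfl <;> norm_num)
  have h1 : n % k < k := Int.emod_lt_of_pos _ (by rcases hk with rfl | rfl <;> norm_num)
  generalize n % k = r at h0 h1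
  have hr := h.add_period (-r)
  rw [h.neg] at hr
  rcases hk with rfl | rfl <;> push_cast at h1 <;> interval_cases r <;>
    norm_num [orbitInd, Fin.sum_univ_four] at hr ⊢ <;> exact hr.symm

/-- The determinant of the even theta functions of level `k` in four variables. -/
def detTheta (k : ℕ) (z : Fin 4 → ℂ) (τ : ℂ) : ℂ :=
  Matrix.det (Matrix.of fun a j : Fin 4 => thetaOrbit k (a : ℕ) (z j) τ)

lemma thetaSeries_eq_sum {k : ℕ} (hk : k = 6 ∨ k = 7) {γ : ℤ → ℂ} (h : EvenPeriodic k γ)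
    (z : ℂ) {τ : ℂ} (hτ : 0 < τ.im) :
    thetaSeries k γ z τ = ∑ a : Fin 4, γ (a : ℕ) * thetaOrbit k (a : ℕ) z τ := by
  have hk0 : k ≠ 0 := by rcases hk with rfl | rfl <;> norm_num
  simp only [thetaOrbit, thetaSeries, ← tsum_mul_left]
  rw [← Summable.tsum_finsetSum fun a _ =>
    ((evenPeriodic_orbitInd k _).summable_norm hk0 z hτ).of_norm.mul_left _]
  refine tsum_congr fun n => ?_
  rw [h.eq_sum_orbitInd hk n, Finset.sum_mul]
  exact Finset.sum_congr rfl fun a _ => by ring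

/-- The mechanism behind both main identities: any four even theta functions of level 6 or 7 have a
determinant proportional to `detTheta`, with a factor independent of `z`. -/
lemma det_thetaSeries {k : ℕ} (hk : k = 6 ∨ k = 7) {γ : Fin 4 → ℤ → ℂ}
    (h : ∀ c, EvenPeriodic k (γ c)) (z : Fin 4 → ℂ) {τ : ℂ} (hτ : 0 < τ.im) :
    Matrix.det (Matrix.of fun c j : Fin 4 => thetaSeries k (γ c) (z j) τ) =
      Matrix.det (Matrix.of fun c a : Fin 4 => γ c (a : ℕ)) * detTheta k z τ := by
  rw [detTheta, ← Matrix.det_mul]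
  congr 1
  ext c j
  simp only [Matrix.of_apply, Matrix.mul_apply]
  exact thetaSeries_eq_sum hk (h c) (z j) hτ

/-! ### The odd theta function -/

/-- The odd theta function `∑ (-1)^n q^{(n+1/2)²/2} x^{n+1/2}`. -/
def thetaOdd (z τ : ℂ) : ℂ :=
  ∑' n : ℤ, (-1 : ℂ) ^ n * ee ((n + 1 / 2) * z + (n + 1 / 2) ^ 2 * τ / 2)

lemma thetaOdd_term (n : ℤ) (z τ : ℂ) :
    (-1 : ℂ) ^ n * ee ((n + 1 / 2) * z + (n + 1 / 2) ^ 2 * τ / 2) =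
      ee (z / 2 + τ / 8) * jacobiTheta₂_term n (z + τ / 2 + 1 / 2) τ := by
  rw [jacobiTheta₂_term_eq_ee, ← ee_int_div_two, ← ee_add, ← ee_add]
  ring_nf

lemma thetaOdd_eq_jacobiTheta₂ (z τ : ℂ) :
    thetaOdd z τ = ee (z / 2 + τ / 8) * jacobiTheta₂ (z + τ / 2 + 1 / 2) τ := by
  simp only [thetaOdd, thetaOdd_term, tsum_mul_left, jacobiTheta₂]

lemma summable_norm_thetaOdd (z : ℂ) {τ : ℂ} (hτ : 0 < τ.im) :
    Summable fun n : ℤ => ‖(-1 : ℂ) ^ n * ee ((n + 1 / 2) * z + (n + 1 / 2) ^ 2 * τ / 2)‖ := by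
  simp only [thetaOdd_term]
  exact (((summable_jacobiTheta₂_term_iff _ τ).2 hτ).mul_left _).norm

lemma thetaOdd_eq_qPoch (z : ℂ) {τ : ℂ} (hτ : 0 < τ.im) :
    thetaOdd z τ = ee (z / 2 + τ / 8) * (qPoch (ee τ) (ee τ) * qPoch (ee (z + τ)) (ee τ) *
      qPoch (ee (-z)) (ee τ)) := by
  rw [thetaOdd_eq_jacobiTheta₂, jacobiTheta₂_eq_qPoch hτ]
  have h1 : -ee (z + τ / 2 + 1 / 2 + τ / 2) = ee (z + τ) := by
    rw [show z + τ / 2 + 1 / 2 + τ / 2 = z + τ + 1 / 2 by ring, ee_add, ee_half]; ring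
  have h2 : -ee (-(z + τ / 2 + 1 / 2) + τ / 2) = ee (-z) := by
    rw [show -(z + τ / 2 + 1 / 2) + τ / 2 = -z + -(1 / 2) by ring, ee_add, ee_neg (1 / 2), ee_half]
    norm_num
  rw [h1, h2]

lemma thetaOdd_neg (z τ : ℂ) : thetaOdd (-z) τ = -thetaOdd z τ := by
  rw [thetaOdd, thetaOdd, ← tsum_neg, ← (Equiv.subLeft (-1 : ℤ)).tsum_eq]
  refine tsum_congr fun n => ?_
  simp only [Equiv.subLeft_apply]
  have h : (-1 : ℂ) ^ (-1 - n) = -(-1) ^ n := by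
    rw [zpow_sub₀ (by norm_num), zpow_neg_one, div_eq_mul_inv, ← inv_zpow]
    norm_num
  rw [h]
  push_cast
  ring_nf

lemma thetaOdd_add_one (z τ : ℂ) : thetaOdd (z + 1) τ = -thetaOdd z τ := by
  rw [thetaOdd, thetaOdd, ← tsum_neg]
  refine tsum_congr fun n => ?_
  rw [show ((n : ℂ) + 1 / 2) * (z + 1) + (n + 1 / 2) ^ 2 * τ / 2 =
    ((n + 1 / 2) * z + (n + 1 / 2) ^ 2 * τ / 2) + n + 1 / 2 by ring, ee_add, ee_add, ee_half, ee_int]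
  ring

lemma orbitInd_two_zero (n : ℤ) : orbitInd 2 0 n = if Even n then 1 else 0 := by
  simp [orbitInd, even_iff_two_dvd]

lemma orbitInd_two_one (n : ℤ) : orbitInd 2 1 n = if Even n then 0 else 1 := by
  have h1 : ((2 : ℕ) : ℤ) ∣ n - 1 ↔ ¬ Even n := by grind
  have h2 : ((2 : ℕ) : ℤ) ∣ n + 1 ↔ ¬ Even n := by grind
  simp only [orbitInd, h1, h2, or_self, ite_not]

/-- The two even theta functions of level `2` and the odd theta function. -/
lemma thetaOrbit_two_wronskian (z w : ℂ) {τ : ℂ} (hτ : 0 < τ.im) :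
    thetaOrbit 2 0 z τ * thetaOrbit 2 1 w τ - thetaOrbit 2 1 z τ * thetaOrbit 2 0 w τ =
      -(thetaOdd (z + w) τ * thetaOdd (z - w) τ) := by
  have hs := fun a z => (evenPeriodic_orbitInd 2 a).summable_norm two_ne_zero z hτ
  have hodd := fun z => summable_norm_thetaOdd z hτ
  simp only [thetaOrbit, thetaSeries, thetaOdd]
  rw [tsum_mul_tsum_of_summable_norm (hs 0 z) (hs 1 w),
    tsum_mul_tsum_of_summable_norm (hs 1 z) (hs 0 w),
    tsum_mul_tsum_of_summable_norm (hodd (z + w)) (hodd (z - w)),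
    ← (summable_mul_of_summable_norm (hs 0 z) (hs 1 w)).tsum_sub
      (summable_mul_of_summable_norm (hs 1 z) (hs 0 w)), ← tsum_neg]
  -- The pairs `(k + l + 1, k - l)` are exactly the pairs of opposite parity. On pairs of equal
  -- parity both indicator products vanish, so nothing is lost.
  have hinj : Function.Injective fun p : ℤ × ℤ => (p.1 + p.2 + 1, p.1 - p.2) := by
    rintro ⟨a, b⟩ ⟨c, d⟩ h
    simp only [Prod.mk.injEq] at h ⊢
    lia
  rw [← hinj.tsum_eq]
  · refine tsum_congr fun p => ?_
    obtain ⟨k, l⟩ := p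
    simp only [orbitInd_two_zero, orbitInd_two_one]
    have e1 : ee ((k + 1 / 2) * (z + w) + (k + 1 / 2) ^ 2 * τ / 2) *
        ee ((l + 1 / 2) * (z - w) + (l + 1 / 2) ^ 2 * τ / 2) =
        ee (((k + l + 1 : ℤ) : ℂ) * z + ((k + l + 1 : ℤ) : ℂ) ^ 2 * τ / (2 * (2 : ℕ))) *
        ee (((k - l : ℤ) : ℂ) * w + ((k - l : ℤ) : ℂ) ^ 2 * τ / (2 * (2 : ℕ))) := by
      rw [← ee_add, ← ee_add]
      push_cast
      ring_nf
    rw [mul_mul_mul_comm ((-1 : ℂ) ^ k), e1, ← zpow_add₀ (by norm_num)]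
    rcases Int.even_or_odd (k + l) with h | h
    · have h1 : ¬ Even (k + l + 1) := by grind
      have h2 : Even (k - l) := by grind
      rw [if_neg h1, if_neg h1, if_pos h2, if_pos h2, h.neg_one_zpow]
      ring
    · have h1 : Even (k + l + 1) := by grind
      have h2 : ¬ Even (k - l) := by grind
      rw [if_pos h1, if_pos h1, if_neg h2, if_neg h2, h.neg_one_zpow]
      ring
  · rintro ⟨m, n⟩ h
    by_contra hr
    refine h ?_
    have : Even m ↔ Even n := by
      by_contra hmn
      refine hr ⟨((m + n - 1) / 2, (m - n - 1) / 2), ?_⟩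
      simp only [Prod.mk.injEq]
      grind
    simp only [orbitInd_two_zero, orbitInd_two_one, this]
    split_ifs <;> ring

end EllipticD4

namespace EllipticD4

open Complex Filter Topology

lemma eta_eq_qPoch (τ : ℂ) : ModularForm.eta τ = ee (τ / 24) * qPoch (ee τ) (ee τ) := by
  simp only [ModularForm.eta, ModularForm.eta_q_eq_pow, qPoch, Function.Periodic.qParam]
  congr 1
  · rw [ee]; push_cast; ring_nf
  · exact tprod_congr fun n => by rw [ee, pow_succ']

/-! ### The theta series of a residue class -/

/-- The theta series `∑_{n ≡ a mod k} q^{n²/2k} x^n`. -/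
def thetaResidue (k : ℕ) (a : ℤ) (z τ : ℂ) : ℂ :=
  ∑' m : ℤ, ee ((k * m + a) * z + (k * m + a) ^ 2 * τ / (2 * k))

lemma thetaResidue_term {k : ℕ} (hk : k ≠ 0) (a m : ℤ) (z τ : ℂ) :
    ee ((k * m + a) * z + (k * m + a) ^ 2 * τ / (2 * k)) =
      ee (a * z + a ^ 2 * τ / (2 * k)) * jacobiTheta₂_term m (k * z + a * τ) (k * τ) := by
  have hk' : (k : ℂ) ≠ 0 := by exact_mod_cast hk
  rw [jacobiTheta₂_term_eq_ee, ← ee_add]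
  congr 1
  field_simp
  ring

lemma thetaResidue_eq_jacobiTheta₂ {k : ℕ} (hk : k ≠ 0) (a : ℤ) (z τ : ℂ) :
    thetaResidue k a z τ =
      ee (a * z + a ^ 2 * τ / (2 * k)) * jacobiTheta₂ (k * z + a * τ) (k * τ) := by
  simp only [thetaResidue, thetaResidue_term hk, tsum_mul_left, jacobiTheta₂]

lemma im_natCast_mul_pos {τ : ℂ} (hτ : 0 < τ.im) {k : ℕ} (hk : k ≠ 0) : 0 < (k * τ).im := by
  have : (0 : ℝ) < k := by exact_mod_cast Nat.pos_of_ne_zero hk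
  simpa using mul_pos this hτ

lemma summable_norm_thetaResidue {k : ℕ} (hk : k ≠ 0) (a : ℤ) (z : ℂ) {τ : ℂ} (hτ : 0 < τ.im) :
    Summable fun m : ℤ => ‖ee ((k * m + a) * z + (k * m + a) ^ 2 * τ / (2 * k))‖ := by
  simp only [thetaResidue_term hk]
  exact (((summable_jacobiTheta₂_term_iff _ _).2 (im_natCast_mul_pos hτ hk)).mul_left _).norm

lemma hasSum_thetaResidue {k : ℕ} (hk : k ≠ 0) (a : ℤ) (z : ℂ) {τ : ℂ} (hτ : 0 < τ.im) :
    HasSum (fun n : ℤ => (if (k : ℤ) ∣ n - a then 1 else 0) *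
      ee (n * z + n ^ 2 * τ / (2 * k))) (thetaResidue k a z τ) := by
  have hinj : Function.Injective fun m : ℤ => (k : ℤ) * m + a := by
    intro m n h
    simpa [hk] using h
  have h := (summable_norm_thetaResidue hk a z hτ).of_norm.hasSum
  rw [← hinj.hasSum_iff]
  · refine h.congr_fun fun m => ?_
    simp
  · intro n hn
    rw [if_neg, zero_mul]
    rintro ⟨m, hm⟩
    exact hn ⟨m, by simp only; lia⟩

/-- When `a ≡ -a` modulo `k` the two classes coincide: the left side counts the class twice,
`orbitInd` only once. -/
lemma thetaResidue_add_neg {k : ℕ} (hk : k ≠ 0) (a : ℤ) (z : ℂ) {τ : ℂ} (hτ : 0 < τ.im) :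
    thetaResidue k a z τ + thetaResidue k (-a) z τ =
      (if (k : ℤ) ∣ 2 * a then 2 else 1) * thetaOrbit k a z τ := by
  have h := (hasSum_thetaResidue hk a z hτ).add (hasSum_thetaResidue hk (-a) z hτ)
  rw [← h.tsum_eq, thetaOrbit, thetaSeries, ← tsum_mul_left]
  refine tsum_congr fun n => ?_
  have h1 : (k : ℤ) ∣ n - a → ((k : ℤ) ∣ n + a ↔ (k : ℤ) ∣ 2 * a) := fun h => by
    rw [show n + a = n - a + 2 * a by ring]; exact dvd_add_right h
  have h2 : (k : ℤ) ∣ n + a → ((k : ℤ) ∣ n - a ↔ (k : ℤ) ∣ 2 * a) := fun h => by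
    rw [show n - a = n + a - 2 * a by ring]; exact dvd_sub_right h
  rw [← add_mul, ← mul_assoc, sub_neg_eq_add, orbitInd]
  congr 1
  by_cases ha : (k : ℤ) ∣ n - a <;> by_cases hb : (k : ℤ) ∣ n + a <;>
    by_cases hc : (k : ℤ) ∣ 2 * a <;> simp [ha, hb, hc] <;> first | norm_num; done | tauto

lemma thetaResidue_neg_zero (k : ℕ) (a : ℤ) (τ : ℂ) :
    thetaResidue k (-a) 0 τ = thetaResidue k a 0 τ := by
  rw [thetaResidue, thetaResidue, ← (Equiv.neg ℤ).tsum_eq]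
  refine tsum_congr fun m => ?_
  simp only [Equiv.neg_apply]
  push_cast
  ring_nf

lemma thetaOrbit_six_zero (a : ℤ) {τ : ℂ} (hτ : 0 < τ.im) :
    (if (6 : ℤ) ∣ 2 * a then 2 else 1) * thetaOrbit 6 a 0 τ = 2 * (ee (a ^ 2 * τ / 12) *
      (qPoch (ee τ ^ 6) (ee τ ^ 6) * qPoch (-ee τ ^ (3 + a)) (ee τ ^ 6) *
        qPoch (-ee τ ^ (3 - a)) (ee τ ^ 6))) := by
  have h := thetaResidue_add_neg (k := 6) (by norm_num) a 0 hτ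
  have hτ6 := im_natCast_mul_pos hτ (k := 6) (by norm_num)
  push_cast at h hτ6
  rw [← h, thetaResidue_neg_zero, ← two_mul, thetaResidue_eq_jacobiTheta₂ (by norm_num)]
  push_cast
  rw [jacobiTheta₂_eq_qPoch hτ6]
  simp only [← ee_int_mul]
  have : ee τ ^ 6 = ee (6 * τ) := by rw [← ee_nat_mul]; norm_num
  rw [this]
  push_cast
  ring_nf

lemma norm_pow_lt_one' {q : ℂ} (hq : ‖q‖ < 1) {k : ℕ} (hk : k ≠ 0) : ‖q ^ k‖ < 1 := by
  rw [norm_pow]; exact pow_lt_one₀ (norm_nonneg _) hq hk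

/-- The arguments `-q^{3 ± a}` for `a = 0, …, 3` comprise `-q, …, -q⁵`, a second `-q³`, and `-q⁶,
-1`. Since `(-1; q⁶)_∞ = 2 (-q⁶; q⁶)_∞`, they assemble into `(-q; q)_∞ (-q³; q³)_∞`. -/
lemma prod_thetaOrbit_six_zero {τ : ℂ} (hτ : 0 < τ.im) :
    ∏ a : Fin 4, thetaOrbit 6 (a : ℕ) 0 τ = 8 * ee (7 * τ / 6) *
      qPoch (ee τ ^ 6) (ee τ ^ 6) ^ 4 * qPoch (-ee τ) (ee τ) *
        qPoch (-ee τ ^ 3) (ee τ ^ 3) := by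
  have hq := norm_ee_lt_one hτ
  have h0 := thetaOrbit_six_zero 0 hτ
  have h1 := thetaOrbit_six_zero 1 hτ
  have h2 := thetaOrbit_six_zero 2 hτ
  have h3 := thetaOrbit_six_zero 3 hτ
  have hb := prod_qPoch_pow hq (-ee τ) (k := 6) (by norm_num)
  have hd := prod_qPoch_pow (norm_pow_lt_one' hq (k := 3) (by norm_num)) (-ee τ ^ 3) (k := 2)
    (by norm_num)
  have h6 := qPoch_eq_one_sub_mul (norm_pow_lt_one' hq (k := 6) (by norm_num)) (-1)
  have e1 : ee (τ / 12) * ee (2 ^ 2 * τ / 12) * ee (3 ^ 2 * τ / 12) = ee (7 * τ / 6) := by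
    rw [← ee_add, ← ee_add]; ring_nf
  rw [if_neg (by norm_num)] at h1 h2
  rw [if_pos (by norm_num)] at h0 h3
  norm_num [← pow_mul] at h0 h1 h2 h3 hd h6
  simp only [Finset.prod_range_succ, Finset.prod_range_zero, one_mul, mul_one, neg_mul,
    ← pow_succ', ← pow_add] at hb hd
  norm_num at hb hd
  simp only [Fin.prod_univ_four]
  norm_num
  rw [h0, h1, h2, h3, ← hb, ← hd, ← e1, h6]
  ring_nf

/-! ### Values at the sixth roots of unity -/

lemma ee_sixth_sq : ee (1 / 6) ^ 2 = ee (1 / 6) - 1 := by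
  have h3 : ee (1 / 6) ^ 3 = -1 := by rw [← ee_nat_mul, ← ee_half]; norm_num
  have h : (ee (1 / 6) + 1) * (ee (1 / 6) ^ 2 - ee (1 / 6) + 1) = 0 := by linear_combination h3
  rcases mul_eq_zero.1 h with h | h
  · exfalso
    have h2 : ee (((2 : ℕ) : ℂ) * (1 / 6)) = 1 := by
      rw [ee_nat_mul]; linear_combination (ee (1 / 6) - 1) * h
    obtain ⟨n, hn⟩ := (ee_eq_one_iff _).1 h2
    have : (1 : ℂ) = (3 * n : ℤ) := by push_cast; rw [← hn]; norm_num
    have : (1 : ℤ) = 3 * n := by exact_mod_cast this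
    lia
  · linear_combination h

lemma ee_sixth_inv : (ee (1 / 6))⁻¹ = 1 - ee (1 / 6) := by
  refine inv_eq_of_mul_eq_one_left ?_
  linear_combination -ee_sixth_sq

/-- At a sixth root of unity `x`, the power `x^n` depends only on `n` modulo 6. Averaging the terms
`n` and `-n` turns it into a cosine common to the classes `a` and `-a`. -/
lemma thetaOrbit_six_div (a j : ℤ) {τ : ℂ} (hτ : 0 < τ.im) :
    thetaOrbit 6 a (j / 6) τ =
      (ee (1 / 6) ^ (a * j) + (ee (1 / 6))⁻¹ ^ (a * j)) / 2 * thetaOrbit 6 a 0 τ := by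
  have hs := ((evenPeriodic_orbitInd 6 a).summable_norm (by norm_num) (j / 6 : ℂ) hτ).of_norm
  have hs' := (Equiv.neg ℤ).summable_iff.2 hs
  have h1 : thetaOrbit 6 a (j / 6) τ + thetaOrbit 6 a (j / 6) τ =
      (ee (1 / 6) ^ (a * j) + (ee (1 / 6))⁻¹ ^ (a * j)) * thetaOrbit 6 a 0 τ := by
    rw [thetaOrbit, thetaSeries]
    nth_rewrite 2 [← (Equiv.neg ℤ).tsum_eq]
    refine (hs.tsum_add hs').symm.trans ?_
    rw [thetaOrbit, thetaSeries, ← tsum_mul_left]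
    refine tsum_congr fun n => ?_
    simp only [Function.comp, Equiv.neg_apply, (evenPeriodic_orbitInd 6 a).neg]
    have key : ∀ m b : ℤ, (6 : ℤ) ∣ m - b → ee (m * (j / 6)) = ee (1 / 6) ^ (b * j) := by
      rintro m b ⟨c, hc⟩
      rw [← ee_int_mul, show m = b + 6 * c by lia]
      push_cast
      rw [show ((b : ℂ) + 6 * c) * (j / 6) = b * j * (1 / 6) + (c * j : ℤ) by push_cast; ring,
        ee_add, ee_int, mul_one]
    have hsplit : ∀ w : ℂ, ee (w + n ^ 2 * τ / (2 * (6 : ℕ))) =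
        ee w * ee (n * 0 + n ^ 2 * τ / (2 * (6 : ℕ))) := fun w => by rw [← ee_add]; ring_nf
    rw [hsplit (n * (j / 6)), show (((-n : ℤ) : ℂ)) ^ 2 = (n : ℂ) ^ 2 by push_cast; ring,
      hsplit ((-n : ℤ) * (j / 6))]
    by_cases h : (6 : ℤ) ∣ n - a ∨ (6 : ℤ) ∣ n + a
    · have : ee (n * (j / 6)) + ee ((-n : ℤ) * (j / 6)) =
          ee (1 / 6) ^ (a * j) + (ee (1 / 6))⁻¹ ^ (a * j) := by
        rw [inv_zpow']
        rcases h with h | h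
        · rw [key n a h, key (-n) (-a) (by
            rw [show -n - -a = -(n - a) by ring]; exact (dvd_neg).2 h), neg_mul]
        · rw [key n (-a) (by simpa using h), key (-n) a (by
            rw [show -n - a = -(n + a) by ring]; exact (dvd_neg).2 h), neg_mul, add_comm]
      rw [← this]
      ring
    · have : orbitInd 6 a n = 0 := if_neg h
      rw [this]
      ring
  linear_combination h1 / 2

lemma det_cos_sixth : Matrix.det (Matrix.of fun a j : Fin 4 =>
    (ee (1 / 6) ^ (((a : ℕ) : ℤ) * ((j : ℕ) : ℤ)) +
      (ee (1 / 6))⁻¹ ^ (((a : ℕ) : ℤ) * ((j : ℕ) : ℤ))) / 2) = 9 := by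
  have h2 := ee_sixth_sq
  have hi := ee_sixth_inv
  set ζ := ee (1 / 6)
  have c0 : (ζ ^ 0 + ζ⁻¹ ^ 0) / 2 = 1 := by norm_num
  have c1 : (ζ ^ 1 + ζ⁻¹ ^ 1) / 2 = 1 / 2 := by rw [hi]; ring
  have i2 : ζ⁻¹ ^ 2 = -ζ := by rw [hi]; linear_combination h2
  have z3 : ζ ^ 3 = -1 := by linear_combination (ζ + 1) * h2
  have i3 : ζ⁻¹ ^ 3 = -1 := by rw [inv_pow, z3]; norm_num
  have c2 : (ζ ^ 2 + ζ⁻¹ ^ 2) / 2 = -1 / 2 := by rw [i2, h2]; ring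
  have c3 : (ζ ^ 3 + ζ⁻¹ ^ 3) / 2 = -1 := by rw [i3, z3]; norm_num
  have c4 : (ζ ^ 4 + ζ⁻¹ ^ 4) / 2 = -1 / 2 := by
    rw [show ζ ^ 4 = ζ ^ 3 * ζ by ring, show ζ⁻¹ ^ 4 = ζ⁻¹ ^ 3 * ζ⁻¹ by ring, i3, z3, hi]; ring
  have c6 : (ζ ^ 6 + ζ⁻¹ ^ 6) / 2 = 1 := by
    rw [show ζ ^ 6 = (ζ ^ 3) ^ 2 by ring, show ζ⁻¹ ^ 6 = (ζ⁻¹ ^ 3) ^ 2 by ring, i3, z3]; norm_num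
  have c9 : (ζ ^ 9 + ζ⁻¹ ^ 9) / 2 = -1 := by
    rw [show ζ ^ 9 = (ζ ^ 3) ^ 3 by ring, show ζ⁻¹ ^ 9 = (ζ⁻¹ ^ 3) ^ 3 by ring, i3, z3]; norm_num
  simp only [← Nat.cast_mul, zpow_natCast]
  have : (Matrix.of fun a j : Fin 4 => (ζ ^ ((a : ℕ) * (j : ℕ)) + ζ⁻¹ ^ ((a : ℕ) * (j : ℕ))) / 2) =
      !![1, 1, 1, 1; 1, 1 / 2, -1 / 2, -1; 1, -1 / 2, -1 / 2, 1; 1, -1, 1, -1] := by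
    ext a j
    fin_cases a <;> fin_cases j <;>
      first | exact c0 | exact c1 | exact c2 | exact c3 | exact c4 | exact c6 | exact c9
  rw [this]
  simp [Matrix.det_succ_row_zero, Fin.sum_univ_succ, Fin.succAbove]
  norm_num

lemma detTheta_six_sixths {τ : ℂ} (hτ : 0 < τ.im) :
    detTheta 6 (fun j => ((j : ℕ) : ℂ) / 6) τ = 9 * ∏ a : Fin 4, thetaOrbit 6 (a : ℕ) 0 τ := by
  have h : ∀ a j : Fin 4, thetaOrbit 6 (a : ℕ) (((j : ℕ) : ℂ) / 6) τ =
      thetaOrbit 6 (a : ℕ) 0 τ * ((ee (1 / 6) ^ (((a : ℕ) : ℤ) * ((j : ℕ) : ℤ)) +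
        (ee (1 / 6))⁻¹ ^ (((a : ℕ) : ℤ) * ((j : ℕ) : ℤ))) / 2) := fun a j => by
    rw [mul_comm]
    simpa only [Int.cast_natCast] using thetaOrbit_six_div (a : ℕ) (j : ℕ) hτ
  simp only [detTheta, h]
  rw [← det_cos_sixth, mul_comm]
  exact Matrix.det_mul_column (fun a : Fin 4 => thetaOrbit 6 (a : ℕ) 0 τ) _

end EllipticD4

namespace EllipticD4

open Complex Filter Topology

/-! ### The denominator of type `D₄` as a product -/

/-- The theta function `Θ₀(z) Θ₁(w) - Θ₁(z) Θ₀(w)` of level `2` in both variables. -/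
def thetaPair (z w τ : ℂ) : ℂ :=
  thetaOrbit 2 0 z τ * thetaOrbit 2 1 w τ - thetaOrbit 2 1 z τ * thetaOrbit 2 0 w τ

lemma thetaPair_eq (z w : ℂ) {τ : ℂ} (hτ : 0 < τ.im) :
    thetaPair z w τ = thetaOdd (z + w) τ * thetaOdd (w - z) τ := by
  rw [thetaPair, thetaOrbit_two_wronskian z w hτ, ← neg_sub z w, thetaOdd_neg]
  ring

/-- The coefficients of the product of three theta functions of level `2`. -/
def cubicCoeff (a b c : ℤ) (τ : ℂ) : ℤ → ℂ :=
  thetaConv 4 2 (thetaConv 2 2 (orbitInd 2 a) (orbitInd 2 b) τ) (orbitInd 2 c) τ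

lemma evenPeriodic_cubicCoeff (a b c : ℤ) (τ : ℂ) : EvenPeriodic 6 (cubicCoeff a b c τ) :=
  EvenPeriodic.thetaConv (by norm_num) (by norm_num)
    (EvenPeriodic.thetaConv (by norm_num) (by norm_num) (evenPeriodic_orbitInd 2 a)
      (evenPeriodic_orbitInd 2 b) τ) (evenPeriodic_orbitInd 2 c) τ

lemma thetaOrbit_two_mul_mul (a b c : ℤ) (z : ℂ) {τ : ℂ} (hτ : 0 < τ.im) :
    thetaOrbit 2 a z τ * thetaOrbit 2 b z τ * thetaOrbit 2 c z τ =
      thetaSeries 6 (cubicCoeff a b c τ) z τ := by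
  have h2 := fun a => evenPeriodic_orbitInd 2 a
  rw [thetaOrbit, thetaOrbit, thetaOrbit,
    thetaSeries_mul (by norm_num) (by norm_num) (h2 a) (h2 b) z hτ,
    thetaSeries_mul (by norm_num) (by norm_num)
      (EvenPeriodic.thetaConv (by norm_num) (by norm_num) (h2 a) (h2 b) τ) (h2 c) z hτ]
  rfl

/-- The product is a homogeneous Vandermonde determinant in the two even functions of level 2. Its
entries are cubic monomials in them, hence even of level 6, and `det_thetaSeries` applies. -/
lemma exists_prod_thetaPair {τ : ℂ} (hτ : 0 < τ.im) : ∃ c : ℂ, ∀ z : Fin 4 → ℂ,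
    ∏ i, ∏ j ∈ Finset.Ioi i, thetaPair (z i) (z j) τ = c * detTheta 6 z τ := by
  let γ : Fin 4 → ℤ → ℂ :=
    ![cubicCoeff 0 0 0 τ, cubicCoeff 1 0 0 τ, cubicCoeff 1 1 0 τ, cubicCoeff 1 1 1 τ]
  have hγ : ∀ c, EvenPeriodic 6 (γ c) := by
    intro c; fin_cases c <;> exact evenPeriodic_cubicCoeff _ _ _ _
  refine ⟨_, fun z => Eq.trans ?_ (det_thetaSeries (Or.inl rfl) hγ z hτ)⟩
  have h := Matrix.det_projVandermonde (fun i => thetaOrbit 2 1 (z i) τ)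
    (fun i => thetaOrbit 2 0 (z i) τ)
  rw [← Matrix.det_transpose] at h
  have hM : (Matrix.projVandermonde (fun i => thetaOrbit 2 1 (z i) τ)
      (fun i => thetaOrbit 2 0 (z i) τ)).transpose =
      Matrix.of fun c j : Fin 4 => thetaSeries 6 (γ c) (z j) τ := by
    ext c j
    rw [Matrix.transpose_apply, Matrix.projVandermonde_apply, Matrix.of_apply]
    fin_cases c <;> simp [γ, Fin.rev] <;> rw [← thetaOrbit_two_mul_mul _ _ _ _ hτ] <;> ring
  rw [← hM, h]
  refine Finset.prod_congr rfl fun i _ => Finset.prod_congr rfl fun j _ => ?_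
  rw [thetaPair]
  ring

lemma prod_pairs_fin_four {M : Type*} [CommMonoid M] (f : Fin 4 → Fin 4 → M) :
    ∏ i, ∏ j ∈ Finset.Ioi i, f i j = f 0 1 * f 0 2 * f 0 3 * (f 1 2 * f 1 3) * f 2 3 := by
  have h0 : Finset.Ioi (0 : Fin 4) = {1, 2, 3} := by decide
  have h1 : Finset.Ioi (1 : Fin 4) = {2, 3} := by decide
  have h2 : Finset.Ioi (2 : Fin 4) = {3} := by decide
  have h3 : Finset.Ioi (3 : Fin 4) = ∅ := by decide
  simp [Fin.prod_univ_four, h0, h1, h2, h3, mul_assoc]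

lemma ee_quarter : ee (1 / 4) = I := by
  rw [ee, show 2 * (Real.pi : ℂ) * I * (1 / 4) = Real.pi / 2 * I by ring, exp_pi_div_two_mul_I]

/-- The product formula contains the arguments `ζq` and `ζ⁻¹q` with `ζ = e^{πi/3}`, which are `-q`
times the two nontrivial cube roots of unity. The factor `(-q; q)_∞` supplies the third. -/
lemma thetaOdd_sixth {τ : ℂ} (hτ : 0 < τ.im) :
    thetaOdd (1 / 6) τ * qPoch (-ee τ) (ee τ) =
      I * ee (τ / 8) * qPoch (ee τ) (ee τ) * qPoch (-ee τ ^ 3) (ee τ ^ 3) := by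
  have hq := norm_ee_lt_one hτ
  have hz := ee_sixth_sq
  have hi := ee_sixth_inv
  have h3 := qPoch_mul_cube_roots hq (ω := ee (1 / 6) - 1) (by linear_combination hz) (-ee τ)
  have e1 : (ee (1 / 6) - 1) * -ee τ = (1 - ee (1 / 6)) * ee τ := by ring
  have e2 : (ee (1 / 6) - 1) ^ 2 * -ee τ = ee (1 / 6) * ee τ := by linear_combination -ee τ * hz
  have e3 : (-ee τ) ^ 3 = -ee τ ^ 3 := by ring
  have e4 : ee (1 / 12) * ee (1 / 6) = I := by rw [← ee_quarter, ← ee_add]; norm_num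
  rw [e1, e2, e3] at h3
  rw [thetaOdd_eq_qPoch _ hτ, ← h3, ee_neg, hi, ee_add (1 / 6) τ, ee_add (1 / 6 / 2) (τ / 8),
    qPoch_eq_one_sub_mul hq (1 - ee (1 / 6)), ← e4]
  norm_num
  ring

/-- Here the arguments are `q` times the nontrivial cube roots of unity. Squaring replaces the
leading constant by its rational square `-3`. -/
lemma thetaOdd_third {τ : ℂ} (hτ : 0 < τ.im) :
    thetaOdd (1 / 3) τ ^ 2 = -3 * (ee (τ / 8) * qPoch (ee τ ^ 3) (ee τ ^ 3)) ^ 2 := by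
  have hq := norm_ee_lt_one hτ
  have hz := ee_sixth_sq
  have h3 := qPoch_mul_cube_roots hq (ω := ee (1 / 6) - 1) (by linear_combination hz) (ee τ)
  have e1 : ee (1 / 3) = ee (1 / 6) - 1 := by rw [← hz, ← ee_nat_mul]; norm_num
  have e2 : ee (-(1 / 3)) = (ee (1 / 6) - 1) ^ 2 := by
    rw [ee_neg, e1]
    refine inv_eq_of_mul_eq_one_left ?_
    linear_combination (ee (1 / 6) - 2) * hz
  have e3 : (ee (1 / 6) * (1 - (ee (1 / 6) - 1) ^ 2)) ^ 2 = -3 := by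
    have : (ee (1 / 6) - 1) ^ 2 = -ee (1 / 6) := by linear_combination hz
    rw [this]
    linear_combination (ee (1 / 6) ^ 2 + 3 * ee (1 / 6) + 3) * hz
  rw [thetaOdd_eq_qPoch _ hτ, e2, ee_add (1 / 3) τ, e1, ee_add (1 / 3 / 2) (τ / 8),
    qPoch_eq_one_sub_mul hq ((ee (1 / 6) - 1) ^ 2), ← h3, ← e3]
  norm_num
  ring

lemma thetaOdd_half {τ : ℂ} (hτ : 0 < τ.im) :
    thetaOdd (1 / 2) τ =
      2 * I * ee (τ / 8) * qPoch (ee τ) (ee τ) * qPoch (-ee τ) (ee τ) ^ 2 := by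
  have hq := norm_ee_lt_one hτ
  rw [thetaOdd_eq_qPoch _ hτ, ee_neg, ee_add (1 / 2) τ, ee_half, ee_add (1 / 2 / 2) (τ / 8),
    show (1 / 2 / 2 : ℂ) = 1 / 4 by norm_num, ee_quarter, show (-1 : ℂ)⁻¹ = -1 by norm_num,
    qPoch_eq_one_sub_mul hq (-1), neg_one_mul]
  ring

/-- Sums and differences of pairs from `0, 1, 2, 3` give `1` four times, `2` and `3` three times,
and `4` and `5` once; the last two reduce to `2` and `1` by oddness and `z ↦ z + 1`. -/
lemma prod_thetaPair_sixths {τ : ℂ} (hτ : 0 < τ.im) :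
    ∏ i : Fin 4, ∏ j ∈ Finset.Ioi i, thetaPair (((i : ℕ) : ℂ) / 6) (((j : ℕ) : ℂ) / 6) τ =
      thetaOdd (1 / 6) τ ^ 5 * (thetaOdd (1 / 3) τ ^ 2) ^ 2 * thetaOdd (1 / 2) τ ^ 3 := by
  have h4 : thetaOdd (4 / 6) τ = thetaOdd (1 / 3) τ := by
    rw [show (4 / 6 : ℂ) = -(1 / 3) + 1 by norm_num, thetaOdd_add_one, thetaOdd_neg, neg_neg]
  have h5 : thetaOdd (5 / 6) τ = thetaOdd (1 / 6) τ := by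
    rw [show (5 / 6 : ℂ) = -(1 / 6) + 1 by norm_num, thetaOdd_add_one, thetaOdd_neg, neg_neg]
  simp only [thetaPair_eq _ _ hτ]
  rw [prod_pairs_fin_four]
  norm_num
  norm_num at h4 h5
  rw [h4, h5]
  ring

/-- The constant of `exists_prod_thetaPair` is found at `z_j = j/6`, where both sides are explicit
infinite products and the determinant does not vanish. -/
lemma prod_thetaPair_eq_eta (z : Fin 4 → ℂ) {τ : ℂ} (hτ : 0 < τ.im) :
    ∏ i, ∏ j ∈ Finset.Ioi i, thetaPair (z i) (z j) τ =
      ModularForm.eta τ ^ 8 * detTheta 6 z τ := by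
  obtain ⟨c, hc⟩ := exists_prod_thetaPair hτ
  have hq := norm_ee_lt_one hτ
  rw [hc z]
  congr 1
  have h := hc fun j => ((j : ℕ) : ℂ) / 6
  rw [prod_thetaPair_sixths hτ, detTheta_six_sixths hτ, prod_thetaOrbit_six_zero hτ,
    thetaOdd_third hτ, thetaOdd_half hτ] at h
  have hb : qPoch (-ee τ) (ee τ) ≠ 0 := qPoch_ne_zero_of_norm_lt_one hq (by simpa using hq)
  have hq3 := norm_pow_lt_one' hq (k := 3) (by norm_num)
  have hd : qPoch (-ee τ ^ 3) (ee τ ^ 3) ≠ 0 :=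
    qPoch_ne_zero_of_norm_lt_one hq3 (by simpa using hq3)
  have h6 : qPoch (ee τ ^ 6) (ee τ ^ 6) ≠ 0 :=
    qPoch_ne_zero_of_norm_lt_one (norm_pow_lt_one' hq (by norm_num))
      (norm_pow_lt_one' hq (by norm_num))
  have h36 := qPoch_mul_qPoch_neg hq3 (ee τ ^ 3)
  rw [← pow_mul] at h36
  norm_num at h36
  have e1 : ee (τ / 8) ^ 12 = ee (τ / 24) ^ 8 * ee (7 * τ / 6) := by
    rw [← ee_nat_mul, ← ee_nat_mul, ← ee_add]; push_cast; ring_nf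
  have h1 := thetaOdd_sixth hτ
  rw [eta_eq_qPoch]
  have hI : I ^ 8 = 1 := by rw [show I ^ 8 = (I ^ 2) ^ 4 by ring, I_sq]; norm_num
  -- The cancelled factor is the determinant at the sixths; `72 = 9 · 8` joins the cosine
  -- determinant and the product of theta constants.
  refine mul_right_cancel₀ (mul_ne_zero (mul_ne_zero (mul_ne_zero (mul_ne_zero
    (by norm_num : (72 : ℂ) ≠ 0) (ee_ne_zero (7 * τ / 6))) (pow_ne_zero 4 h6)) hb) hd) ?_
  set φ := qPoch (ee τ) (ee τ)
  set b := qPoch (-ee τ) (ee τ)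
  set d := qPoch (-ee τ ^ 3) (ee τ ^ 3)
  -- The cube of `thetaOdd_half` supplies `b ^ 6`, of which five factors are spent here.
  have h5 : thetaOdd (1 / 6) τ ^ 5 * b ^ 5 = (I * ee (τ / 8) * φ * d) ^ 5 := by
    rw [← mul_pow, h1]
  rw [← h36] at h ⊢
  linear_combination -h + 72 * (ee (τ / 8) ^ 7 * qPoch (ee τ ^ 3) (ee τ ^ 3) ^ 4 * I ^ 3 * φ ^ 3 * b) * h5
    + (72 * (ee (τ / 8) ^ 12 * qPoch (ee τ ^ 3) (ee τ ^ 3) ^ 4 * φ ^ 8 * d ^ 5 * b)) * hI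
    + 72 * (qPoch (ee τ ^ 3) (ee τ ^ 3) ^ 4 * φ ^ 8 * d ^ 5 * b) * e1

/-! ### Multiplication of the denominator by theta functions of level one -/

lemma thetaOdd_mul_seven {τ : ℂ} (hτ : 0 < τ.im) {r : ℕ} (hr : r ≤ 7) (hr0 : r ≠ 0) :
    thetaOdd (r * τ) (7 * τ) = -(ee (7 * τ / 8 - r * τ / 2) *
      (qPoch (ee τ ^ 7) (ee τ ^ 7) * qPoch (ee τ ^ r) (ee τ ^ 7) *
        qPoch (ee τ ^ (7 - r)) (ee τ ^ 7))) := by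
  have hq := norm_ee_lt_one hτ
  have hq7 := norm_pow_lt_one' hq (k := 7) (by norm_num)
  have hτ7 : 0 < (7 * τ).im := by
    have := im_natCast_mul_pos hτ (k := 7) (by norm_num)
    exact_mod_cast this
  have e7 : ee (7 * τ) = ee τ ^ 7 := by rw [← ee_nat_mul]; norm_num
  have hr1 : 1 - ee τ ^ r ≠ 0 := by
    obtain ⟨k, rfl⟩ := Nat.exists_eq_succ_of_ne_zero hr0
    exact one_sub_pow_ne_zero hq k
  have h1 := qPoch_eq_one_sub_mul hq7 (ee τ ^ r)
  have h2 := qPoch_eq_one_sub_mul hq7 (ee (-(r * τ)))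
  have e1 : ee (-(r * τ)) * ee τ ^ 7 = ee τ ^ (7 - r) := by
    rw [← ee_nat_mul, ← ee_nat_mul, ← ee_add, Nat.cast_sub hr]; ring_nf
  have e2 : ee (r * τ + 7 * τ) = ee τ ^ r * ee τ ^ 7 := by rw [ee_add, ee_nat_mul, e7]
  have e3 : ee (r * τ / 2 + 7 * τ / 8) = ee (7 * τ / 8 - r * τ / 2) * ee τ ^ r := by
    rw [← ee_nat_mul, ← ee_add]; ring_nf
  have e4 : ee τ ^ r * ee (-(r * τ)) = 1 := by rw [← ee_nat_mul, ee_mul_neg]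
  rw [thetaOdd_eq_qPoch _ hτ7, e7, e2, h2, e1, e3, h1]
  linear_combination (-ee (7 * τ / 8 - r * τ / 2) * qPoch (ee τ ^ 7) (ee τ ^ 7) *
    qPoch (ee τ ^ r * ee τ ^ 7) (ee τ ^ 7) * qPoch (ee τ ^ (7 - r)) (ee τ ^ 7)) * e4

/-- In the product formula at modulus `7τ` the multiples `r = 1, …, 5` of `τ` occur 4, 3, 3, 1, 1
times. As `r` and `7 - r` give the same pair of products, each nonzero class modulo 7 occurs four
times, which yields `(q; q)_∞⁴` and powers of `(q⁷; q⁷)_∞`. -/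
lemma detTheta_six_seven {τ : ℂ} (hτ : 0 < τ.im) :
    ee (6 * τ) * detTheta 6 (fun j => ((j : ℕ) : ℂ) * τ) (7 * τ) = ModularForm.eta τ ^ 4 := by
  have hq := norm_ee_lt_one hτ
  have hτ7 : 0 < (7 * τ).im := by
    have := im_natCast_mul_pos hτ (k := 7) (by norm_num)
    exact_mod_cast this
  have hne : ModularForm.eta (7 * τ) ^ 8 ≠ 0 := pow_ne_zero 8 (ModularForm.eta_ne_zero hτ7)
  refine mul_left_cancel₀ hne ?_
  have h := prod_thetaPair_eq_eta (fun j => ((j : ℕ) : ℂ) * τ) hτ7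
  rw [mul_left_comm, ← h, prod_pairs_fin_four]
  simp only [thetaPair_eq _ _ hτ7, ← add_mul, ← sub_mul]
  norm_num
  have t := fun (r : ℕ) (h : r ≤ 7) (h' : r ≠ 0) => thetaOdd_mul_seven hτ h h'
  have t1 := t 1 (by norm_num) (by norm_num)
  have t2 := t 2 (by norm_num) (by norm_num)
  have t3 := t 3 (by norm_num) (by norm_num)
  have t4 := t 4 (by norm_num) (by norm_num)
  have t5 := t 5 (by norm_num) (by norm_num)
  norm_num at t1 t2 t3 t4 t5
  have hp := prod_qPoch_pow hq (ee τ) (k := 7) (by norm_num)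
  simp only [Finset.prod_range_succ, Finset.prod_range_zero, one_mul, ← pow_succ'] at hp
  norm_num at hp
  have e7 : ee (7 * τ) = ee τ ^ 7 := by rw [← ee_nat_mul]; norm_num
  rw [t1, t2, t3, t4, t5, eta_eq_qPoch, eta_eq_qPoch, ← hp, e7]
  have e1 : ee (6 * τ) * (ee (7 * τ / 8 - τ / 2) ^ 4 * ee (7 * τ / 8 - τ) ^ 3 *
      ee (7 * τ / 8 - 3 * τ / 2) ^ 3 * ee (7 * τ / 8 - 4 * τ / 2) * ee (7 * τ / 8 - 5 * τ / 2)) =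
      ee (7 * τ / 24) ^ 8 * ee (τ / 24) ^ 4 := by
    simp only [← ee_nat_mul, ← ee_add]; push_cast; ring_nf
  linear_combination (qPoch (ee τ ^ 7) (ee τ ^ 7) ^ 12 * (qPoch (ee τ) (ee τ ^ 7) *
    qPoch (ee τ ^ 2) (ee τ ^ 7) * qPoch (ee τ ^ 3) (ee τ ^ 7) * qPoch (ee τ ^ 4) (ee τ ^ 7) *
    qPoch (ee τ ^ 5) (ee τ ^ 7) * qPoch (ee τ ^ 6) (ee τ ^ 7)) ^ 4) * e1

lemma jacobiTheta₂_eq_thetaSeries (z τ : ℂ) :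
    jacobiTheta₂ z τ = thetaSeries 1 (fun _ => 1) z τ := by
  simp only [jacobiTheta₂, thetaSeries, jacobiTheta₂_term_eq_ee]
  exact tsum_congr fun n => by push_cast; ring_nf

/-- The product of the level `6` determinant with four theta functions of level `1`. -/
theorem prod_jacobiTheta₂_mul_detTheta_six (z : Fin 4 → ℂ) {τ : ℂ} (hτ : 0 < τ.im) :
    (∏ j, jacobiTheta₂ (z j) τ) * detTheta 6 z τ = ModularForm.eta τ ^ 4 * detTheta 7 z τ := by
  let γ : Fin 4 → ℤ → ℂ := fun a => thetaConv 6 1 (orbitInd 6 (a : ℕ)) (fun _ => 1) τ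
  have h1 : EvenPeriodic 1 fun _ => 1 := ⟨fun _ => rfl, fun _ => rfl⟩
  have hγ : ∀ a, EvenPeriodic 7 (γ a) := fun a =>
    EvenPeriodic.thetaConv (by norm_num) (by norm_num) (evenPeriodic_orbitInd 6 _) h1 τ
  -- The exponent is `m²/12 + (b - m)²/2 - b²/14 = 7m²/12 - bm + 3b²/7`, so after `m ↦ -m` the
  -- coefficient is itself a level 6 theta function at `7τ`. The prefactors multiply to `ee (6 *
  -- τ)`.
  have hcoef : ∀ a b : Fin 4, γ a (b : ℕ) =
      ee (3 * ((b : ℕ) : ℂ) ^ 2 * τ / 7) * thetaOrbit 6 (a : ℕ) (((b : ℕ) : ℂ) * τ) (7 * τ) := by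
    intro a b
    simp only [γ, thetaConv, thetaOrbit, thetaSeries]
    rw [← tsum_mul_left, ← (Equiv.neg ℤ).tsum_eq]
    refine tsum_congr fun m => ?_
    simp only [Equiv.neg_apply, (evenPeriodic_orbitInd 6 _).neg]
    rw [mul_one, mul_left_comm, ← ee_add]
    congr 2
    push_cast
    ring
  have h := det_thetaSeries (Or.inr rfl) hγ z hτ
  have hL : (Matrix.of fun c j : Fin 4 => thetaSeries 7 (γ c) (z j) τ) =
      Matrix.of fun c j : Fin 4 => jacobiTheta₂ (z j) τ * thetaOrbit 6 (c : ℕ) (z j) τ := by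
    ext c j
    rw [Matrix.of_apply, Matrix.of_apply, mul_comm, jacobiTheta₂_eq_thetaSeries, thetaOrbit,
      thetaSeries_mul (by norm_num) (by norm_num) (evenPeriodic_orbitInd 6 _) h1 _ hτ]
  rw [hL] at h
  have hdet := Matrix.det_mul_row (fun j => jacobiTheta₂ (z j) τ)
    (Matrix.of fun c j : Fin 4 => thetaOrbit 6 (c : ℕ) (z j) τ)
  simp only [Matrix.of_apply] at hdet
  rw [detTheta, ← hdet, h, ← detTheta_six_seven hτ]
  congr 1
  simp only [hcoef]
  have hdet' := Matrix.det_mul_row (fun b : Fin 4 => ee (3 * ((b : ℕ) : ℂ) ^ 2 * τ / 7))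
    (Matrix.of fun a b : Fin 4 => thetaOrbit 6 (a : ℕ) (((b : ℕ) : ℂ) * τ) (7 * τ))
  simp only [Matrix.of_apply] at hdet'
  rw [hdet', detTheta]
  congr 1
  simp only [Fin.prod_univ_four, ← ee_add]
  norm_num
  ring_nf

end EllipticD4

namespace EllipticD4

open Complex Filter Topology Equiv

/-! ### The affine Weyl group as a group of signed permutations and translations -/

/-- A signed permutation of the coordinates of `F_cl` followed by a translation. -/
structure SignedAffine where
  perm : Perm (Fin 4)
  sgn : Fin 4 → ℤˣ
  shift : Fin 4 → ℤ

namespace SignedAffine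

/-- The linear map of `F̃` given by the signed permutation and the translation. -/
def toLin (d : SignedAffine) : HypSpace →ₗ[ℝ] HypSpace where
  toFun u := (fun i => (d.sgn i : ℤ) * u.1 (d.perm⁻¹ i) + u.2.2.2 * d.shift i,
    u.2.1 - ∑ i, (d.sgn i : ℤ) * u.1 (d.perm⁻¹ i) * d.shift i -
      u.2.2.2 * (∑ i, (d.shift i : ℝ) ^ 2) / 2, u.2.2.1, u.2.2.2)
  map_add' u v := by
    ext i
    · simp; ring
    · simp only [Prod.fst_add, Prod.snd_add, Pi.add_apply, mul_add, add_mul, Finset.sum_add_distrib]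
      ring
    · simp
    · simp
  map_smul' c u := by
    ext i
    · simp; ring
    · simp only [Prod.smul_fst, Prod.smul_snd, Pi.smul_apply, smul_eq_mul, RingHom.id_apply,
        mul_sub, Finset.mul_sum]
      congr 1
      · congr 1
        exact Finset.sum_congr rfl fun i _ => by ring
      · simp only [← Finset.mul_sum]
        ring
    · simp
    · simp

/-- The composition of two signed permutations with translations. -/
def comp (d d' : SignedAffine) : SignedAffine :=
  ⟨d.perm * d'.perm, fun i => d.sgn i * d'.sgn (d.perm⁻¹ i),
    fun i => d.sgn i * d'.shift (d.perm⁻¹ i) + d.shift i⟩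

lemma sgn_mul_self (d : SignedAffine) (i : Fin 4) :
    ((d.sgn i : ℤ) : ℝ) * ((d.sgn i : ℤ) : ℝ) = 1 := by
  rcases Int.units_eq_one_or (d.sgn i) with h | h <;> simp [h]

lemma toLin_comp (d d' : SignedAffine) : (d.comp d').toLin = d.toLin ∘ₗ d'.toLin := by
  refine LinearMap.ext fun u => ?_
  have hperm : ∀ f : Fin 4 → ℝ, ∑ i, f (d.perm⁻¹ i) = ∑ i, f i := fun f =>
    Equiv.sum_comp d.perm⁻¹ f
  ext i
  · simp [toLin, comp]; ring
  · have h1 : ∑ i, ((d'.sgn i : ℤ) : ℝ) * u.1 (d'.perm⁻¹ i) * d'.shift i =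
        ∑ i, ((d.sgn i : ℤ) : ℝ) * ((d.sgn i : ℤ) : ℝ) *
          (((d'.sgn (d.perm⁻¹ i) : ℤ) : ℝ) * u.1 (d'.perm⁻¹ (d.perm⁻¹ i)) *
            d'.shift (d.perm⁻¹ i)) := by
      rw [← hperm]
      exact Finset.sum_congr rfl fun i _ => by rw [sgn_mul_self, one_mul]
    have h2 : ∑ i, (d'.shift i : ℝ) ^ 2 =
        ∑ i, ((d.sgn i : ℤ) : ℝ) * ((d.sgn i : ℤ) : ℝ) * (d'.shift (d.perm⁻¹ i) : ℝ) ^ 2 := by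
      rw [← hperm]
      exact Finset.sum_congr rfl fun i _ => by rw [sgn_mul_self, one_mul]
    simp only [toLin, comp, LinearMap.coe_mk, AddHom.coe_mk, LinearMap.comp_apply, h1, h2]
    push_cast
    simp only [mul_inv_rev, Perm.coe_mul, Function.comp]
    rw [sub_sub, sub_sub, sub_sub, sub_sub]
    congr 1
    simp only [Finset.mul_sum, Finset.sum_div, ← Finset.sum_add_distrib]
    exact Finset.sum_congr rfl fun i _ => by ring
  · simp [toLin]
  · simp [toLin]

/-- The identity. -/
def id : SignedAffine := ⟨1, 1, 0⟩

/-- The inverse of a signed permutation with translation. -/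
def inv (d : SignedAffine) : SignedAffine :=
  ⟨d.perm⁻¹, fun i => d.sgn (d.perm i), fun i => -(d.sgn (d.perm i) * d.shift (d.perm i))⟩

lemma toLin_id : id.toLin = LinearMap.id := by
  refine LinearMap.ext fun u => ?_
  simp [toLin, id]

lemma comp_inv (d : SignedAffine) : d.comp d.inv = id := by
  simp only [comp, inv, id, mk.injEq]
  refine ⟨mul_inv_cancel _, ?_, ?_⟩
  · ext i; simp
  · ext i
    rcases Int.units_eq_one_or (d.sgn i) with h | h <;> simp [h]

lemma inv_comp (d : SignedAffine) : d.inv.comp d = id := by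
  simp only [comp, inv, id, mk.injEq]
  refine ⟨inv_mul_cancel _, ?_, ?_⟩
  · ext i; simp
  · ext i; simp

/-- The linear automorphism of `F̃` given by the signed permutation and the translation. -/
def toEquiv (d : SignedAffine) : HypSpace ≃ₗ[ℝ] HypSpace :=
  LinearEquiv.ofLinearMap d.toLin d.inv.toLin (by rw [← toLin_comp, comp_inv, toLin_id])
    (by rw [← toLin_comp, inv_comp, toLin_id])

lemma toEquiv_apply (d : SignedAffine) (u : HypSpace) : d.toEquiv u = d.toLin u := rfl

lemma toEquiv_comp (d d' : SignedAffine) : (d.comp d').toEquiv = d.toEquiv * d'.toEquiv := by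
  refine LinearEquiv.ext fun u => ?_
  simp only [toEquiv_apply, toLin_comp, LinearEquiv.mul_apply, LinearMap.comp_apply]

lemma toEquiv_id : id.toEquiv = 1 := by
  refine LinearEquiv.ext fun u => ?_
  rw [toEquiv_apply, toLin_id]; rfl

lemma toEquiv_inv (d : SignedAffine) : d.inv.toEquiv = d.toEquiv⁻¹ := by
  rw [eq_inv_iff_mul_eq_one, ← toEquiv_comp, inv_comp, toEquiv_id]

/-- The image of `Λ₀` reveals the shift. The image of `(1, 2, 3, 4)`, whose entries have distinct
nonzero absolute values, reveals the permutation and the signs. -/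
lemma toEquiv_injective : Function.Injective toEquiv := by
  intro d d' h
  obtain ⟨σ, s, β⟩ := d
  obtain ⟨σ', s', β'⟩ := d'
  have hβ : β = β' := by
    have h1 := congrArg (fun f : HypSpace ≃ₗ[ℝ] HypSpace => (f (0, 0, 0, 1)).1) h
    ext i
    have h2 := congrFun h1 i
    simpa [toEquiv_apply, toLin] using h2
  have h1 := congrArg (fun f : HypSpace ≃ₗ[ℝ] HypSpace =>
    (f (fun i => ((i : ℕ) : ℝ) + 1, 0, 0, 0)).1) h
  have h2 : ∀ i, ((s i : ℤ) : ℝ) * (((σ⁻¹ i : Fin 4) : ℕ) + 1) =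
      ((s' i : ℤ) : ℝ) * (((σ'⁻¹ i : Fin 4) : ℕ) + 1) := fun i => by
    simpa [toEquiv_apply, toLin] using congrFun h1 i
  have h3 : ∀ i, (s i : ℤ) * ((((σ⁻¹ i : Fin 4) : ℕ) : ℤ) + 1) =
      (s' i : ℤ) * ((((σ'⁻¹ i : Fin 4) : ℕ) : ℤ) + 1) := fun i => by exact_mod_cast h2 i
  have h4 : ∀ i, s i = s' i ∧ σ⁻¹ i = σ'⁻¹ i := by
    intro i
    have h := h3 i
    rcases Int.units_eq_one_or (s i) with hs | hs <;>
      rcases Int.units_eq_one_or (s' i) with hs' | hs' <;> rw [hs, hs'] at h ⊢ <;>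
      simp only [Units.val_one, Units.val_neg, one_mul, neg_mul] at h
    · exact ⟨rfl, Fin.ext (by lia)⟩
    · lia
    · lia
    · exact ⟨rfl, Fin.ext (by lia)⟩
  have hs : s = s' := funext fun i => (h4 i).1
  have hσ : σ = σ' := inv_injective (Equiv.ext fun i => (h4 i).2)
  rw [hβ, hs, hσ]

/-- The parity conditions that single out the affine Weyl group of type `D₄`. -/
def IsEven (d : SignedAffine) : Prop := ∏ i, d.sgn i = 1 ∧ Even (∑ i, d.shift i)

lemma IsEven.comp {d d' : SignedAffine} (h : d.IsEven) (h' : d'.IsEven) : (d.comp d').IsEven := by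
  refine ⟨?_, ?_⟩
  · simp only [SignedAffine.comp, Finset.prod_mul_distrib]
    rw [h.1, one_mul, Equiv.prod_comp d.perm⁻¹ d'.sgn, h'.1]
  · simp only [SignedAffine.comp, Finset.sum_add_distrib]
    refine Even.add ?_ h.2
    have h1 : Even (∑ i, (d.sgn i * d'.shift (d.perm⁻¹ i) - d'.shift (d.perm⁻¹ i)) : ℤ) := by
      refine Finset.even_sum _ fun i _ => ?_
      rcases Int.units_eq_one_or (d.sgn i) with hs | hs <;> rw [hs]
      · simp
      · exact ⟨-d'.shift (d.perm⁻¹ i), by simp; ring⟩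
    rw [Finset.sum_sub_distrib, Equiv.sum_comp d.perm⁻¹ d'.shift] at h1
    simpa using h1.add h'.2

/-- The signed permutations that give the simple reflections. -/
def simple : Fin 5 → SignedAffine :=
  ![⟨swap 0 1, ![-1, -1, 1, 1], ![1, 1, 0, 0]⟩, ⟨swap 0 1, 1, 0⟩, ⟨swap 1 2, 1, 0⟩,
    ⟨swap 2 3, 1, 0⟩, ⟨swap 2 3, ![1, 1, -1, -1], 0⟩]

lemma simple_isEven (i : Fin 5) : (simple i).IsEven := by
  fin_cases i <;> refine ⟨?_, ?_⟩ <;> simp [simple, Fin.prod_univ_four, Fin.sum_univ_four]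

lemma sign_simple_perm (i : Fin 5) : Perm.sign (simple i).perm = -1 := by
  fin_cases i <;> exact Perm.sign_swap (by decide)

lemma toEquiv_simple (i : Fin 5) : (simple i).toEquiv = simpleReflection i := by
  refine LinearEquiv.ext fun u => ?_
  obtain ⟨v, m, n, k⟩ := u
  rw [simpleReflection, Module.reflection_apply, toEquiv_apply, coroot, form_simpleRoot_self]
  have hswap : ∀ a b j : Fin 4, swap a b j = if j = a then b else if j = b then a else j :=
    swap_apply_def
  fin_cases i <;> ext j <;> (try fin_cases j) <;>
    simp [simple, toLin, form, simpleRoot, ofCl, delta, dotProduct, Fin.sum_univ_four, hswap,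
      Matrix.vecHead, Matrix.vecTail] <;>
    ring

/-- Every simple reflection is an even signed permutation with translation whose permutation is a
transposition, so its determinant `-1` agrees with the sign of the permutation; both are
multiplicative. -/
lemma exists_isEven_of_mem {w : HypSpace ≃ₗ[ℝ] HypSpace} (hw : w ∈ affineWeyl) :
    ∃ d : SignedAffine, d.IsEven ∧ d.toEquiv = w ∧
      sign ⟨w, hw⟩ = ((Perm.sign d.perm : ℤ) : ℝ) := by
  induction hw using Subgroup.closure_induction_left with
  | one =>
    refine ⟨id, ⟨by simp [id], by simp [id]⟩, toEquiv_id, ?_⟩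
    refine sign_one.trans ?_
    simp [id]
  | mul_left x hx y hy ih =>
    obtain ⟨i, rfl⟩ := hx
    obtain ⟨d, hd, rfl, hs⟩ := ih
    refine ⟨(simple i).comp d, (simple_isEven i).comp hd, ?_, ?_⟩
    · rw [toEquiv_comp, toEquiv_simple]
    · have h := sign_mul ⟨simpleReflection i, Subgroup.subset_closure ⟨i, rfl⟩⟩ ⟨d.toEquiv, hy⟩
      rw [hs, sign_simpleReflection] at h
      refine Eq.trans ?_ (h.trans ?_)
      · rfl
      · simp [comp, sign_simple_perm]
  | inv_mul_cancel x hx y hy ih =>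
    obtain ⟨i, rfl⟩ := hx
    obtain ⟨d, hd, rfl, hs⟩ := ih
    have hinv : (simpleReflection i)⁻¹ = simpleReflection i := by
      rw [inv_eq_iff_mul_eq_one]
      exact LinearEquiv.ext fun u => Module.involutive_reflection (form_coroot_self i) u
    refine ⟨(simple i).comp d, (simple_isEven i).comp hd, ?_, ?_⟩
    · rw [toEquiv_comp, toEquiv_simple, hinv]
    · have h := sign_mul ⟨simpleReflection i, Subgroup.subset_closure ⟨i, rfl⟩⟩ ⟨d.toEquiv, hy⟩
      rw [hs, sign_simpleReflection] at h
      refine Eq.trans ?_ (h.trans ?_)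
      · exact congrArg sign (Subtype.ext (congrArg (· * d.toEquiv) hinv))
      · simp [comp, sign_simple_perm]

/-! ### Generation of all even signed permutations and translations by the simple reflections -/

lemma simple_mem (i : Fin 5) : (simple i).toEquiv ∈ affineWeyl := by
  rw [toEquiv_simple]
  exact Subgroup.subset_closure ⟨i, rfl⟩

lemma comp_mem {d d' : SignedAffine} (h : d.toEquiv ∈ affineWeyl) (h' : d'.toEquiv ∈ affineWeyl) :
    (d.comp d').toEquiv ∈ affineWeyl := by
  rw [toEquiv_comp]; exact mul_mem h h'

lemma inv_mem {d : SignedAffine} (h : d.toEquiv ∈ affineWeyl) : d.inv.toEquiv ∈ affineWeyl := by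
  rw [toEquiv_inv]; exact affineWeyl.inv_mem h

lemma perm_mem (σ : Perm (Fin 4)) : (mk σ 1 0).toEquiv ∈ affineWeyl := by
  have h : σ ∈ Submonoid.closure (Set.range fun i : Fin 3 => swap i.castSucc i.succ) := by
    rw [Perm.mclosure_swap_castSucc_succ]; trivial
  induction h using Submonoid.closure_induction with
  | mem x hx =>
    obtain ⟨i, rfl⟩ := hx
    fin_cases i
    · exact simple_mem 1
    · exact simple_mem 2
    · exact simple_mem 3
  | one => rw [show mk 1 1 0 = id from rfl, toEquiv_id]; exact one_mem _
  | mul x y _ _ hx hy =>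
    have := comp_mem hx hy
    simpa [comp, Pi.one_def, Pi.zero_def] using this

/-- The sign vector that is `-1` at `i` and `j`. -/
def flip (i j : Fin 4) : Fin 4 → ℤˣ := fun k => if k = i ∨ k = j then -1 else 1

/-- The reflections in `e₃ - e₄` and `e₃ + e₄` compose to the sign change of the last two
coordinates; the other pairs are conjugate to it under permutations. -/
lemma flip_mem {i j : Fin 4} (hij : i ≠ j) : (mk 1 (flip i j) 0).toEquiv ∈ affineWeyl := by
  have h0 : (mk 1 (flip 2 3) 0).toEquiv ∈ affineWeyl := by
    have := comp_mem (simple_mem 4) (simple_mem 3)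
    convert this using 2
    simp only [simple, comp, mk.injEq]
    refine ⟨by simp, ?_, ?_⟩
    · ext k; fin_cases k <;> simp [flip]
    · ext k; simp
  obtain ⟨π, rfl, rfl⟩ : ∃ π : Perm (Fin 4), π 2 = i ∧ π 3 = j := by
    revert i j; decide
  have := comp_mem (comp_mem (perm_mem π) h0) (perm_mem π⁻¹)
  convert this using 2
  simp only [comp, mk.injEq]
  refine ⟨by simp, ?_, ?_⟩
  · ext k
    simp [flip, Equiv.symm_apply_eq]
  · ext k; simp

lemma sgn_mem {s : Fin 4 → ℤˣ} (hs : ∏ i, s i = 1) : (mk 1 s 0).toEquiv ∈ affineWeyl := by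
  have h : ∀ s : Fin 4 → ℤˣ, ∏ i, s i = 1 →
      s = 1 ∨ (∃ i j, i ≠ j ∧ s = flip i j) ∨ s = fun i => flip 0 1 i * flip 2 3 i := by
    unfold flip; decide
  rcases h s hs with rfl | ⟨i, j, hij, rfl⟩ | rfl
  · exact perm_mem 1
  · exact flip_mem hij
  · have := comp_mem (flip_mem (i := 0) (j := 1) (by decide)) (flip_mem (i := 2) (j := 3) (by decide))
    convert this using 2
    simp [comp, Pi.zero_def]

lemma shift_add_mem {b b' : Fin 4 → ℤ} (h : (mk 1 1 b).toEquiv ∈ affineWeyl)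
    (h' : (mk 1 1 b').toEquiv ∈ affineWeyl) : (mk 1 1 (b + b')).toEquiv ∈ affineWeyl := by
  have := comp_mem h' h
  convert this using 2
  simp only [comp, mk.injEq]
  refine ⟨by simp, by ext; simp, by ext; simp⟩

/-- The translations in the affine Weyl group. -/
def translations : AddSubgroup (Fin 4 → ℤ) where
  carrier := {b | (mk 1 1 b).toEquiv ∈ affineWeyl}
  add_mem' := shift_add_mem
  zero_mem' := perm_mem 1
  neg_mem' {b} h := by
    have := inv_mem h
    change (mk _ _ _).toEquiv ∈ affineWeyl
    convert this using 2
    simp only [inv, mk.injEq]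
    refine ⟨by simp, by ext; simp, by ext; simp⟩

lemma shift_conj {b : Fin 4 → ℤ} (h : b ∈ translations) (π : Perm (Fin 4)) {s : Fin 4 → ℤˣ}
    (hs : ∏ i, s i = 1) : (fun i => (s i : ℤ) * b (π⁻¹ i)) ∈ translations := by
  have h1 := comp_mem (sgn_mem hs) (perm_mem π)
  have := comp_mem (comp_mem h1 h) (inv_mem h1)
  change (mk _ _ _).toEquiv ∈ affineWeyl
  convert this using 2
  simp only [comp, inv, mk.injEq]
  refine ⟨by simp, ?_, ?_⟩
  · ext i
    rcases Int.units_eq_one_or (s i) with h | h <;> simp [h]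
  · ext i; simp

/-- The reflection in `α₀` followed by a linear one in `θ = e₁ + e₂` is a translation by `±θ`;
conjugates of this translation generate the lattice of vectors of even sum. -/
lemma shift_mem {b : Fin 4 → ℤ} (hb : Even (∑ i, b i)) : b ∈ translations := by
  have h0 : ![1, 1, 0, 0] ∈ translations := by
    have h1 := comp_mem (flip_mem (i := 0) (j := 1) (by decide)) (perm_mem (swap 0 1))
    have := comp_mem (simple_mem 0) (inv_mem h1)
    change (mk _ _ _).toEquiv ∈ affineWeyl
    convert this using 2
    simp only [simple, comp, inv, mk.injEq]
    refine ⟨by simp, ?_, ?_⟩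
    · ext k; fin_cases k <;> simp [flip]
    · ext k; fin_cases k <;> simp
  have h1 : ![1, -1, 0, 0] ∈ translations := by
    convert shift_conj h0 1 (s := flip 1 2) (by decide) using 1
    decide
  have h2 : ![1, 0, -1, 0] ∈ translations := by
    convert shift_conj h0 (swap 1 2) (s := flip 2 3) (by decide) using 1
    decide
  have h3 : ![1, 0, 0, -1] ∈ translations := by
    convert shift_conj h0 (swap 1 3) (s := flip 2 3) (by decide) using 1
    decide
  obtain ⟨m, hm⟩ := hb
  rw [Fin.sum_univ_four] at hm
  have key : b = m • ![1, 1, 0, 0] + (m - b 1) • ![1, -1, 0, 0] + (-b 2) • ![1, 0, -1, 0] +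
      (-b 3) • ![1, 0, 0, -1] := by
    ext k
    fin_cases k <;> simp
    lia
  rw [key]
  exact add_mem (add_mem (add_mem (zsmul_mem h0 _) (zsmul_mem h1 _)) (zsmul_mem h2 _))
    (zsmul_mem h3 _)

lemma toEquiv_mem {d : SignedAffine} (hd : d.IsEven) : d.toEquiv ∈ affineWeyl := by
  have := comp_mem (shift_mem hd.2 : (mk 1 1 d.shift).toEquiv ∈ affineWeyl)
    (comp_mem (sgn_mem hd.1) (perm_mem d.perm))
  convert this using 2
  obtain ⟨σ, s, b⟩ := d
  simp only [comp, mk.injEq]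
  refine ⟨by simp, by ext; simp, by ext; simp⟩

lemma sign_toEquiv {d : SignedAffine} (hd : d.IsEven) :
    sign ⟨d.toEquiv, toEquiv_mem hd⟩ = ((Perm.sign d.perm : ℤ) : ℝ) := by
  obtain ⟨d', -, h1, h2⟩ := exists_isEven_of_mem (toEquiv_mem hd)
  rw [h2, toEquiv_injective h1]

/-- The affine Weyl group consists of the signed permutations with translations that satisfy the
parity conditions. -/
def equivAffineWeyl : {d : SignedAffine // d.IsEven} ≃ affineWeyl :=
  Equiv.ofBijective (fun d => ⟨d.1.toEquiv, toEquiv_mem d.2⟩)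
    ⟨fun _ _ h => Subtype.ext (toEquiv_injective (congrArg Subtype.val h)), fun w => by
      obtain ⟨d, hd, h, -⟩ := exists_isEven_of_mem w.2
      exact ⟨⟨d, hd⟩, Subtype.ext h⟩⟩

end SignedAffine

end EllipticD4

namespace EllipticD4

open Complex Filter Topology Equiv

/-! ### The alternating sums as determinants of theta functions -/

/-- Both claims share one induction because multiplying out the next series needs absolute
summability of the product so far. -/
lemma summable_norm_prod_and_prod_tsum {ι : Type*} {n : ℕ} (f : Fin n → ι → ℂ)
    (hf : ∀ j, Summable fun x => ‖f j x‖) :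
    (Summable fun x : Fin n → ι => ‖∏ j, f j (x j)‖) ∧
      ∏ j, ∑' x, f j x = ∑' x : Fin n → ι, ∏ j, f j (x j) := by
  induction n with
  | zero => exact ⟨(hasSum_fintype _).summable, by simp⟩
  | succ n ih =>
    obtain ⟨h1, h2⟩ := ih (fun j => f j.succ) fun j => hf j.succ
    have h0 := hf 0
    generalize hg : (fun x : Fin n → ι => ∏ j, f j.succ (x j)) = g at h2
    have hg' : ∀ x, g x = ∏ j, f j.succ (x j) := fun x => by rw [← hg]
    have h1' : Summable fun x => ‖g x‖ := by simpa only [hg'] using h1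
    have hn : Summable fun x : ι × (Fin n → ι) => ‖f 0 x.1 * g x.2‖ := Summable.mul_norm h0 h1'
    refine ⟨?_, ?_⟩
    · rw [← (Fin.consEquiv fun _ => ι).summable_iff]
      refine hn.congr fun x => ?_
      simp [Fin.consEquiv, Fin.prod_univ_succ, hg']
    · rw [Fin.prod_univ_succ, h2, tsum_mul_tsum_of_summable_norm h0 h1',
        ← (Fin.consEquiv fun _ => ι).tsum_eq]
      refine tsum_congr fun x => ?_
      simp [Fin.consEquiv, Fin.prod_univ_succ, hg']

/-- The theta series of the residue class `a` modulo `k`, twisted by the `v`-th power of the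
character `(-1)^m` of `k m + a`. -/
def twistedResidue (v k : ℕ) (a : ℤ) (z τ : ℂ) : ℂ :=
  ∑' m : ℤ, ((-1 : ℂ) ^ m) ^ v * ee ((k * m + a) * z + (k * m + a) ^ 2 * τ / (2 * k))

lemma norm_neg_one_zpow_pow (m : ℤ) (v : ℕ) : ‖((-1 : ℂ) ^ m) ^ v‖ = 1 := by simp

lemma summable_norm_twistedResidue (v : ℕ) {k : ℕ} (hk : k ≠ 0) (a : ℤ) (z : ℂ) {τ : ℂ}
    (hτ : 0 < τ.im) : Summable fun m : ℤ => ‖((-1 : ℂ) ^ m) ^ v *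
      ee ((k * m + a) * z + (k * m + a) ^ 2 * τ / (2 * k))‖ := by
  simp only [norm_mul, norm_neg_one_zpow_pow, one_mul]
  exact summable_norm_thetaResidue hk a z hτ

/-- The summand of the alternating sum that belongs to one coordinate, a sign and a shift. -/
def coordTerm (u v k : ℕ) (a : ℤ) (z τ : ℂ) (x : ℤˣ × ℤ) : ℂ :=
  ((x.1 : ℤ) : ℂ) ^ u * (((-1 : ℂ) ^ x.2) ^ v *
    ee ((k * x.2 + (x.1 * a : ℤ)) * z + (k * x.2 + (x.1 * a : ℤ)) ^ 2 * τ / (2 * k)))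

lemma norm_units_int_pow (s : ℤˣ) (u : ℕ) : ‖((s : ℤ) : ℂ) ^ u‖ = 1 := by
  rcases Int.units_eq_one_or s with h | h <;> simp [h]

lemma summable_norm_coordTerm (u v : ℕ) {k : ℕ} (hk : k ≠ 0) (a : ℤ) (z : ℂ) {τ : ℂ}
    (hτ : 0 < τ.im) : Summable fun x => ‖coordTerm u v k a z τ x‖ := by
  rw [summable_prod_of_nonneg fun _ => norm_nonneg _]
  refine ⟨fun s => ?_, (hasSum_fintype _).summable⟩
  simp only [coordTerm, norm_mul _ (_ * _), norm_units_int_pow, one_mul]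
  exact summable_norm_twistedResidue v hk _ z hτ

lemma tsum_coordTerm (u v : ℕ) {k : ℕ} (hk : k ≠ 0) (a : ℤ) (z : ℂ) {τ : ℂ} (hτ : 0 < τ.im) :
    ∑' x, coordTerm u v k a z τ x =
      twistedResidue v k a z τ + (-1) ^ u * twistedResidue v k (-a) z τ := by
  rw [(summable_norm_coordTerm u v hk a z hτ).of_norm.tsum_prod, tsum_fintype,
    show (Finset.univ : Finset ℤˣ) = {1, -1} from rfl, Finset.sum_pair (by decide)]
  simp [coordTerm, twistedResidue, tsum_mul_left]

lemma twistedResidue_zero (k : ℕ) (a : ℤ) (z τ : ℂ) :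
    twistedResidue 0 k a z τ = thetaResidue k a z τ := by
  simp [twistedResidue, thetaResidue]

/-- As 7 is odd, `(-1)^m = (-1)^a (-1)^{7m + a}`, so the twist is a shift of `z` by `1/2`. -/
lemma twistedResidue_one_seven (a : ℤ) (z τ : ℂ) :
    twistedResidue 1 7 a z τ = (-1) ^ a * thetaResidue 7 a (z + 1 / 2) τ := by
  rw [twistedResidue, thetaResidue, ← tsum_mul_left]
  refine tsum_congr fun m => ?_
  have h : ((7 : ℕ) * m + a) * (z + 1 / 2) + ((7 : ℕ) * m + a) ^ 2 * τ / (2 * (7 : ℕ)) =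
      ((7 : ℕ) * m + a) * z + ((7 : ℕ) * m + a) ^ 2 * τ / (2 * (7 : ℕ)) + ((m + a : ℤ) : ℂ) / 2 +
        ((3 * m : ℤ) : ℂ) := by
    push_cast; ring
  have ha : (-1 : ℂ) ^ a * (-1) ^ a = 1 := by rw [← mul_zpow]; norm_num
  rw [h, ee_add _ ((3 * m : ℤ) : ℂ), ee_add _ (((m + a : ℤ) : ℂ) / 2), ee_int_div_two, ee_int, pow_one,
    zpow_add₀ (by norm_num)]
  linear_combination (-(-1 : ℂ) ^ m *
    ee (((7 : ℕ) * m + a) * z + ((7 : ℕ) * m + a) ^ 2 * τ / (2 * (7 : ℕ)))) * ha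

/-- The classes of `3` and `-3` modulo 6 coincide, but their parametrizations differ by `m ↦ m + 1`,
which reverses the twist. This eliminates the twisted determinant for `ρ`. -/
lemma twistedResidue_one_six_three (z τ : ℂ) :
    twistedResidue 1 6 (-3) z τ = -twistedResidue 1 6 3 z τ := by
  rw [twistedResidue, twistedResidue, ← tsum_neg, ← (Equiv.addRight (1 : ℤ)).tsum_eq]
  refine tsum_congr fun m => ?_
  simp only [coe_addRight, zpow_add₀ (show (-1 : ℂ) ≠ 0 by norm_num)]
  push_cast
  ring_nf

/-- The integral weight `∑ lᵢ eᵢ + k Λ₀`. -/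
def intWeight (l : Fin 4 → ℤ) (k : ℕ) : HypSpace := (fun i => (l i : ℝ), 0, 0, (k : ℝ))

/-- Completing the square in each coordinate separates a factor that does not depend on `d` from a
product over the coordinates. -/
lemma exp_pairing_toLin (d : SignedAffine) (l : Fin 4 → ℤ) {k : ℕ} (hk : k ≠ 0)
    (τ t : ℂ) (z : Fin 4 → ℂ) :
    exp (pairing (d.toLin (intWeight l k)) (τ, z, t)) =
      ee (k * t - (∑ i, (l i : ℂ) ^ 2) * τ / (2 * k)) *
        ∏ j, coordTerm 0 0 k (l (d.perm⁻¹ j)) (z j) τ (d.sgn j, d.shift j) := by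
  have hk' : (k : ℂ) ≠ 0 := by exact_mod_cast hk
  have hl : ∑ i, (l i : ℂ) ^ 2 = ∑ j, (l (d.perm⁻¹ j) : ℂ) ^ 2 :=
    (Equiv.sum_comp d.perm⁻¹ fun i => (l i : ℂ) ^ 2).symm
  simp only [coordTerm, pow_zero, one_mul]
  have hprod : ∀ f : Fin 4 → ℂ, ∏ j, ee (f j) = ee (∑ j, f j) := fun f => by
    simp only [Fin.prod_univ_four, Fin.sum_univ_four, ee_add]
  rw [hprod, ← ee_add, ee, pairing]
  congr 2
  simp only [SignedAffine.toLin, intWeight, LinearMap.coe_mk, AddHom.coe_mk]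
  rw [hl]
  push_cast
  have hs : ∀ j, ((d.sgn j : ℤ) : ℂ) ^ 2 = 1 := fun j => by
    rcases Int.units_eq_one_or (d.sgn j) with h | h <;> simp [h]
  have h1 : ∀ j, ((k : ℂ) * d.shift j + (d.sgn j : ℤ) * l (d.perm⁻¹ j)) ^ 2 * τ / (2 * k) =
      (d.sgn j : ℤ) * l (d.perm⁻¹ j) * d.shift j * τ + k * (d.shift j) ^ 2 / 2 * τ +
        (l (d.perm⁻¹ j) : ℂ) ^ 2 * τ / (2 * k) := fun j => by
    field_simp
    linear_combination (τ * (l (d.perm⁻¹ j) : ℂ) ^ 2) * hs j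
  simp only [h1, Finset.sum_add_distrib, ← Finset.sum_mul, ← Finset.sum_div, ← Finset.mul_sum]
  have h2 : ∑ j, (((d.sgn j : ℤ) : ℂ) * l (d.perm⁻¹ j) + k * d.shift j) * z j =
      ∑ j, ((k : ℂ) * d.shift j + (d.sgn j : ℤ) * l (d.perm⁻¹ j)) * z j :=
    Finset.sum_congr rfl fun j _ => by ring
  rw [h2]
  ring

/-- Signed permutations with translations as permutations with a sign and a shift for each
coordinate. -/
def signedAffineEquiv : Perm (Fin 4) × (Fin 4 → ℤˣ × ℤ) ≃ SignedAffine where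
  toFun x := ⟨x.1, fun i => (x.2 i).1, fun i => (x.2 i).2⟩
  invFun d := (d.perm, fun i => (d.sgn i, d.shift i))
  left_inv _ := rfl
  right_inv _ := rfl

open Classical in
-- Orthogonality of the characters of `(ℤ/2)²`; each character is a product over coordinates, which
-- the parity conditions themselves are not.
lemma indicator_isEven (d : SignedAffine) :
    (if d.IsEven then 1 else 0 : ℂ) = 4⁻¹ * ∑ u ∈ Finset.range 2, ∑ v ∈ Finset.range 2,
      ∏ j, (((d.sgn j : ℤ) : ℂ) ^ u * ((-1 : ℂ) ^ d.shift j) ^ v) := by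
  have h1 : ∏ j, ((d.sgn j : ℤ) : ℂ) = (((∏ j, d.sgn j : ℤˣ) : ℤ) : ℂ) := by
    push_cast; rfl
  have h2 : ∏ j, (-1 : ℂ) ^ d.shift j = (-1) ^ ∑ j, d.shift j := by
    simp only [Fin.prod_univ_four, Fin.sum_univ_four, zpow_add₀ (show (-1 : ℂ) ≠ 0 by norm_num)]
  simp only [Finset.prod_mul_distrib, Finset.prod_pow, h1, h2, Finset.sum_range_succ,
    Finset.sum_range_zero, pow_zero, pow_one, SignedAffine.IsEven]
  rcases Int.units_eq_one_or (∏ j, d.sgn j) with h | h <;>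
    rcases Int.even_or_odd (∑ j, d.shift j) with h' | h' <;>
    simp [h, h'.neg_one_zpow, h']
  norm_num

lemma altSum_eq_sum_det (l : Fin 4 → ℤ) {k : ℕ} (hk : k ≠ 0) {τ : ℂ} (hτ : 0 < τ.im) (t : ℂ)
    (z : Fin 4 → ℂ) :
    altSum (intWeight l k) (τ, z, t) = ee (k * t - (∑ i, (l i : ℂ) ^ 2) * τ / (2 * k)) *
      (4⁻¹ * ∑ u ∈ Finset.range 2, ∑ v ∈ Finset.range 2,
        Matrix.det (Matrix.of fun a j : Fin 4 => twistedResidue v k (l a) (z j) τ +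
          (-1) ^ u * twistedResidue v k (-l a) (z j) τ)) := by
  classical
  rw [altSum, ← SignedAffine.equivAffineWeyl.tsum_eq]
  set E := ee (k * t - (∑ i, (l i : ℂ) ^ 2) * τ / (2 * k)) with hE
  have hterm : ∀ d : {d : SignedAffine // d.IsEven},
      (sign (SignedAffine.equivAffineWeyl d) : ℂ) *
        exp (pairing ((SignedAffine.equivAffineWeyl d).1 (intWeight l k)) (τ, z, t)) =
      (fun d : SignedAffine => ((Perm.sign d.perm : ℤ) : ℂ) * (E *
        ∏ j, coordTerm 0 0 k (l (d.perm⁻¹ j)) (z j) τ (d.sgn j, d.shift j))) d := by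
    rintro ⟨d, hd⟩
    have h1 : sign (SignedAffine.equivAffineWeyl ⟨d, hd⟩) = ((Perm.sign d.perm : ℤ) : ℝ) :=
      SignedAffine.sign_toEquiv hd
    have h2 : (SignedAffine.equivAffineWeyl ⟨d, hd⟩).1 (intWeight l k) = d.toLin (intWeight l k) :=
      rfl
    rw [h1, h2, exp_pairing_toLin d l hk]
    push_cast
    rfl
  rw [tsum_congr hterm]
  have hsub := tsum_subtype {d : SignedAffine | d.IsEven} (fun d : SignedAffine =>
    ((Perm.sign d.perm : ℤ) : ℂ) * (E *
        ∏ j, coordTerm 0 0 k (l (d.perm⁻¹ j)) (z j) τ (d.sgn j, d.shift j)))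
  refine hsub.trans ?_
  rw [← signedAffineEquiv.tsum_eq]
  have hs := fun (u v : ℕ) (σ : Perm (Fin 4)) => summable_norm_prod_and_prod_tsum
    (fun j => coordTerm u v k (l (σ⁻¹ j)) (z j) τ) fun j => summable_norm_coordTerm u v hk _ _ hτ
  have hterm' : ∀ x : Perm (Fin 4) × (Fin 4 → ℤˣ × ℤ),
      Set.indicator {d : SignedAffine | d.IsEven} (fun d : SignedAffine =>
        ((Perm.sign d.perm : ℤ) : ℂ) * (E *
          ∏ j, coordTerm 0 0 k (l (d.perm⁻¹ j)) (z j) τ (d.sgn j, d.shift j)))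
        (signedAffineEquiv x) = E * (4⁻¹ * ∑ u ∈ Finset.range 2, ∑ v ∈ Finset.range 2,
          ((Perm.sign x.1 : ℤ) : ℂ) *
            ∏ j, coordTerm u v k (l (x.1⁻¹ j)) (z j) τ (x.2 j)) := by
    intro x
    have hind := indicator_isEven (signedAffineEquiv x)
    have h1 : ∀ u v, ∏ j, coordTerm u v k (l (x.1⁻¹ j)) (z j) τ (x.2 j) =
        (∏ j, ((((x.2 j).1 : ℤ) : ℂ) ^ u * ((-1 : ℂ) ^ (x.2 j).2) ^ v)) *
          ∏ j, coordTerm 0 0 k (l (x.1⁻¹ j)) (z j) τ (x.2 j) := fun u v => by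
      rw [← Finset.prod_mul_distrib]
      exact Finset.prod_congr rfl fun j _ => by simp only [coordTerm]; ring
    have h2 : ∑ u ∈ Finset.range 2, ∑ v ∈ Finset.range 2, ((Perm.sign x.1 : ℤ) : ℂ) *
        ∏ j, coordTerm u v k (l (x.1⁻¹ j)) (z j) τ (x.2 j) =
        (∑ u ∈ Finset.range 2, ∑ v ∈ Finset.range 2,
          ∏ j, ((((x.2 j).1 : ℤ) : ℂ) ^ u * ((-1 : ℂ) ^ (x.2 j).2) ^ v)) *
          (((Perm.sign x.1 : ℤ) : ℂ) * ∏ j, coordTerm 0 0 k (l (x.1⁻¹ j)) (z j) τ (x.2 j)) := by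
      simp only [Finset.sum_mul]
      refine Finset.sum_congr rfl fun u _ => Finset.sum_congr rfl fun v _ => ?_
      rw [h1 u v]
      ring
    have h3 : Set.indicator {d : SignedAffine | d.IsEven} (fun d : SignedAffine =>
        ((Perm.sign d.perm : ℤ) : ℂ) * (E *
          ∏ j, coordTerm 0 0 k (l (d.perm⁻¹ j)) (z j) τ (d.sgn j, d.shift j)))
        (signedAffineEquiv x) = (if (signedAffineEquiv x).IsEven then 1 else 0) *
        (((Perm.sign x.1 : ℤ) : ℂ) * (E * ∏ j, coordTerm 0 0 k (l (x.1⁻¹ j)) (z j) τ (x.2 j))) := by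
      rw [Set.indicator_apply, ite_mul, one_mul, zero_mul]
      rfl
    rw [h3, hind, h2]
    simp only [signedAffineEquiv, Equiv.coe_fn_mk]
    ring
  rw [tsum_congr hterm', tsum_mul_left, tsum_mul_left]
  congr 2
  have hsum : ∀ u v : ℕ, Summable fun x : Perm (Fin 4) × (Fin 4 → ℤˣ × ℤ) =>
      ((Perm.sign x.1 : ℤ) : ℂ) * ∏ j, coordTerm u v k (l (x.1⁻¹ j)) (z j) τ (x.2 j) := by
    intro u v
    refine Summable.of_norm ?_
    rw [summable_prod_of_nonneg fun _ => norm_nonneg _]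
    refine ⟨fun σ => ?_, (hasSum_fintype _).summable⟩
    simp only [norm_mul]
    exact (hs u v σ).1.mul_left _
  rw [Summable.tsum_finsetSum fun u _ => summable_sum fun v _ => hsum u v]
  refine Finset.sum_congr rfl fun u _ => ?_
  rw [Summable.tsum_finsetSum fun v _ => hsum u v]
  refine Finset.sum_congr rfl fun v _ => ?_
  -- The coordinate `j` carries the weight entry `l (σ⁻¹ j)`, so the Leibniz formula appears after
  -- inverting the permutation.
  rw [(hsum u v).tsum_prod, tsum_fintype, Matrix.det_apply', 
    ← Equiv.sum_comp (Equiv.inv (Perm (Fin 4)))]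
  refine Finset.sum_congr rfl fun σ _ => ?_
  have hσ := (hs u v σ⁻¹).2
  simp only [inv_inv, tsum_coordTerm u v hk _ _ hτ] at hσ
  simp only [Equiv.inv_apply, inv_inv, Perm.sign_inv, Matrix.of_apply]
  rw [tsum_mul_left, ← hσ]

/-! ### The alternating sums for `ρ`, `ρ + Λ₀` and `ρ + Λ₁` -/

lemma rho_eq_intWeight : rho = intWeight ![3, 2, 1, 0] 6 := by
  ext i
  · fin_cases i <;> simp [rho, fundWeight, intWeight, Fin.sum_univ_five] <;> norm_num
  all_goals simp [rho, fundWeight, intWeight, Fin.sum_univ_five] <;> norm_num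

lemma rho_add_fundWeight_zero : rho + fundWeight 0 = intWeight ![3, 2, 1, 0] 7 := by
  rw [rho_eq_intWeight]
  ext i
  · fin_cases i <;> simp [fundWeight, intWeight]
  all_goals simp [fundWeight, intWeight] <;> norm_num

lemma rho_add_fundWeight_one : rho + fundWeight 1 = intWeight ![4, 2, 1, 0] 7 := by
  rw [rho_eq_intWeight]
  ext i
  · fin_cases i <;> simp [fundWeight, intWeight, Matrix.vecHead, Matrix.vecTail]; norm_num
  all_goals simp [fundWeight, intWeight] <;> norm_num

/-- The determinant with the odd combinations vanishes if some coordinate is zero. -/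
lemma det_odd_eq_zero (v k : ℕ) {l : Fin 4 → ℤ} (hl : l 3 = 0) (z : Fin 4 → ℂ) (τ : ℂ) :
    Matrix.det (Matrix.of fun a j : Fin 4 => twistedResidue v k (l a) (z j) τ +
      (-1) ^ 1 * twistedResidue v k (-l a) (z j) τ) = 0 :=
  Matrix.det_eq_zero_of_row_eq_zero 3 fun j => by simp [hl]

/-- The entries of the weights decrease while the rows of `detTheta` increase; reversing four rows
is an even permutation and costs no sign. -/
lemma det_rev_thetaOrbit (k : ℕ) (z : Fin 4 → ℂ) (τ : ℂ) (c : Fin 4 → ℂ) (M : Fin 4 → Fin 4 → ℂ)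
    (h : ∀ a j, M a j = c a * thetaOrbit k (((Fin.revPerm a : Fin 4) : ℕ) : ℤ) (z j) τ) :
    Matrix.det (Matrix.of M) = (∏ a, c a) * detTheta k z τ := by
  have h1 := Matrix.det_mul_column c (Matrix.of fun a j : Fin 4 =>
    thetaOrbit k (((Fin.revPerm a : Fin 4) : ℕ) : ℤ) (z j) τ)
  have h2 := Matrix.det_permute (Fin.revPerm (n := 4))
    (Matrix.of fun a j : Fin 4 => thetaOrbit k (a : ℕ) (z j) τ)
  have hsign : Perm.sign (Fin.revPerm (n := 4)) = 1 := by decide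
  rw [hsign] at h2
  simp only [Matrix.of_apply] at h1
  have h3 : M = fun a j => c a * thetaOrbit k (((Fin.revPerm a : Fin 4) : ℕ) : ℤ) (z j) τ :=
    funext fun a => funext fun j => h a j
  rw [h3, detTheta]
  refine h1.trans ?_
  congr 1
  refine Eq.trans ?_ (h2.trans (by simp))
  rfl

lemma altSum_rho {τ : ℂ} (hτ : 0 < τ.im) (z : Fin 4 → ℂ) (t : ℂ) :
    altSum rho (τ, z, t) = ee (6 * t - 7 * τ / 6) * detTheta 6 z τ := by
  rw [rho_eq_intWeight, altSum_eq_sum_det _ (by norm_num) hτ]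
  simp only [Finset.sum_range_succ, Finset.sum_range_zero, zero_add]
  rw [det_odd_eq_zero 0 6 (l := ![3, 2, 1, 0]) rfl, det_odd_eq_zero 1 6 (l := ![3, 2, 1, 0]) rfl]
  have h01 : Matrix.det (Matrix.of fun a j : Fin 4 =>
      twistedResidue 1 6 ((![3, 2, 1, 0] : Fin 4 → ℤ) a) (z j) τ + (-1) ^ 0 *
        twistedResidue 1 6 (-(![3, 2, 1, 0] : Fin 4 → ℤ) a) (z j) τ) = 0 := by
    refine Matrix.det_eq_zero_of_row_eq_zero 0 fun j => ?_
    simp [twistedResidue_one_six_three]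
  have h00 := det_rev_thetaOrbit 6 z τ ![2, 1, 1, 2] (fun a j : Fin 4 =>
      twistedResidue 0 6 ((![3, 2, 1, 0] : Fin 4 → ℤ) a) (z j) τ + (-1) ^ 0 *
        twistedResidue 0 6 (-(![3, 2, 1, 0] : Fin 4 → ℤ) a) (z j) τ) (fun a j => by
    simp only [twistedResidue_zero, pow_zero, one_mul]
    rw [thetaResidue_add_neg (by norm_num) _ _ hτ]
    fin_cases a <;> simp [Fin.revPerm, Fin.rev])
  rw [h01, h00]
  have hsum : ∑ i, (((![3, 2, 1, 0] : Fin 4 → ℤ) i : ℤ) : ℂ) ^ 2 = 14 := by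
    simp [Fin.sum_univ_four]; norm_num
  have hprod : ∏ a, (![2, 1, 1, 2] : Fin 4 → ℂ) a = 4 := by
    simp [Fin.prod_univ_four]; norm_num
  rw [hsum, hprod, show ((6 : ℕ) : ℂ) * t - 14 * τ / (2 * (6 : ℕ)) = 6 * t - 7 * τ / 6 by
    push_cast; ring]
  ring

lemma thetaOrbit_seven_four (z τ : ℂ) : thetaOrbit 7 4 z τ = thetaOrbit 7 3 z τ := by
  have : orbitInd 7 4 = orbitInd 7 3 := by
    ext n
    have : ((7 : ℕ) : ℤ) ∣ n - 4 ∨ ((7 : ℕ) : ℤ) ∣ n + 4 ↔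
        ((7 : ℕ) : ℤ) ∣ n - 3 ∨ ((7 : ℕ) : ℤ) ∣ n + 3 := by push_cast; lia
    simp only [orbitInd, this]
  rw [thetaOrbit, thetaOrbit, this]

/-- The alternating sums of level `7`. -/
lemma altSum_level_seven {a₀ : ℤ} (ha : a₀ = 3 ∨ a₀ = 4) {τ : ℂ} (hτ : 0 < τ.im)
    (z : Fin 4 → ℂ) (t : ℂ) :
    altSum (intWeight ![a₀, 2, 1, 0] 7) (τ, z, t) = ee (7 * t - (a₀ ^ 2 + 5) * τ / 14) *
      ((detTheta 7 z τ - (-1) ^ a₀ * detTheta 7 (fun j => z j + 1 / 2) τ) / 2) := by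
  have horb : ∀ w, thetaOrbit 7 a₀ w τ = thetaOrbit 7 3 w τ := fun w => by
    rcases ha with rfl | rfl
    · rfl
    · exact thetaOrbit_seven_four w τ
  have hdvd : ¬ (7 : ℤ) ∣ 2 * a₀ := by rcases ha with rfl | rfl <;> norm_num
  rw [altSum_eq_sum_det _ (by norm_num) hτ]
  simp only [Finset.sum_range_succ, Finset.sum_range_zero, zero_add]
  rw [det_odd_eq_zero 0 7 (l := ![a₀, 2, 1, 0]) rfl, det_odd_eq_zero 1 7 (l := ![a₀, 2, 1, 0]) rfl]
  have h00 := det_rev_thetaOrbit 7 z τ ![1, 1, 1, 2] (fun a j : Fin 4 =>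
      twistedResidue 0 7 ((![a₀, 2, 1, 0] : Fin 4 → ℤ) a) (z j) τ + (-1) ^ 0 *
        twistedResidue 0 7 (-(![a₀, 2, 1, 0] : Fin 4 → ℤ) a) (z j) τ) (fun a j => by
    simp only [twistedResidue_zero, pow_zero, one_mul]
    rw [thetaResidue_add_neg (by norm_num) _ _ hτ]
    fin_cases a <;> simp [Fin.revPerm, Fin.rev, horb, hdvd])
  -- The row factors are the signs `(-1)^a` for `a = a₀, 2, 1, 0`, the last one doubled because the
  -- class `0` is its own negative.
  have h01 := det_rev_thetaOrbit 7 (fun j => z j + 1 / 2) τ ![(-1) ^ a₀, 1, -1, 2]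
    (fun a j : Fin 4 =>
      twistedResidue 1 7 ((![a₀, 2, 1, 0] : Fin 4 → ℤ) a) (z j) τ + (-1) ^ 0 *
        twistedResidue 1 7 (-(![a₀, 2, 1, 0] : Fin 4 → ℤ) a) (z j) τ) (fun a j => by
    have hneg : ∀ b : ℤ, (-1 : ℂ) ^ (-b) = (-1) ^ b := fun b => by
      rw [zpow_neg, ← inv_zpow]; norm_num
    simp only [twistedResidue_one_seven, pow_zero, one_mul, hneg]
    rw [← mul_add, thetaResidue_add_neg (by norm_num) _ _ hτ]
    fin_cases a <;> simp [Fin.revPerm, Fin.rev, horb, hdvd])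
  rw [h01, h00]
  have hsum : ∑ i, (((![a₀, 2, 1, 0] : Fin 4 → ℤ) i : ℤ) : ℂ) ^ 2 = a₀ ^ 2 + 5 := by
    simp [Fin.sum_univ_four]; ring
  have hprod : ∏ a, (![1, 1, 1, 2] : Fin 4 → ℂ) a = 2 := by simp [Fin.prod_univ_four]
  have hprod' : ∏ a, (![(-1) ^ a₀, 1, -1, 2] : Fin 4 → ℂ) a = -2 * (-1) ^ a₀ := by
    simp [Fin.prod_univ_four]; ring
  rw [hsum, hprod, hprod', show ((7 : ℕ) : ℂ) * t - ((a₀ : ℂ) ^ 2 + 5) * τ / (2 * (7 : ℕ)) =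
    7 * t - (a₀ ^ 2 + 5) * τ / 14 by push_cast; ring]
  ring

end EllipticD4

namespace EllipticD4

open Complex Filter Topology

/-! ### The characters of level one -/

lemma thetaOrbit_six_add_half (a : ℤ) (z τ : ℂ) :
    thetaOrbit 6 a (z + 1 / 2) τ = (-1) ^ a * thetaOrbit 6 a z τ := by
  rw [thetaOrbit, thetaOrbit, thetaSeries, thetaSeries, ← tsum_mul_left]
  refine tsum_congr fun n => ?_
  rw [show n * (z + 1 / 2) + n ^ 2 * τ / (2 * (6 : ℕ)) =
    n * z + n ^ 2 * τ / (2 * (6 : ℕ)) + n / 2 by ring, ee_add _ ((n : ℂ) / 2), ee_int_div_two]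
  by_cases h : ((6 : ℕ) : ℤ) ∣ n - a ∨ ((6 : ℕ) : ℤ) ∣ n + a
  · have : (-1 : ℂ) ^ n = (-1) ^ a := by
      have hpar : Even n ↔ Even a := by
        push_cast at h
        rw [Int.even_iff, Int.even_iff]
        lia
      rcases Int.even_or_odd n with hn | hn
      · rw [hn.neg_one_zpow, (hpar.1 hn).neg_one_zpow]
      · have ha : Odd a := by
          rw [← Int.not_even_iff_odd] at hn ⊢
          rwa [← hpar]
        rw [hn.neg_one_zpow, ha.neg_one_zpow]
    rw [this]
    ring
  · have : orbitInd 6 a n = 0 := if_neg h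
    rw [this]
    ring

/-- The row signs multiply to `(-1)^{0+1+2+3} = 1`. Thus both level 7 determinants have the same
denominator. -/
lemma detTheta_six_add_half (z : Fin 4 → ℂ) (τ : ℂ) :
    detTheta 6 (fun j => z j + 1 / 2) τ = detTheta 6 z τ := by
  have h := Matrix.det_mul_column (fun a : Fin 4 => (-1 : ℂ) ^ (((a : ℕ) : ℤ)))
    (Matrix.of fun a j : Fin 4 => thetaOrbit 6 (a : ℕ) (z j) τ)
  simp only [Matrix.of_apply, ← thetaOrbit_six_add_half] at h
  rw [detTheta, h, detTheta]
  simp [Fin.prod_univ_four]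
  norm_num

/-- The quotient of theta functions that gives the characters of level one. -/
def levelOneChar (ε s : ℂ) (p : ℂ × (Fin 4 → ℂ) × ℂ) : ℂ :=
  ee (p.2.2 + (1 / 6 - s) * p.1) * (2⁻¹ * (∏ j, jacobiTheta₂ (p.2.1 j) p.1 +
    ε * ∏ j, jacobiTheta₂ (p.2.1 j + 1 / 2) p.1)) * (ModularForm.eta p.1 ^ 4)⁻¹

lemma differentiableOn_levelOneChar (ε s : ℂ) : DifferentiableOn ℂ (levelOneChar ε s) domainY := by
  intro p hp
  have hp : 0 < p.1.im := hp
  refine DifferentiableAt.differentiableWithinAt ?_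
  have hθ : ∀ (c : ℂ) (j : Fin 4), DifferentiableAt ℂ
      (fun p : ℂ × (Fin 4 → ℂ) × ℂ => jacobiTheta₂ (p.2.1 j + c) p.1) p := by
    intro c j
    have h1 := (hasFDerivAt_jacobiTheta₂ (p.2.1 j + c) hp).differentiableAt
    have h2 : DifferentiableAt ℂ
        (fun p : ℂ × (Fin 4 → ℂ) × ℂ => (p.2.1 j + c, p.1)) p := by fun_prop
    exact DifferentiableAt.comp (f := fun p : ℂ × (Fin 4 → ℂ) × ℂ => (p.2.1 j + c, p.1)) p h1 h2
  have hθ0 := fun j => hθ 0 j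
  simp only [add_zero] at hθ0
  have hη : DifferentiableAt ℂ (fun p : ℂ × (Fin 4 → ℂ) × ℂ => ModularForm.eta p.1) p :=
    DifferentiableAt.comp p (ModularForm.differentiableAt_eta_of_mem_upperHalfPlaneSet hp)
      differentiableAt_fst
  have he : DifferentiableAt ℂ
      (fun p : ℂ × (Fin 4 → ℂ) × ℂ => ee (p.2.2 + (1 / 6 - s) * p.1)) p :=
    DifferentiableAt.comp (g := ee) p (differentiable_ee _) (by fun_prop)
  have hη0 : ModularForm.eta p.1 ^ 4 ≠ 0 := pow_ne_zero 4 (ModularForm.eta_ne_zero hp)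
  unfold levelOneChar
  simp only [Fin.prod_univ_four]
  have i0 := hθ0 0
  have i1 := hθ0 1
  have i2 := hθ0 2
  have i3 := hθ0 3
  have j0 := hθ (1 / 2) 0
  have j1 := hθ (1 / 2) 1
  have j2 := hθ (1 / 2) 2
  have j3 := hθ (1 / 2) 3
  have hsum := (((i0.mul i1).mul i2).mul i3).add ((((j0.mul j1).mul j2).mul j3).const_mul ε)
  exact (he.mul (hsum.const_mul 2⁻¹)).mul ((hη.pow 4).inv hη0)

/-- The multiplication identity is used at `z` and at `z + 1/2`. The exponent `(a₀² + 5)/14 - 1` is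
`0` for `Λ₀` and `1/2` for `Λ₁`. -/
lemma levelOneChar_mul_altSum_rho {a₀ : ℤ} (ha : a₀ = 3 ∨ a₀ = 4) {p : ℂ × (Fin 4 → ℂ) × ℂ}
    (hp : p ∈ domainY) :
    levelOneChar (-(-1) ^ a₀) ((a₀ ^ 2 + 5) / 14 - 1) p * altSum rho p =
      altSum (intWeight ![a₀, 2, 1, 0] 7) p := by
  obtain ⟨τ, z, t⟩ := p
  have hτ : 0 < τ.im := hp
  have h1 := prod_jacobiTheta₂_mul_detTheta_six z hτ
  have h2 := prod_jacobiTheta₂_mul_detTheta_six (fun j => z j + 1 / 2) hτ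
  rw [detTheta_six_add_half] at h2
  have hη0 : ModularForm.eta τ ^ 4 ≠ 0 := pow_ne_zero 4 (ModularForm.eta_ne_zero hτ)
  rw [altSum_rho hτ, altSum_level_seven ha hτ, levelOneChar]
  have e1 : ee (7 * t - (a₀ ^ 2 + 5) * τ / 14) =
      ee (t + (1 / 6 - ((a₀ ^ 2 + 5) / 14 - 1)) * τ) * ee (6 * t - 7 * τ / 6) := by
    rw [← ee_add]; ring_nf
  rw [e1]
  have hinv := mul_inv_cancel₀ hη0
  simp only
  set E₁ := ee (t + (1 / 6 - ((a₀ ^ 2 + 5) / 14 - 1)) * τ)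
  set E₂ := ee (6 * t - 7 * τ / 6)
  linear_combination (E₁ * E₂ / 2 * (ModularForm.eta τ ^ 4)⁻¹) * h1 -
    (E₁ * E₂ / 2 * (ModularForm.eta τ ^ 4)⁻¹ * (-1) ^ a₀) * h2 +
    (E₁ * E₂ / 2 * (detTheta 7 z τ - (-1) ^ a₀ * detTheta 7 (fun j => z j + 1 / 2) τ)) * hinv

lemma isCharacter_levelOneChar_zero : IsCharacter 0 (levelOneChar 1 0) := by
  refine ⟨differentiableOn_levelOneChar _ _, fun p hp => ?_⟩
  have h := levelOneChar_mul_altSum_rho (Or.inl rfl) hp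
  rw [rho_add_fundWeight_zero, ← h]
  norm_num

lemma isCharacter_levelOneChar_one : IsCharacter 1 (levelOneChar (-1) (1 / 2)) := by
  refine ⟨differentiableOn_levelOneChar _ _, fun p hp => ?_⟩
  have h := levelOneChar_mul_altSum_rho (Or.inr rfl) hp
  rw [rho_add_fundWeight_one, ← h]
  norm_num

/-! ### Uniqueness of the characters -/

lemma exists_eq_of_thetaOdd_eq_zero {w τ : ℂ} (hτ : 0 < τ.im) (h : thetaOdd w τ = 0) :
    ∃ m n : ℤ, w = m + n * τ := by
  have hq := norm_ee_lt_one hτ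
  rw [thetaOdd_eq_qPoch w hτ] at h
  have h0 := qPoch_ne_zero_of_norm_lt_one hq hq
  have hcases : qPoch (ee (w + τ)) (ee τ) = 0 ∨ qPoch (ee (-w)) (ee τ) = 0 := by
    simpa [ee_ne_zero, h0] using h
  rcases hcases with h | h
  · have : ∃ n : ℕ, ee (w + τ) * ee τ ^ n = 1 := by
      by_contra! hn
      exact qPoch_ne_zero hq hn h
    obtain ⟨n, hn⟩ := this
    rw [← ee_nat_mul, ← ee_add, ee_eq_one_iff] at hn
    obtain ⟨m, hm⟩ := hn
    exact ⟨m, -(n + 1), by push_cast; linear_combination hm⟩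
  · have : ∃ n : ℕ, ee (-w) * ee τ ^ n = 1 := by
      by_contra! hn
      exact qPoch_ne_zero hq hn h
    obtain ⟨n, hn⟩ := this
    rw [← ee_nat_mul, ← ee_add, ee_eq_one_iff] at hn
    obtain ⟨m, hm⟩ := hn
    exact ⟨-m, n, by push_cast; linear_combination -hm⟩

/-- By the product formula a zero forces some `z_j ± z_i` with `i < j` into the lattice `ℤ + ℤτ`. In
the direction `(1, 2, 3, 4)` all these combinations have nonzero slope, so a lattice point, a pair
and a sign determine `x`. -/
lemma countable_altSum_rho_eq_zero {τ : ℂ} (hτ : 0 < τ.im) (z : Fin 4 → ℂ) (t : ℂ) :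
    Set.Countable {x : ℝ | altSum rho (τ, fun j => z j + x * (((j : ℕ) : ℂ) + 1), t) = 0} := by
  let F : Fin 4 × Fin 4 × ℤˣ × ℤ × ℤ → ℝ := fun y =>
    ((y.2.2.2.1 + y.2.2.2.2 * τ - (z y.2.1 + (y.2.2.1 : ℤ) * z y.1)) /
      ((((y.2.1 : ℕ) : ℂ) + 1) + (y.2.2.1 : ℤ) * (((y.1 : ℕ) : ℂ) + 1))).re
  refine (Set.countable_range F).mono fun x hx => ?_
  have hx : altSum rho (τ, fun j => z j + x * (((j : ℕ) : ℂ) + 1), t) = 0 := hx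
  rw [altSum_rho hτ] at hx
  have hd := (mul_eq_zero.1 hx).resolve_left (ee_ne_zero _)
  have hprod := prod_thetaPair_eq_eta (fun j : Fin 4 => z j + x * (((j : ℕ) : ℂ) + 1)) hτ
  rw [hd, mul_zero, Finset.prod_eq_zero_iff] at hprod
  obtain ⟨i, -, hi⟩ := hprod
  obtain ⟨j, hij, hj⟩ := Finset.prod_eq_zero_iff.1 hi
  have hij : i < j := Finset.mem_Ioi.1 hij
  have hlt : (i : ℕ) < (j : ℕ) := hij
  rw [thetaPair_eq _ _ hτ, mul_eq_zero] at hj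
  have key : ∀ s : ℤˣ, (∃ m n : ℤ, z j + x * (((j : ℕ) : ℂ) + 1) +
      (s : ℤ) * (z i + x * (((i : ℕ) : ℂ) + 1)) = m + n * τ) → x ∈ Set.range F := by
    rintro s ⟨m, n, h⟩
    refine ⟨(i, j, s, m, n), ?_⟩
    have hne : (((j : ℕ) : ℂ) + 1) + (s : ℤ) * (((i : ℕ) : ℂ) + 1) ≠ 0 := by
      have : ((j : ℕ) : ℤ) + 1 + (s : ℤ) * (((i : ℕ) : ℤ) + 1) ≠ 0 := by
        rcases Int.units_eq_one_or s with rfl | rfl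
        · simp only [Units.val_one]; lia
        · simp only [Units.val_neg, Units.val_one]; lia
      exact_mod_cast this
    have : (x : ℂ) = (m + n * τ - (z j + (s : ℤ) * z i)) /
        ((((j : ℕ) : ℂ) + 1) + (s : ℤ) * (((i : ℕ) : ℂ) + 1)) := by
      rw [eq_div_iff hne, ← h]; ring
    simp only [F]
    rw [← this, ofReal_re]
  rcases hj with h | h
  · obtain ⟨m, n, h⟩ := exists_eq_of_thetaOdd_eq_zero hτ h
    exact key 1 ⟨m, n, by rw [← h]; push_cast; ring⟩
  · obtain ⟨m, n, h⟩ := exists_eq_of_thetaOdd_eq_zero hτ h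
    exact key (-1) ⟨m, n, by rw [← h]; push_cast; ring⟩

/-- Through every point of `Y` runs a real line on which the denominator is nonzero off a countable
set. The quotients agree on the dense complement, hence everywhere by continuity. -/
lemma IsCharacter.eqOn {i : Fin 5} {f g : ℂ × (Fin 4 → ℂ) × ℂ → ℂ} (hf : IsCharacter i f)
    (hg : IsCharacter i g) : Set.EqOn f g domainY := by
  rintro ⟨τ, z, t⟩ hp
  have hτ : 0 < τ.im := hp
  let γ : ℝ → ℂ × (Fin 4 → ℂ) × ℂ := fun x => (τ, fun j => z j + x * (((j : ℕ) : ℂ) + 1), t)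
  have hγ : Continuous γ := by fun_prop
  have hγY : ∀ x, γ x ∈ domainY := fun _ => hτ
  have hfc : Continuous (f ∘ γ) := hf.1.continuousOn.comp_continuous hγ hγY
  have hgc : Continuous (g ∘ γ) := hg.1.continuousOn.comp_continuous hγ hγY
  have hdense := (countable_altSum_rho_eq_zero hτ z t).dense_compl ℝ
  have heq := Continuous.ext_on hdense hfc hgc fun x hx =>
    mul_right_cancel₀ hx ((hf.2 _ (hγY x)).trans (hg.2 _ (hγY x)).symm)
  have h0 := congrFun heq 0
  simpa [γ] using h0

lemma isCharacter_ch {i : Fin 5} {f : ℂ × (Fin 4 → ℂ) × ℂ → ℂ} (hf : IsCharacter i f) :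
    IsCharacter i (ch i) := by
  have h : ∃ f, IsCharacter i f := ⟨f, hf⟩
  rw [ch, dif_pos h]
  exact h.choose_spec

end EllipticD4

namespace EllipticD4

open Complex Filter Topology

/-! ### Theta constants -/

/-- The theta constant `∑ q^{(n+a)²/2}`. -/
def thetaNull (a τ : ℂ) : ℂ := ∑' n : ℤ, ee ((n + a) ^ 2 * τ / 2)

lemma thetaNull_term (a τ : ℂ) (n : ℤ) :
    ee ((n + a) ^ 2 * τ / 2) = ee (a ^ 2 * τ / 2) * jacobiTheta₂_term n (a * τ) τ := by
  rw [jacobiTheta₂_term_eq_ee, ← ee_add]; ring_nf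

lemma thetaNull_eq_jacobiTheta₂ (a τ : ℂ) :
    thetaNull a τ = ee (a ^ 2 * τ / 2) * jacobiTheta₂ (a * τ) τ := by
  simp only [thetaNull, thetaNull_term, tsum_mul_left, jacobiTheta₂]

lemma summable_thetaNull (a : ℂ) {τ : ℂ} (hτ : 0 < τ.im) :
    Summable fun n : ℤ => ee ((n + a) ^ 2 * τ / 2) := by
  simp only [thetaNull_term]
  exact ((summable_jacobiTheta₂_term_iff _ _).2 hτ).mul_left _

lemma hasDerivAt_ee (w : ℂ) : HasDerivAt ee (2 * Real.pi * I * ee w) w := by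
  have := ((hasDerivAt_id w).const_mul (2 * Real.pi * I)).cexp
  change HasDerivAt (fun w => exp (2 * Real.pi * I * w)) (2 * Real.pi * I * exp (2 * Real.pi * I * w)) w
  simpa [mul_comm] using this

/-- Termwise differentiation comes from the two-variable derivative of `jacobiTheta₂` along the
curve `τ ↦ (aτ, τ)`. -/
lemma hasSum_thetaNull_deriv (a : ℂ) {τ : ℂ} (hτ : 0 < τ.im) :
    HasSum (fun n : ℤ => (n + a) ^ 2 * ee ((n + a) ^ 2 * τ / 2))
      (2 * (2 * Real.pi * I)⁻¹ * deriv (thetaNull a) τ) := by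
  have h1 := ((hasSum_jacobiTheta₂_term_fderiv (a * τ) hτ).mapL
    (ContinuousLinearMap.apply ℂ ℂ ((a, 1) : ℂ × ℂ)))
  have h0 := hasSum_jacobiTheta₂_term (a * τ) hτ
  have hpath : HasDerivAt (fun τ : ℂ => (a * τ, τ)) ((a, 1) : ℂ × ℂ) τ := by
    simpa using ((hasDerivAt_id τ).const_mul a).prodMk (hasDerivAt_id τ)
  have hd := HasFDerivAt.comp_hasDerivAt (f := fun τ : ℂ => (a * τ, τ)) τ
    (hasFDerivAt_jacobiTheta₂ (a * τ) hτ) hpath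
  have he : HasDerivAt (fun τ : ℂ => ee (a ^ 2 * τ / 2))
      (2 * Real.pi * I * ee (a ^ 2 * τ / 2) * (a ^ 2 / 2)) τ := by
    have hlin : HasDerivAt (fun τ : ℂ => a ^ 2 * τ / 2) (a ^ 2 / 2) τ := by
      simpa using ((hasDerivAt_id τ).const_mul (a ^ 2)).div_const 2
    exact (hasDerivAt_ee _).comp τ hlin
  have hderiv : deriv (thetaNull a) τ =
      2 * Real.pi * I * ee (a ^ 2 * τ / 2) * (a ^ 2 / 2) * jacobiTheta₂ (a * τ) τ +
        ee (a ^ 2 * τ / 2) * jacobiTheta₂_fderiv (a * τ) τ (a, 1) := by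
    have := (he.mul hd).deriv
    refine Eq.trans ?_ this
    congr 1
    ext τ
    exact thetaNull_eq_jacobiTheta₂ a τ
  rw [hderiv]
  have hpi := two_pi_I_ne_zero
  have hs := (((h0.mul_left (2 * Real.pi * I * ee (a ^ 2 * τ / 2) * (a ^ 2 / 2))).add
    (h1.mul_left (ee (a ^ 2 * τ / 2))))).mul_left (2 * (2 * Real.pi * I)⁻¹)
  refine hs.congr_fun fun n => ?_
  rw [thetaNull_term]
  simp only [jacobiTheta₂_term_fderiv, ContinuousLinearMap.apply_apply, _root_.smul_apply,
    _root_.add_apply, ContinuousLinearMap.coe_fst', ContinuousLinearMap.coe_snd',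
    smul_eq_mul, mul_one]
  have hpi' : (Real.pi : ℂ) ≠ 0 := by exact_mod_cast Real.pi_ne_zero
  field_simp
  simp only [jacobiTheta₂_term]
  ring_nf

lemma differentiableAt_thetaNull (a : ℂ) {τ : ℂ} (hτ : 0 < τ.im) :
    DifferentiableAt ℂ (thetaNull a) τ := by
  have hpath : DifferentiableAt ℂ (fun τ : ℂ => (a * τ, τ)) τ := by fun_prop
  have h := DifferentiableAt.comp (f := fun τ : ℂ => (a * τ, τ)) τ
    (hasFDerivAt_jacobiTheta₂ (a * τ) hτ).differentiableAt hpath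
  have he : DifferentiableAt ℂ (fun τ : ℂ => ee (a ^ 2 * τ / 2)) τ :=
    DifferentiableAt.comp (g := ee) τ (differentiable_ee _) (by fun_prop)
  refine (he.mul h).congr_of_eventuallyEq (Eventually.of_forall fun τ => ?_)
  exact thetaNull_eq_jacobiTheta₂ a τ

/-! ### The derivative of the odd theta function -/

lemma hasSum_thetaOdd_deriv {τ : ℂ} (hτ : 0 < τ.im) :
    HasSum (fun n : ℤ => (-1 : ℂ) ^ n * ((n + 1 / 2) * ee ((n + 1 / 2) ^ 2 * τ / 2)))
      ((2 * Real.pi * I)⁻¹ * deriv (fun z => thetaOdd z τ) 0) := by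
  have h1 := hasSum_jacobiTheta₂'_term (τ / 2 + 1 / 2) hτ
  have h0 := hasSum_jacobiTheta₂_term (τ / 2 + 1 / 2) hτ
  have he : HasDerivAt (fun z : ℂ => ee (z / 2 + τ / 8))
      (2 * Real.pi * I * ee (τ / 8) * (1 / 2)) 0 := by
    have hlin : HasDerivAt (fun z : ℂ => z / 2 + τ / 8) (1 / 2) 0 := by
      simpa using ((hasDerivAt_id (0 : ℂ)).div_const 2).add_const (τ / 8)
    have := (hasDerivAt_ee ((0 : ℂ) / 2 + τ / 8)).comp (0 : ℂ) hlin
    rw [zero_div, zero_add] at this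
    exact this
  have hj : HasDerivAt (fun z : ℂ => jacobiTheta₂ (z + τ / 2 + 1 / 2) τ)
      (jacobiTheta₂' (τ / 2 + 1 / 2) τ) 0 := by
    have hlin : HasDerivAt (fun z : ℂ => z + τ / 2 + 1 / 2) 1 0 := by
      simpa using ((hasDerivAt_id (0 : ℂ)).add_const (τ / 2)).add_const (1 / 2)
    have := (hasDerivAt_jacobiTheta₂_fst ((0 : ℂ) + τ / 2 + 1 / 2) hτ).comp (0 : ℂ) hlin
    rw [zero_add, mul_one] at this
    exact this
  have hderiv : deriv (fun z => thetaOdd z τ) 0 =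
      2 * Real.pi * I * ee (τ / 8) * (1 / 2) * jacobiTheta₂ (τ / 2 + 1 / 2) τ +
        ee (τ / 8) * jacobiTheta₂' (τ / 2 + 1 / 2) τ := by
    have := (he.mul hj).deriv
    simp only [thetaOdd_eq_jacobiTheta₂]
    refine Eq.trans ?_ (this.trans ?_)
    · rfl
    · simp
  rw [hderiv]
  have hs := ((h0.mul_left (2 * Real.pi * I * ee (τ / 8) * (1 / 2))).add
    (h1.mul_left (ee (τ / 8)))).mul_left (2 * Real.pi * I)⁻¹
  refine hs.congr_fun fun n => ?_
  have ht := thetaOdd_term n 0 τ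
  simp only [mul_zero, zero_add, zero_div] at ht
  rw [mul_left_comm, ht, jacobiTheta₂'_term]
  have hpi' : (Real.pi : ℂ) ≠ 0 := by exact_mod_cast Real.pi_ne_zero
  field_simp
  ring

/-- The product formula splits off the simple zero `1 - ee (-z)`. The continuous cofactor has the
value `η³` at `0`. -/
lemma deriv_thetaOdd {τ : ℂ} (hτ : 0 < τ.im) :
    deriv (fun z => thetaOdd z τ) 0 = 2 * Real.pi * I * ModularForm.eta τ ^ 3 := by
  have hq := norm_ee_lt_one hτ
  let H : ℂ → ℂ := fun z => ee (z / 2 + τ / 8) * (qPoch (ee τ) (ee τ) *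
    qPoch (ee (z + τ)) (ee τ) * qPoch (ee (-z + τ)) (ee τ))
  have hH : Continuous H := by
    have hc := continuous_qPoch hq
    have he := continuous_ee
    have h1 : Continuous fun z : ℂ => ee (z / 2 + τ / 8) := he.comp (by fun_prop)
    have h2 : Continuous fun z : ℂ => qPoch (ee (z + τ)) (ee τ) :=
      hc.comp (he.comp (by fun_prop))
    have h3 : Continuous fun z : ℂ => qPoch (ee (-z + τ)) (ee τ) :=
      hc.comp (he.comp (by fun_prop))
    exact h1.mul ((continuous_const.mul h2).mul h3)
  have hfac : ∀ z, thetaOdd z τ = (1 - ee (-z)) * H z := fun z => by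
    rw [thetaOdd_eq_qPoch z hτ, qPoch_eq_one_sub_mul hq (ee (-z)), ← ee_add]
    simp only [H]
    ring
  have hd1 : HasDerivAt (fun z : ℂ => 1 - ee (-z)) (2 * Real.pi * I) 0 := by
    have h := (hasDerivAt_ee (-0)).comp (0 : ℂ) (hasDerivAt_neg 0)
    simpa using h.const_sub 1
  have hd : HasDerivAt (fun z => thetaOdd z τ) (2 * Real.pi * I * H 0) 0 := by
    rw [hasDerivAt_iff_tendsto_slope] at hd1 ⊢
    refine (hd1.mul (hH.continuousAt.tendsto.mono_left nhdsWithin_le_nhds)).congr fun z => ?_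
    simp only [slope_def_field, hfac]
    simp
    ring
  have e1 : ee (τ / 8) = ee (τ / 24) ^ 3 := by rw [← ee_nat_mul]; push_cast; ring_nf
  rw [hd.deriv, eta_eq_qPoch]
  simp only [H]
  norm_num
  rw [e1]
  ring

end EllipticD4

namespace EllipticD4

open Complex Filter Topology

/-! ### Product formulas for the theta constants -/

/-- Multiplied by `(Q²; Q²)_∞`, the left side becomes `(Q²; Q⁴)_∞ (Q⁴; Q⁴)_∞`, which is `(Q²; Q²)_∞`
again. -/
lemma qPoch_triple_product {Q : ℂ} (hQ : ‖Q‖ < 1) :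
    qPoch Q (Q ^ 2) * qPoch (-Q) (Q ^ 2) * qPoch (-Q ^ 2) (Q ^ 2) = 1 := by
  have hq : ‖Q ^ 2‖ < 1 := by rw [norm_pow]; exact pow_lt_one₀ (norm_nonneg _) hQ two_ne_zero
  have h1 := qPoch_mul_qPoch_neg hq Q
  have h2 := qPoch_mul_qPoch_neg hq (Q ^ 2)
  have h3 := prod_qPoch_pow hq (Q ^ 2) two_ne_zero
  have h0 := qPoch_ne_zero_of_norm_lt_one hq hq
  rw [Finset.prod_range_succ, Finset.prod_range_one, pow_zero, mul_one, pow_one, ← sq] at h3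
  apply mul_right_cancel₀ h0
  linear_combination qPoch (-Q ^ 2) (Q ^ 2) * qPoch (Q ^ 2) (Q ^ 2) * h1 +
    qPoch (Q ^ 2) ((Q ^ 2) ^ 2) * h2 + h3

lemma ee_half_sq (τ : ℂ) : ee (τ / 2) ^ 2 = ee τ := by
  rw [← ee_nat_mul]; congr 1; push_cast; ring

lemma im_div_two_pos {τ : ℂ} (hτ : 0 < τ.im) : 0 < (τ / 2).im := by
  rw [show (τ / 2).im = τ.im / 2 by simp]; linarith

lemma im_add_one_pos {τ : ℂ} (hτ : 0 < τ.im) : 0 < (τ + 1).im := by simpa using hτ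

lemma qPoch_theta_product {τ : ℂ} (hτ : 0 < τ.im) :
    qPoch (ee (τ / 2)) (ee τ) * qPoch (-ee (τ / 2)) (ee τ) * qPoch (-ee τ) (ee τ) = 1 := by
  simpa only [ee_half_sq] using qPoch_triple_product (norm_ee_lt_one (im_div_two_pos hτ))

lemma ee_add_one (w : ℂ) : ee (w + 1) = ee w := by
  have := ee_int 1
  rw [ee_add, ← Int.cast_one, this, mul_one]

lemma thetaNull_zero_eq_qPoch {τ : ℂ} (hτ : 0 < τ.im) :
    thetaNull 0 τ = qPoch (ee τ) (ee τ) * qPoch (-ee (τ / 2)) (ee τ) ^ 2 := by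
  rw [thetaNull_eq_jacobiTheta₂, jacobiTheta₂_eq_qPoch hτ]
  simp
  ring

lemma thetaNull_zero_add_one_eq_qPoch {τ : ℂ} (hτ : 0 < τ.im) :
    thetaNull 0 (τ + 1) = qPoch (ee τ) (ee τ) * qPoch (ee (τ / 2)) (ee τ) ^ 2 := by
  rw [thetaNull_zero_eq_qPoch (im_add_one_pos hτ), ee_add_one, add_div, ee_add, ee_half]
  simp

lemma thetaNull_half_eq_qPoch {τ : ℂ} (hτ : 0 < τ.im) :
    thetaNull (1 / 2) τ =
      2 * ee (τ / 8) * (qPoch (ee τ) (ee τ) * qPoch (-ee τ) (ee τ) ^ 2) := by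
  have h := qPoch_eq_one_sub_mul (norm_ee_lt_one hτ) (-1)
  rw [thetaNull_eq_jacobiTheta₂, jacobiTheta₂_eq_qPoch hτ,
    show (1 / 2 : ℂ) * τ + τ / 2 = τ by ring, show -((1 / 2 : ℂ) * τ) + τ / 2 = 0 by ring,
    show (1 / 2 : ℂ) ^ 2 * τ / 2 = τ / 8 by ring, ee_zero, h, neg_one_mul]
  ring

lemma thetaNull_half_ne_zero {τ : ℂ} (hτ : 0 < τ.im) : thetaNull (1 / 2) τ ≠ 0 := by
  have hq := norm_ee_lt_one hτ
  have h := qPoch_ne_zero_of_norm_lt_one hq hq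
  have h' := right_ne_zero_of_mul_eq_one (qPoch_theta_product hτ)
  rw [thetaNull_half_eq_qPoch hτ]
  exact mul_ne_zero (mul_ne_zero two_ne_zero (ee_ne_zero _)) (mul_ne_zero h (pow_ne_zero 2 h'))

lemma thetaNull_zero_ne_zero {τ : ℂ} (hτ : 0 < τ.im) : thetaNull 0 τ ≠ 0 := by
  have hq := norm_ee_lt_one hτ
  have h := qPoch_ne_zero_of_norm_lt_one hq hq
  have h' := right_ne_zero_of_mul (left_ne_zero_of_mul_eq_one (qPoch_theta_product hτ))
  rw [thetaNull_zero_eq_qPoch hτ]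
  positivity

lemma thetaNull_mul_eq_eta {τ : ℂ} (hτ : 0 < τ.im) :
    thetaNull (1 / 2) τ * thetaNull 0 τ * thetaNull 0 (τ + 1) = 2 * ModularForm.eta τ ^ 3 := by
  have e1 : ee (τ / 8) = ee (τ / 24) ^ 3 := by rw [← ee_nat_mul]; push_cast; ring_nf
  have h := qPoch_theta_product hτ
  rw [thetaNull_half_eq_qPoch hτ, thetaNull_zero_eq_qPoch hτ, thetaNull_zero_add_one_eq_qPoch hτ,
    eta_eq_qPoch, e1]
  generalize qPoch (ee (τ / 2)) (ee τ) = u at *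
  generalize qPoch (-ee (τ / 2)) (ee τ) = v at *
  generalize qPoch (-ee τ) (ee τ) = w at *
  linear_combination 2 * (ee (τ / 24) * qPoch (ee τ) (ee τ)) ^ 3 * (u * v * w + 1) * h

/-- In the notation `u, v, w` below, the product is `u⁸v²w²` up to elementary factors, and `uvw = 1`
leaves `u⁶`; moreover `(q^{1/2}; q^{1/2})_∞ = u (q; q)_∞`. -/
lemma thetaNull_mul_eq_eta_half {τ : ℂ} (hτ : 0 < τ.im) :
    thetaNull (1 / 2) τ * thetaNull 0 τ * thetaNull 0 (τ + 1) ^ 4 =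
      2 * ModularForm.eta (τ / 2) ^ 6 := by
  have e1 : ee (τ / 8) = ee (τ / 2 / 24) ^ 6 := by rw [← ee_nat_mul]; push_cast; ring_nf
  have h := qPoch_theta_product hτ
  have h2 := prod_qPoch_pow (norm_ee_lt_one (im_div_two_pos hτ)) (ee (τ / 2)) two_ne_zero
  rw [Finset.prod_range_succ, Finset.prod_range_one, pow_zero, mul_one, pow_one, ← sq,
    ee_half_sq] at h2
  rw [thetaNull_half_eq_qPoch hτ, thetaNull_zero_eq_qPoch hτ, thetaNull_zero_add_one_eq_qPoch hτ,
    eta_eq_qPoch, e1, ← h2]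
  generalize qPoch (ee (τ / 2)) (ee τ) = u at *
  generalize qPoch (-ee (τ / 2)) (ee τ) = v at *
  generalize qPoch (-ee τ) (ee τ) = w at *
  linear_combination
    2 * (ee (τ / 2 / 24) * qPoch (ee τ) (ee τ) * u) ^ 6 * (u * v * w + 1) * h

/-! ### Differences of logarithmic derivatives of theta constants -/

lemma hasSum_eta_cube {τ : ℂ} (hτ : 0 < τ.im) :
    HasSum (fun n : ℤ => (-1 : ℂ) ^ n * ((n + 1 / 2) * ee ((n + 1 / 2) ^ 2 * τ / 2)))
      (ModularForm.eta τ ^ 3) := by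
  have h := hasSum_thetaOdd_deriv hτ
  rwa [deriv_thetaOdd hτ, inv_mul_cancel_left₀ two_pi_I_ne_zero] at h

/-- The terms `n` and `-1 - n` cancel. -/
lemma hasSum_odd_half_integer {τ : ℂ} (hτ : 0 < τ.im) :
    HasSum (fun n : ℤ => (n + 1 / 2) * ee ((n + 1 / 2) ^ 2 * τ / 2)) 0 := by
  have hs : Summable fun n : ℤ => ((n : ℂ) + 1 / 2) * ee ((n + 1 / 2) ^ 2 * τ / 2) := by
    have := (hasSum_eta_cube hτ).summable.norm
    refine Summable.of_norm (this.congr fun n => ?_)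
    rw [norm_mul, norm_zpow, norm_neg, norm_one, one_zpow, one_mul]
  have h := hs.hasSum
  have h' := (Equiv.subLeft (-1 : ℤ)).hasSum_iff.2 h
  have hneg := h.neg
  have : ∑' n : ℤ, ((n : ℂ) + 1 / 2) * ee ((n + 1 / 2) ^ 2 * τ / 2) =
      -∑' n : ℤ, ((n : ℂ) + 1 / 2) * ee ((n + 1 / 2) ^ 2 * τ / 2) := by
    refine h'.unique (hneg.congr_fun fun n => ?_)
    simp only [Function.comp_apply, Equiv.subLeft_apply]
    push_cast
    ring_nf
  rwa [self_eq_neg.1 this] at h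

/-- The double series of the Wronskian carries the factor `(k + 1/2)² - n² = (k + n + 1/2)(k - n +
1/2)`. With `i = k + n` and `j = k - n` it becomes the part with `i + j` even of the square of
Jacobi's series for `η(τ/2)³`. -/
lemma thetaNull_wronskian {τ : ℂ} (hτ : 0 < τ.im) :
    thetaNull 0 τ * ((2 * Real.pi * I)⁻¹ * deriv (thetaNull (1 / 2)) τ) -
      thetaNull (1 / 2) τ * ((2 * Real.pi * I)⁻¹ * deriv (thetaNull 0) τ) =
    ModularForm.eta (τ / 2) ^ 6 / 4 := by
  have hτ2 := im_div_two_pos hτ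
  have mulHasSum : ∀ {f g : ℤ → ℂ} {a b : ℂ}, HasSum f a → HasSum g b →
      HasSum (fun p : ℤ × ℤ => f p.1 * g p.2) (a * b) := fun hf hg =>
    hf.mul hg (summable_mul_of_summable_norm hf.summable.norm hg.summable.norm)
  have hY := mulHasSum (hasSum_eta_cube hτ2) (hasSum_eta_cube hτ2)
  have hZ := mulHasSum (hasSum_odd_half_integer hτ2) (hasSum_odd_half_integer hτ2)
  -- Adding the square of the untwisted series, which is zero, cancels the terms with `i + j` odd
  -- and doubles the others.
  have hG := hY.add hZ
  let g : ℤ × ℤ → ℤ × ℤ := fun p => (p.1 + p.2, p.1 - p.2)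
  have hg : Function.Injective g := fun p p' h => by
    simp only [g, Prod.mk.injEq] at h
    ext <;> lia
  rw [← hg.hasSum_iff] at hG
  swap
  · rintro ⟨i, j⟩ hij
    have hodd : Odd (i + j) := by
      by_contra h
      rw [Int.not_odd_iff_even] at h
      obtain ⟨k, hk⟩ := h
      exact hij ⟨(k, i - k), by simp only [g, Prod.mk.injEq]; lia⟩
    have : (-1 : ℂ) ^ i * (-1 : ℂ) ^ j = -1 := by
      rw [← zpow_add₀ (by norm_num), hodd.neg_one_zpow]
    linear_combination ((i : ℂ) + 1 / 2) * ee ((i + 1 / 2) ^ 2 * (τ / 2) / 2) *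
      (((j : ℂ) + 1 / 2) * ee ((j + 1 / 2) ^ 2 * (τ / 2) / 2)) * this
  have h2 := hasSum_thetaNull_deriv (1 / 2) hτ
  have h3 := hasSum_thetaNull_deriv 0 hτ
  have hW := (mulHasSum h2 (summable_thetaNull 0 hτ).hasSum).sub
    (mulHasSum (summable_thetaNull (1 / 2) hτ).hasSum h3)
  have key := (hW.mul_left 2).unique (hG.congr_fun fun p => ?_)
  · change 2 * (_ * thetaNull 0 τ - thetaNull (1 / 2) τ * _) = _ at key
    linear_combination key / 4
  · obtain ⟨k, n⟩ := p
    simp only [Function.comp_apply, g]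
    have hsgn : (-1 : ℂ) ^ (k + n) * (-1 : ℂ) ^ (k - n) = 1 := by
      rw [← zpow_add₀ (by norm_num), Even.neg_one_zpow ⟨k, by ring⟩]
    have e1 : ee (((k : ℂ) + 1 / 2) ^ 2 * τ / 2) * ee (((n : ℂ) + 0) ^ 2 * τ / 2) =
        ee ((((k + n : ℤ) : ℂ) + 1 / 2) ^ 2 * (τ / 2) / 2) *
          ee ((((k - n : ℤ) : ℂ) + 1 / 2) ^ 2 * (τ / 2) / 2) := by
      rw [← ee_add, ← ee_add]; push_cast; ring_nf
    generalize ee ((((k + n : ℤ) : ℂ) + 1 / 2) ^ 2 * (τ / 2) / 2) = A at *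
    generalize ee ((((k - n : ℤ) : ℂ) + 1 / 2) ^ 2 * (τ / 2) / 2) = B at *
    push_cast
    linear_combination 2 * (((k : ℂ) + 1 / 2) ^ 2 - n ^ 2) * e1 -
      A * B * (k + n + 1 / 2) * (k - n + 1 / 2) * hsgn

lemma logDeriv_thetaNull_half_sub_zero {τ : ℂ} (hτ : 0 < τ.im) :
    (2 * Real.pi * I)⁻¹ * logDeriv (thetaNull (1 / 2)) τ -
      (2 * Real.pi * I)⁻¹ * logDeriv (thetaNull 0) τ = thetaNull 0 (τ + 1) ^ 4 / 8 := by
  have h2 := thetaNull_half_ne_zero hτ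
  have h3 := thetaNull_zero_ne_zero hτ
  have h := thetaNull_wronskian hτ
  have hm := thetaNull_mul_eq_eta_half hτ
  rw [logDeriv_apply, logDeriv_apply, ← mul_div_assoc, ← mul_div_assoc, div_sub_div _ _ h2 h3,
    div_eq_iff (mul_ne_zero h2 h3)]
  linear_combination h - hm / 8

lemma thetaNull_half_add_one (τ : ℂ) :
    thetaNull (1 / 2) (τ + 1) = ee (1 / 8) * thetaNull (1 / 2) τ := by
  rw [thetaNull, thetaNull, ← tsum_mul_left]
  refine tsum_congr fun n => ?_
  obtain ⟨k, hk⟩ := Int.even_mul_succ_self n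
  have hk' : (n : ℂ) * (n + 1) = k + k := by exact_mod_cast hk
  rw [show ((n : ℂ) + 1 / 2) ^ 2 * (τ + 1) / 2 = 1 / 8 + (n + 1 / 2) ^ 2 * τ / 2 + k by
    linear_combination hk' / 2, ee_add, ee_int, mul_one, ee_add]

lemma thetaNull_zero_add_one (τ : ℂ) :
    thetaNull 0 (τ + 1) = ∑' n : ℤ, (-1 : ℂ) ^ n * ee (n ^ 2 * τ / 2) := by
  refine tsum_congr fun n => ?_
  obtain ⟨k, hk⟩ := Int.even_mul_pred_self n
  have hk' : (n : ℂ) * (n - 1) = k + k := by exact_mod_cast hk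
  rw [show ((n : ℂ) + 0) ^ 2 * (τ + 1) / 2 = n / 2 + n ^ 2 * τ / 2 + k by
    linear_combination hk' / 2, ee_add, ee_int, mul_one, ee_add, ee_int_div_two]

lemma thetaNull_zero_add_two (τ : ℂ) : thetaNull 0 (τ + 1 + 1) = thetaNull 0 τ := by
  refine tsum_congr fun n => ?_
  rw [show ((n : ℂ) + 0) ^ 2 * (τ + 1 + 1) / 2 = (n + 0) ^ 2 * τ / 2 + (n ^ 2 : ℤ) by
    push_cast; ring, ee_add, ee_int, mul_one]

/-- Under `τ ↦ τ + 1` the constants `θ₃` and `θ₄` are exchanged and `θ₂` is multiplied by a root of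
unity, which its logarithmic derivative ignores. -/
lemma logDeriv_thetaNull_half_sub_add_one {τ : ℂ} (hτ : 0 < τ.im) :
    (2 * Real.pi * I)⁻¹ * logDeriv (thetaNull (1 / 2)) τ -
      (2 * Real.pi * I)⁻¹ * logDeriv (fun w => thetaNull 0 (w + 1)) τ =
    thetaNull 0 τ ^ 4 / 8 := by
  have h := logDeriv_thetaNull_half_sub_zero (im_add_one_pos hτ)
  rw [thetaNull_zero_add_two] at h
  rw [← h]
  congr 2
  · rw [logDeriv_apply, logDeriv_apply, ← deriv_comp_add_const,
      funext thetaNull_half_add_one, deriv_const_mul _ (differentiableAt_thetaNull _ hτ),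
      thetaNull_half_add_one, mul_div_mul_left _ _ (ee_ne_zero _)]
  · rw [logDeriv_apply, logDeriv_apply, deriv_comp_add_const]

lemma logDeriv_eta_eq {τ : ℂ} (hτ : 0 < τ.im) :
    3 * logDeriv ModularForm.eta τ = logDeriv (thetaNull (1 / 2)) τ + logDeriv (thetaNull 0) τ +
      logDeriv (fun w => thetaNull 0 (w + 1)) τ := by
  have hd2 := differentiableAt_thetaNull (1 / 2) hτ
  have hd3 := differentiableAt_thetaNull 0 hτ
  have hd4 : DifferentiableAt ℂ (fun w => thetaNull 0 (w + 1)) τ :=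
    differentiableAt_comp_add_const.2 (differentiableAt_thetaNull 0 (im_add_one_pos hτ))
  have h2 := thetaNull_half_ne_zero hτ
  have h3 := thetaNull_zero_ne_zero hτ
  have h4 := thetaNull_zero_ne_zero (im_add_one_pos hτ)
  have heta : DifferentiableAt ℂ ModularForm.eta τ :=
    ModularForm.differentiableAt_eta_of_mem_upperHalfPlaneSet hτ
  have hev : (fun w => thetaNull (1 / 2) w * thetaNull 0 w * thetaNull 0 (w + 1)) =ᶠ[𝓝 τ]
      fun w => 2 * ModularForm.eta w ^ 3 := by
    filter_upwards [(isOpen_lt continuous_const continuous_im).mem_nhds hτ] with w hw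
    exact thetaNull_mul_eq_eta hw
  have h := logDeriv_mul (f := fun w => thetaNull (1 / 2) w * thetaNull 0 w)
    (g := fun w => thetaNull 0 (w + 1)) τ (mul_ne_zero h2 h3) h4 (hd2.mul hd3) hd4
  rw [logDeriv_mul τ h2 h3 hd2 hd3] at h
  rw [← h, logDeriv_apply (fun w => _ * _), hev.deriv_eq, hev.eq_of_nhds, ← logDeriv_apply,
    logDeriv_const_mul _ _ two_ne_zero, logDeriv_fun_pow heta]
  simp

end EllipticD4

namespace EllipticD4

open Complex Filter Topology

/-! ### Transfer to the theta constants and Halphen functions on the upper half plane -/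

lemma qPow_eq_ee (s : ℝ) (τ : UpperHalfPlane) : qPow s τ = ee (s * τ) := by
  rw [qPow, ee]; ring_nf

lemma theta2_eq_thetaNull (τ : UpperHalfPlane) : theta2 τ = thetaNull (1 / 2) τ := by
  rw [theta2, thetaNull, ← (Equiv.addRight (1 : ℤ)).tsum_eq]
  refine tsum_congr fun n => ?_
  rw [qPow_eq_ee, Equiv.coe_addRight]
  push_cast
  ring_nf

lemma theta3_eq_thetaNull (τ : UpperHalfPlane) : theta3 τ = thetaNull 0 τ := by
  refine tsum_congr fun n => ?_
  rw [qPow_eq_ee]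
  push_cast
  ring_nf

lemma theta4_eq_thetaNull (τ : UpperHalfPlane) : theta4 τ = thetaNull 0 (τ + 1) := by
  rw [thetaNull_zero_add_one]
  refine tsum_congr fun n => ?_
  rw [qPow_eq_ee]
  push_cast
  ring_nf

lemma qLogDeriv_eq_logDeriv {f : UpperHalfPlane → ℂ} {g : ℂ → ℂ}
    (h : ∀ τ : UpperHalfPlane, f τ = g τ) (τ : UpperHalfPlane) :
    qLogDeriv f τ = (2 * Real.pi * I)⁻¹ * logDeriv g τ := by
  have hev : f ∘ UpperHalfPlane.ofComplex =ᶠ[𝓝 (τ : ℂ)] g := by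
    filter_upwards [(isOpen_lt continuous_const continuous_im).mem_nhds τ.im_pos] with w hw
    rw [Function.comp_apply, h, UpperHalfPlane.ofComplex_apply_of_im_pos hw]
  rw [qLogDeriv, Derivative.normalizedDerivOfComplex, hev.deriv_eq, h, logDeriv_apply,
    mul_div_assoc]

lemma xi2_sub_xi3 (τ : UpperHalfPlane) : xi2 τ - xi3 τ = theta4 τ ^ 4 / 4 := by
  rw [xi2, xi3, qLogDeriv_eq_logDeriv theta2_eq_thetaNull,
    qLogDeriv_eq_logDeriv theta3_eq_thetaNull, theta4_eq_thetaNull]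
  linear_combination 2 * logDeriv_thetaNull_half_sub_zero τ.im_pos

lemma xi2_sub_xi4 (τ : UpperHalfPlane) : xi2 τ - xi4 τ = theta3 τ ^ 4 / 4 := by
  rw [xi2, xi4, qLogDeriv_eq_logDeriv theta2_eq_thetaNull,
    qLogDeriv_eq_logDeriv (g := fun w => thetaNull 0 (w + 1)) theta4_eq_thetaNull,
    theta3_eq_thetaNull]
  linear_combination 2 * logDeriv_thetaNull_half_sub_add_one τ.im_pos

lemma qLogDeriv_eta (τ : UpperHalfPlane) : qLogDeriv eta τ = (xi2 τ + xi3 τ + xi4 τ) / 6 := by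
  rw [xi2, xi3, xi4, qLogDeriv_eq_logDeriv theta2_eq_thetaNull,
    qLogDeriv_eq_logDeriv theta3_eq_thetaNull,
    qLogDeriv_eq_logDeriv (g := fun w => thetaNull 0 (w + 1)) theta4_eq_thetaNull,
    qLogDeriv_eq_logDeriv (f := eta) (g := ModularForm.eta) fun _ => rfl]
  linear_combination (2 * Real.pi * I)⁻¹ / 3 * logDeriv_eta_eq τ.im_pos

/-! ### Specialized characters -/

lemma modularAnomaly_zero : modularAnomaly 0 = -1 / 6 := by
  simp [modularAnomaly, rho, fundWeight, form, delta, dotProduct, Fin.sum_univ_succ]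
  norm_num

lemma modularAnomaly_one : modularAnomaly 1 = 1 / 3 := by
  simp [modularAnomaly, rho, fundWeight, form, delta, dotProduct, Fin.sum_univ_succ]
  norm_num

lemma jacobiTheta₂_zero_eq_theta3 (τ : UpperHalfPlane) : jacobiTheta₂ 0 τ = theta3 τ := by
  rw [theta3_eq_thetaNull, thetaNull_eq_jacobiTheta₂]
  simp

lemma jacobiTheta₂_half_eq_theta4 (τ : UpperHalfPlane) : jacobiTheta₂ (1 / 2) τ = theta4 τ := by
  rw [theta4_eq_thetaNull, thetaNull_zero_add_one, jacobiTheta₂]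
  refine tsum_congr fun n => ?_
  rw [jacobiTheta₂_term_eq_ee, ee_add, mul_one_div, ee_int_div_two]

/-- The modular anomaly is exactly the exponent that cancels the power of `q` in `levelOneChar`.
Uniqueness permits replacing the chosen `ch i` by this explicit function. -/
lemma eta_pow_mul_chiZero {i : Fin 5} {ε s : ℂ} (hc : IsCharacter i (levelOneChar ε s))
    (hm : (modularAnomaly i : ℂ) = s - 1 / 6) (τ : UpperHalfPlane) :
    eta τ ^ 4 * chiZero i τ = (theta3 τ ^ 4 + ε * theta4 τ ^ 4) / 2 := by
  have hη : ModularForm.eta τ ^ 4 ≠ 0 := pow_ne_zero 4 (ModularForm.eta_ne_zero τ.im_pos)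
  have hp : ((τ : ℂ), (0 : Fin 4 → ℂ), (0 : ℂ)) ∈ domainY := τ.im_pos
  have hexp : exp (-(modularAnomaly i : ℂ) * pairing delta ((τ : ℂ), 0, 0)) =
      ee ((s - 1 / 6) * τ) := by
    rw [hm, ee]
    simp only [pairing, delta]
    congr 1
    simp
    ring
  have hee : ee ((s - 1 / 6) * τ) * ee (0 + (1 / 6 - s) * τ) = 1 := by
    rw [← ee_add, ← ee_zero]; ring_nf
  rw [chiZero, chi, hexp, (isCharacter_ch hc).eqOn hc hp, levelOneChar, eta]
  simp only [Pi.zero_apply, zero_add, Finset.prod_const, Finset.card_univ, Fintype.card_fin,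
    jacobiTheta₂_zero_eq_theta3, jacobiTheta₂_half_eq_theta4]
  rw [zero_add] at hee
  linear_combination (theta3 τ ^ 4 + ε * theta4 τ ^ 4) / 2 *
    (ee ((s - 1 / 6) * τ) * ee ((1 / 6 - s) * τ) * mul_inv_cancel₀ hη + hee)

end EllipticD4

end

theorem proposition7p3 :
    (∀ i : Fin 5, i = 0 ∨ i = 1 →
      EllipticD4.IsCharacter i (EllipticD4.ch i) ∧
        ∀ f, EllipticD4.IsCharacter i f →
          Set.EqOn f (EllipticD4.ch i) EllipticD4.domainY) ∧
    (∀ τ : UpperHalfPlane, EllipticD4.theta2 τ ≠ 0 ∧ EllipticD4.theta3 τ ≠ 0 ∧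
      EllipticD4.theta4 τ ≠ 0) ∧
    (∀ τ : UpperHalfPlane,
      EllipticD4.eta τ ^ 4 * EllipticD4.chiZero 0 τ =
          4 * EllipticD4.xi2 τ - 2 * EllipticD4.xi3 τ - 2 * EllipticD4.xi4 τ ∧
        EllipticD4.eta τ ^ 4 * EllipticD4.chiZero 1 τ =
          2 * EllipticD4.xi3 τ - 2 * EllipticD4.xi4 τ ∧
        EllipticD4.qLogDeriv EllipticD4.eta τ =
          (EllipticD4.xi2 τ + EllipticD4.xi3 τ + EllipticD4.xi4 τ) / 6) := by
  open EllipticD4 in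
  refine ⟨fun i hi => ?_, fun τ => ⟨?_, ?_, ?_⟩, fun τ => ⟨?_, ?_, qLogDeriv_eta τ⟩⟩
  · have hch : IsCharacter i (ch i) := by
      rcases hi with rfl | rfl
      · exact isCharacter_ch isCharacter_levelOneChar_zero
      · exact isCharacter_ch isCharacter_levelOneChar_one
    exact ⟨hch, fun f hf => hf.eqOn hch⟩
  · rw [theta2_eq_thetaNull]
    exact thetaNull_half_ne_zero τ.im_pos
  · rw [theta3_eq_thetaNull]
    exact thetaNull_zero_ne_zero τ.im_pos
  · rw [theta4_eq_thetaNull]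
    exact thetaNull_zero_ne_zero (im_add_one_pos τ.im_pos)
  · rw [eta_pow_mul_chiZero isCharacter_levelOneChar_zero (by rw [modularAnomaly_zero]; norm_num)]
    -- `4ξ₂ - 2ξ₃ - 2ξ₄` is twice the sum of `ξ₂ - ξ₃` and `ξ₂ - ξ₄`; below, `2ξ₃ - 2ξ₄` is twice
    -- the second minus the first.
    linear_combination -2 * xi2_sub_xi3 τ - 2 * xi2_sub_xi4 τ
  · rw [eta_pow_mul_chiZero isCharacter_levelOneChar_one (by rw [modularAnomaly_one]; norm_num)]
    linear_combination 2 * xi2_sub_xi3 τ - 2 * xi2_sub_xi4 τ
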